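/- Let $n\ge 2$, $r>1$. Let $Cl_m$ be the real Clifford algebra of $\mathbb R^m$ with $x^2=-\|x\|^2$, with the norm for which the products $e_{j_1}\cdots e_{j_k}$ ($j_1<\dots<j_k$) are orthonormal, and let $\tilde{\ }$ be its reversion. Regard $\mathbb R^n\subset\mathbb R^{n+1}$, put $e=e_{n+1}$, and let $c(u)=(eu+1)(u+e)^{-1}$ be the Cayley transformation $\mathbb R^n\to S^n\setminus\{e\}$. For a Möbius transformation $\psi(x)=(\alpha x+\beta)(\gamma x+\delta)^{-1}$ write $J(\psi,x)=\widetilde{(\gamma x+\delta)}/\|\gamma x+\delta\|^n$. **The manifold.** Let $S_1,S_2$ be two copies of $S^n$ and $S_j'=S_j\setminus c(\{\|u\|\le 1/r\})$. The manifold $M=S_1\wedge S_2(r)$ is obtained from $S_1'\sqcup S_2'$ by identifying $c(u)\in S_1'$ with $c(-u^{-1})=c(u/\|u\|^2)\in S_2'$ for $1/r<\|u\|<r$. The gluing map is the restriction of the Möbius transformation $\Psi(x)=(-ex)e^{-1}$ of the whole sphere (the reflection in the equator), for which $J(\Psi,x)=e$ and $J(\Psi^{-1},x)=-e$. It is an isometry,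 so the round metrics of $S_1',S_2'$ define a metric on $M$; unit normals and the surface measure $\sigma$ are taken with respect to it. **The bundle.** A left Clifford holomorphic section $f$ of the spinor bundle $E$ over an open $U\subset M$ is a pair of $Cl_{n+1}$-valued functions $f_j$ on $U\cap S'_j$ ($j=1,2$) such that $f_1(x)=J(\Psi,x)f_2(\Psi(x))$ on the glued part and such that, for each of the Möbius charts $\psi=c$ and $\psi=\Psi\circ c:u\mapsto(u-e)(eu-1)^{-1}$, the function $u\mapsto J(\psi,u)f_j(\psi(u))$ is, where defined, $Cl_n$-valued, differentiable and annihilated by $D=\sum_{i=1}^n e_i\,\partial/\partial u_i$. **The kernel.** With $G(x)=x/\|x\|^n$ for $x\in\mathbb R^{n+1}\setminus\{0\}$, the Cauchy kernel is $C_M(x,y)=G(x-y)$ if $x,y$ are both represented in the same $S'_j$; $C_M(x,y)=J(\Psi^{-1},y)\,G(x-\Psi^{-1}(y))$ if $x\in S_1'$, $y\in S_2'$; and $C_M(x,y)=J(\Psi,y)\,G(x-\Psi(y))$ if $x\in S_2'$, $y\in S_1'$. **Theorem.** Let $U\subset M$ be open and connected, and let $f$ be a left Clifford holomorphic section of $E$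 over $U$. Let $S\subset U$ be a strongly Lipschitz hypersurface (locally the image under a Möbius transformation of the graph of a Lipschitz function in $\mathbb R^n$, with bounded Lipschitz constants) that is the boundary of a subdomain $V\subset U$. Then for every $y\in V$ the integrand below is integrable over $S$ and $$f(y)=-\frac1{\omega_n}\int_S C_M(x,y)\,n(x)\,f(x)\,d\sigma(x),$$ where $n(x)$ is the unit vector in $TM_x$ that is orthogonal to $TS_x$ and points out of $V$ (it exists for almost every $x\in S$), $\sigma$ is the $(n-1)$-dimensional Lebesgue (surface) measure on $S$, and $\omega_n$ is the surface area of the unit sphere in $\mathbb R^n$. The formula holds for $f(y)$ read in either $S_1'$ or $S_2'$, with $y$ in the kernel read in the same way. -/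

import Mathlib

noncomputable section

open MeasureTheory Set Metric Topology
open scoped NNReal

namespace GluedSpheres

/-! ### The Clifford algebra of `ℝᵐ` with `x² = -‖x‖²`, and its norm -/

/-- Euclidean space `ℝᵐ`. -/
abbrev Euc (m : ℕ) : Type := EuclideanSpace ℝ (Fin m)

/-- The quadratic form `x ↦ -‖x‖²` on `ℝᵐ`. -/
def negNormSq (m : ℕ) : QuadraticForm ℝ (Euc m) :=
  -(LinearMap.BilinMap.toQuadraticMap (innerₗ (Euc m)))

theorem negNormSq_apply (m : ℕ) (x : Euc m) : negNormSq m x = -‖x‖ ^ 2 := by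
  simp [negNormSq, LinearMap.BilinMap.toQuadraticMap_apply]

/-- The real Clifford algebra `Clₘ`, of dimension `2ᵐ`. -/
abbrev Cl (m : ℕ) : Type := CliffordAlgebra (negNormSq m)

/-- The inclusion of `ℝᵐ` into `Clₘ`. -/
abbrev vec {m : ℕ} : Euc m →ₗ[ℝ] Cl m := CliffordAlgebra.ι (negNormSq m)

/-- The basis `e_{j₁} ⋯ e_{jᵣ}` (`j₁ < ⋯ < jᵣ`) of `Clₘ`; see `clBasis_apply`. -/
def clBasis (m : ℕ) : Module.Basis (Finset (Fin m)) ℝ (Cl m) :=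
  ((EuclideanSpace.basisFun (Fin m) ℝ).toBasis.ExteriorAlgebra).map
    (CliffordAlgebra.equivExterior (negNormSq m)).symm

theorem contractLeft_list_prod {m : ℕ} (Q : QuadraticForm ℝ (Euc m))
    (d : Module.Dual ℝ (Euc m)) (l : List (Euc m)) (h : ∀ v ∈ l, d v = 0) :
    CliffordAlgebra.contractLeft d ((l.map (CliffordAlgebra.ι Q)).prod) = 0 := by
  induction l with
  | nil => simp
  | cons a l ih =>
    have h1 := ih fun v hv => h v (List.mem_cons_of_mem _ hv)
    simp [CliffordAlgebra.contractLeft_ι_mul, h1, h a]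

theorem associated_negNormSq (m : ℕ) (x y : Euc m) :
    QuadraticMap.associated (R := ℝ) (-(negNormSq m)) x y = inner ℝ x y := by
  rw [negNormSq, neg_neg, QuadraticMap.associated_left_inverse]
  · rfl
  · exact fun x y => by simp [real_inner_comm]

theorem equivExterior_list_prod {m : ℕ} (l : List (Euc m))
    (h : l.Pairwise fun v w => inner ℝ v w = 0) :
    CliffordAlgebra.equivExterior (negNormSq m)
      ((l.map (CliffordAlgebra.ι (negNormSq m))).prod) =
        ((l.map (ExteriorAlgebra.ι ℝ)).prod) := by
  induction l with
  | nil => simp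
  | cons a l ih =>
    rw [List.pairwise_cons] at h
    have h1 := ih h.2
    simp only [CliffordAlgebra.equivExterior, CliffordAlgebra.changeFormEquiv_apply] at h1 ⊢
    rw [List.map_cons, List.prod_cons, CliffordAlgebra.changeForm_ι_mul, h1,
      List.map_cons, List.prod_cons]
    have h2 := contractLeft_list_prod (0 : QuadraticForm ℝ (Euc m))
      (QuadraticMap.associated (R := ℝ) (-(negNormSq m)) a) l
      (fun v hv => by rw [associated_negNormSq]; exact h.1 v hv)
    erw [h2]
    simp [ExteriorAlgebra.ι]

theorem clBasis_apply (m : ℕ) (s : Finset (Fin m)) :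
    clBasis m s = ((s.sort (· ≤ ·)).map fun i => vec (EuclideanSpace.single i (1 : ℝ))).prod := by
  have h1 : (((s.sort (· ≤ ·)).map fun i => (EuclideanSpace.single i (1 : ℝ) : Euc m))).Pairwise
      fun v w => inner ℝ v w = 0 := by
    rw [List.pairwise_map]
    refine (s.sort_nodup (· ≤ ·)).imp ?_
    intro a b hab
    simp [EuclideanSpace.inner_single_left, hab]
  rw [clBasis, Module.Basis.map_apply, LinearEquiv.symm_apply_eq]
  have h2 := equivExterior_list_prod _ h1
  rw [List.map_map, List.map_map] at h2
  refine Eq.trans ?_ h2.symm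
  rw [ExteriorAlgebra.basis_apply_ofCard _ rfl]
  refine (ExteriorAlgebra.ιMulti_apply _).trans ?_
  congr 1
  apply List.ext_getElem
  · simp
  · intro i h3 h4
    simp
    rfl

/-- The norm of `Clₘ` for which the basis `e_{j₁} ⋯ e_{jᵣ}` is orthonormal. -/
def clCoord (m : ℕ) : Cl m →ₗ[ℝ] EuclideanSpace ℝ (Finset (Fin m)) :=
  (WithLp.linearEquiv 2 ℝ (Finset (Fin m) → ℝ)).symm.toLinearMap ∘ₗ
    (clBasis m).equivFun.toLinearMap

theorem clCoord_injective (m : ℕ) : Function.Injective (clCoord m) := by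
  exact (((clBasis m).equivFun).trans
    (WithLp.linearEquiv 2 ℝ (Finset (Fin m) → ℝ)).symm).injective

instance (m : ℕ) : NormedAddCommGroup (Cl m) :=
  NormedAddCommGroup.induced (Cl m) _ (clCoord m) (clCoord_injective m)

instance (m : ℕ) : NormedSpace ℝ (Cl m) := NormedSpace.induced ℝ (Cl m) _ (clCoord m)

/-! ### Vectors, the Cayley transformation and the inversion -/

/-- The inclusion `ℝⁿ ⊂ ℝⁿ⁺¹`, with last coordinate `0`. -/
def emb {n : ℕ} : Euc n →ₗ[ℝ] Euc (n + 1) where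
  toFun u := WithLp.toLp 2 (Fin.snoc (fun i => u i) 0)
  map_add' u v := by
    ext i
    refine Fin.lastCases ?_ (fun i => ?_) i <;> simp
  map_smul' a u := by
    ext i
    refine Fin.lastCases ?_ (fun i => ?_) i <;> simp

/-- The unit vector `e = e_{n+1}` of `ℝⁿ⁺¹`. -/
def pole (n : ℕ) : Euc (n + 1) := EuclideanSpace.single (Fin.last n) 1

theorem norm_emb {n : ℕ} (u : Euc n) : ‖emb u‖ = ‖u‖ := by
  simp [EuclideanSpace.norm_eq, Fin.sum_univ_castSucc, emb]

theorem norm_pole (n : ℕ) : ‖pole n‖ = 1 := by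
  simp [pole]

theorem vec_mul_self {m : ℕ} (x : Euc m) : vec x * vec x = algebraMap ℝ (Cl m) (-‖x‖ ^ 2) := by
  rw [CliffordAlgebra.ι_sq_scalar, negNormSq_apply]

theorem vec_mul_add {m : ℕ} (x y : Euc m) :
    vec x * vec y + vec y * vec x = algebraMap ℝ (Cl m) (-2 * inner ℝ x y) := by
  rw [CliffordAlgebra.ι_mul_ι_add_swap]
  congr 1
  simp only [QuadraticMap.polar, negNormSq_apply]
  rw [@norm_add_sq_real]
  ring

theorem vec_emb_mul_pole {n : ℕ} (u : Euc n) :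
    vec (emb u) * vec (pole n) = -(vec (pole n) * vec (emb u)) := by
  have h := vec_mul_add (emb u) (pole n)
  have h2 : inner ℝ (emb u) (pole n) = 0 := by
    simp [pole, emb, EuclideanSpace.inner_single_right]
  rw [h2] at h
  simp only [mul_zero, map_zero] at h
  exact eq_neg_of_add_eq_zero_left h

/-- The inversion `u ↦ -u⁻¹ = u / ‖u‖²` of `ℝⁿ`; see `kelvin_spec`. -/
def kelvin {n : ℕ} (u : Euc n) : Euc n := (‖u‖ ^ 2)⁻¹ • u

theorem kelvin_spec {n : ℕ} {u : Euc n} (hu : u ≠ 0) : vec (kelvin u) * vec u = -1 := by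
  have h : ‖u‖ ≠ 0 := norm_ne_zero_iff.mpr hu
  rw [kelvin, map_smul, smul_mul_assoc, vec_mul_self, ← map_one (algebraMap ℝ (Cl n)),
    ← map_neg, Algebra.smul_def, ← map_mul]
  congr 1
  field_simp

/-- The Cayley transformation `c u = (e u + 1)(u + e)⁻¹` from `ℝⁿ` onto `Sⁿ \ {e}`;
see `cayley_spec`. -/
def cayley {n : ℕ} (u : Euc n) : Euc (n + 1) :=
  (‖u‖ ^ 2 + 1)⁻¹ • ((-2 : ℝ) • emb u + (‖u‖ ^ 2 - 1) • pole n)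

theorem cayley_spec {n : ℕ} (u : Euc n) :
    vec (cayley u) * (vec (emb u) + vec (pole n)) = vec (pole n) * vec (emb u) + 1 := by
  have h : ‖u‖ ^ 2 + 1 ≠ 0 := by positivity
  rw [cayley, map_smul, smul_mul_assoc, inv_smul_eq_iff₀ h, map_add, map_smul, map_smul]
  simp only [add_mul, mul_add, smul_mul_assoc, vec_mul_self, norm_emb, norm_pole,
    vec_emb_mul_pole, Algebra.algebraMap_eq_smul_one]
  module

/-- The reflection `Ψ x = (-e x) e⁻¹ = e x e` of `Sⁿ` in the equator; it is the Möbius map of the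
whole sphere that continues `c ∘ (u ↦ -u⁻¹) ∘ c⁻¹`, see `reflect_spec` and `reflect_cayley`. -/
def reflect {n : ℕ} (x : Euc (n + 1)) : Euc (n + 1) := x - (2 * x (Fin.last n)) • pole n

theorem reflect_spec {n : ℕ} (x : Euc (n + 1)) :
    vec (reflect x) * vec (pole n) = -(vec (pole n)) * vec x := by
  have h := vec_mul_add x (pole n)
  have h2 : inner ℝ x (pole n) = x (Fin.last n) := by
    simp [pole, EuclideanSpace.inner_single_right]
  rw [h2] at h
  rw [reflect, map_sub, map_smul, sub_mul, smul_mul_assoc, vec_mul_self, norm_pole,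
    eq_sub_of_add_eq h]
  simp only [Algebra.algebraMap_eq_smul_one, neg_mul]
  module

theorem reflect_cayley {n : ℕ} {u : Euc n} (hu : u ≠ 0) :
    reflect (cayley u) = cayley (kelvin u) := by
  have h : ‖u‖ ≠ 0 := norm_ne_zero_iff.mpr hu
  have h1 : (cayley u) (Fin.last n) = (‖u‖ ^ 2 + 1)⁻¹ * (‖u‖ ^ 2 - 1) := by
    simp [cayley, pole, emb]
  have h3 : ‖kelvin u‖ = ‖u‖⁻¹ := by
    rw [kelvin, norm_smul]
    simp only [norm_inv, norm_pow, norm_norm]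
    field_simp
  rw [reflect, h1]
  simp only [cayley, h3]
  rw [kelvin, map_smul]
  have e1 : (‖u‖ ^ 2 + 1)⁻¹ = (‖u‖⁻¹ ^ 2 + 1)⁻¹ * (‖u‖ ^ 2)⁻¹ := by
    field_simp
    ring
  have e2 : (‖u‖ ^ 2 + 1)⁻¹ * (1 - ‖u‖ ^ 2) = (‖u‖⁻¹ ^ 2 + 1)⁻¹ * (‖u‖⁻¹ ^ 2 - 1) := by
    field_simp
    ring
  simp only [smul_add, smul_smul]
  rw [show (‖u‖⁻¹ ^ 2 + 1)⁻¹ * (‖u‖⁻¹ ^ 2 - 1) = (‖u‖ ^ 2 + 1)⁻¹ * (1 - ‖u‖ ^ 2) from e2.symm,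
    show (‖u‖⁻¹ ^ 2 + 1)⁻¹ * (-2 * (‖u‖ ^ 2)⁻¹) = (‖u‖ ^ 2 + 1)⁻¹ * (-2) by rw [e1]; ring]
  module

/-- Two Möbius charts `ℝⁿ → Sⁿ` that cover the sphere: `chart false = c`, and
`chart true = Ψ ∘ c`, that is `u ↦ (u - e)(e u - 1)⁻¹`, the Möbius continuation of
`c ∘ (u ↦ -u⁻¹)` to `0`; see `chart_spec`. -/
def chart {n : ℕ} (κ : Bool) (u : Euc n) : Euc (n + 1) :=
  if κ then reflect (cayley u) else cayley u

/-- The numerator `a u + b` of the Möbius transformation `chart κ`. -/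
def chartNum {n : ℕ} (κ : Bool) (u : Euc n) : Cl (n + 1) :=
  if κ then vec (emb u) - vec (pole n) else vec (pole n) * vec (emb u) + 1

/-- The denominator `c u + d` of the Möbius transformation `chart κ`. -/
def chartDen {n : ℕ} (κ : Bool) (u : Euc n) : Cl (n + 1) :=
  if κ then vec (pole n) * vec (emb u) - 1 else vec (emb u) + vec (pole n)

theorem chart_spec {n : ℕ} (κ : Bool) (u : Euc n) :
    vec (chart κ u) * chartDen κ u = chartNum κ u := by
  cases κ
  · simpa [chart, chartDen, chartNum] using cayley_spec u
  · have hp : vec (pole n) * vec (pole n) = -1 := by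
      rw [vec_mul_self, norm_pole]; simp
    have h1 : vec (pole n) * vec (emb u) - 1 =
        vec (pole n) * (vec (emb u) + vec (pole n)) := by
      rw [mul_add, hp, sub_eq_add_neg]
    simp only [chart, chartDen, chartNum, if_true]
    rw [h1, ← mul_assoc, reflect_spec, mul_assoc, cayley_spec, mul_add, ← mul_assoc, neg_mul, hp]
    simp [sub_eq_add_neg]

/-- The conformal weight `J = (c u + d)~ / ‖c u + d‖ⁿ` of a Möbius transformation with denominator
`A = c u + d`. -/
def weight (n : ℕ) (A : Cl (n + 1)) : Cl (n + 1) :=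
  (‖A‖ ^ n)⁻¹ • CliffordAlgebra.reverse A

/-! ### The manifold `S₁ ∧ S₂(r)` -/

/-- `S'_j = Sⁿ \ c(closed ball of radius 1/r)`. -/
def cap (n : ℕ) (r : ℝ) : Set (Euc (n + 1)) :=
  sphere 0 1 \ cayley '' closedBall (0 : Euc n) (1 / r)

/-- The spherical annulus `c(A(0,1/r,r))`, the part of each `S'_j` that is glued to the other. -/
def annulus (n : ℕ) (r : ℝ) : Set (Euc (n + 1)) :=
  cayley '' {u : Euc n | 1 / r < ‖u‖ ∧ ‖u‖ < r}

/-- The disjoint union of `S'_1` (index `0`) and `S'_2` (index `1`). -/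
abbrev Caps (n : ℕ) (r : ℝ) : Type := Fin 2 × cap n r

/-- `c(u)` in the first sphere is glued to `c(-u⁻¹)` in the second, for `1/r < ‖u‖ < r`. -/
def Glue (n : ℕ) (r : ℝ) (p q : Caps n r) : Prop :=
  ∃ u : Euc n, 1 / r < ‖u‖ ∧ ‖u‖ < r ∧ p.1 = 0 ∧ q.1 = 1 ∧
    (p.2 : Euc (n + 1)) = cayley u ∧ (q.2 : Euc (n + 1)) = cayley (kelvin u)

/-- The manifold `S₁ ∧ S₂(r)`, with the quotient topology. -/
def Wedge (n : ℕ) (r : ℝ) : Type := Quot (Glue n r)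

instance (n : ℕ) (r : ℝ) : TopologicalSpace (Wedge n r) :=
  inferInstanceAs (TopologicalSpace (Quot (Glue n r)))

variable {n : ℕ} {r : ℝ}

/-- The point of `S₁ ∧ S₂(r)` represented by `x ∈ S'_j`. -/
def pt (j : Fin 2) (x : Euc (n + 1)) (h : x ∈ cap n r) : Wedge n r :=
  Quot.mk (Glue n r) (j, ⟨x, h⟩)

/-- The part of `U ⊂ S₁ ∧ S₂(r)` in `S'_j`, as a subset of the sphere in `ℝⁿ⁺¹`. -/
def part (U : Set (Wedge n r)) (j : Fin 2) : Set (Euc (n + 1)) :=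
  {x | ∃ h : x ∈ cap n r, pt j x h ∈ U}

/-! ### The spinor bundle and its Clifford holomorphic sections -/

/-- `Clₙ` as a subalgebra of `Clₙ₊₁`. -/
def clSub (n : ℕ) : Subalgebra ℝ (Cl (n + 1)) :=
  Algebra.adjoin ℝ (range fun u : Euc n => vec (emb u))

/-- The Dirac operator `D = ∑ eⱼ ∂/∂xⱼ` of `ℝⁿ`. -/
def dirac (g : Euc n → Cl (n + 1)) (u : Euc n) : Cl (n + 1) :=
  ∑ i : Fin n, vec (emb (EuclideanSpace.single i (1 : ℝ))) *
    fderiv ℝ g u (EuclideanSpace.single i (1 : ℝ))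

/-- `g` is a `Clₙ`-valued left Clifford holomorphic function on the open set `O ⊂ ℝⁿ`. -/
def IsCliffordHolomorphicOn (g : Euc n → Cl (n + 1)) (O : Set (Euc n)) : Prop :=
  ∀ u ∈ O, g u ∈ clSub n ∧ DifferentiableAt ℝ g u ∧ dirac g u = 0

/-- The denominator `c x + d` of the gluing map on `S'_j`: `Ψ` has the Vahlen matrix
`diag (-e, e)` (the product of those of `c`, `u ↦ -u⁻¹` and `c⁻¹`) and is used to pass from `S'_1`
to `S'_2`; its inverse, with the inverse matrix `diag (e, -e)`, is used from `S'_2` to `S'_1`. -/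
def glueDen (n : ℕ) (j : Fin 2) : Cl (n + 1) :=
  if j = 0 then vec (pole n) else -vec (pole n)

/-- A left Clifford holomorphic section over `U` of the spinor bundle `E`, given by its
representatives `F j` over the two spheres, with values in `Clₙ₊₁`. Over the glued part the
representatives are related by `F₁(x) = J(Ψ, x) F₂(Ψ x)`. In the Möbius charts `ψ` of each sphere,
`J(ψ, u) F_j(ψ u)` is a `Clₙ`-valued left Clifford holomorphic function; the values at `x` thus lie
in a subspace of dimension `2ⁿ` of `Clₙ₊₁`, the fibre of `E`. (The values of `F j` outside `U` play
no role.) -/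
structure IsHolomorphicSection (U : Set (Wedge n r)) (F : Fin 2 → Euc (n + 1) → Cl (n + 1)) :
    Prop where
  glue : ∀ x ∈ part U 0 ∩ annulus n r, F 0 x = weight n (glueDen n 0) * F 1 (reflect x)
  holomorphic : ∀ (j : Fin 2) (κ : Bool),
    IsCliffordHolomorphicOn (fun u => weight n (chartDen κ u) * F j (chart κ u))
      {u | chart κ u ∈ part U j}

/-! ### The Cauchy kernel -/

/-- `G(x) = x / ‖x‖ⁿ`, on `ℝⁿ⁺¹`. -/
def cauchyG (n : ℕ) (x : Euc (n + 1)) : Cl (n + 1) := (‖x‖ ^ n)⁻¹ • vec x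

/-- The Cauchy kernel `C_M(x,y)`, for the representatives `x ∈ S'_i` and `y ∈ S'_j`: it is
`(x-y)/‖x-y‖ⁿ` if `i = j`, and it is carried to the other sphere in the variable `y` by the Möbius
transformation `Ψ^{±1}` of the whole sphere and its weight, if `i ≠ j`. -/
def cauchyKernel (i : Fin 2) (x : Euc (n + 1)) (j : Fin 2) (y : Euc (n + 1)) : Cl (n + 1) :=
  if i = j then cauchyG n (x - y) else weight n (glueDen n j) * cauchyG n (x - reflect y)

/-! ### Strongly Lipschitz hypersurfaces, outward normal, surface integral -/

/-- `T` is, on `W ⊂ ℝⁿ`, a Möbius transformation of `ℝⁿ ∪ {∞}` (without pole on `W`): a similarity,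
possibly after an inversion. -/
def IsMobiusOn (T : Euc n → Euc n) (W : Set (Euc n)) : Prop :=
  ∃ (A : Euc n ≃ₗᵢ[ℝ] Euc n) (a b : Euc n) (s : ℝ), 0 < s ∧
    ((∀ u ∈ W, T u = b + s • A (u - a)) ∨
      (a ∉ W ∧ ∀ u ∈ W, T u = b + s • A (kelvin (u - a))))

/-- The graph of `φ` over the hyperplane `w^⊥`, in the direction of the unit vector `w`. -/
def lipGraph (w : Euc n) (φ : Euc n → ℝ) : Set (Euc n) :=
  {u | inner ℝ u w = φ (u - (inner ℝ u w : ℝ) • w)}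

/-- Near each of its points, `S` is the image under a Möbius transformation from `ℝⁿ` of the graph
of a Lipschitz function, and the Lipschitz constants are bounded. -/
def IsStronglyLipschitz (S : Set (Wedge n r)) : Prop :=
  ∃ L : ℝ≥0, ∀ p ∈ S, ∃ (j : Fin 2) (κ : Bool) (W : Set (Euc n)) (T : Euc n → Euc n)
    (w : Euc n) (φ : Euc n → ℝ),
    IsOpen W ∧ IsMobiusOn T W ∧ ‖w‖ = 1 ∧ LipschitzWith L φ ∧
    (∀ u ∈ W, chart κ (T u) ∈ cap n r) ∧
    (∃ u ∈ W, ∃ h : chart κ (T u) ∈ cap n r, pt j (chart κ (T u)) h = p) ∧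
    ∀ u ∈ W, (chart κ (T u) ∈ part S j ↔ u ∈ lipGraph w φ)

/-- `ν` is the outward unit normal at the boundary point `x` of `V ⊂ Sⁿ`: a unit vector tangent to
`Sⁿ` at `x`, such that near `x` every cone around `ν` lies outside `V` and every cone around `-ν`
lies inside `V`. So `∂V` is tangent to `ν^⊥` at `x`, and `ν` points out of `V`. -/
def IsOutwardNormal (V : Set (Euc (n + 1))) (x ν : Euc (n + 1)) : Prop :=
  ‖ν‖ = 1 ∧ inner ℝ x ν = 0 ∧ ∀ ε > (0 : ℝ), ∀ᶠ p in 𝓝[sphere 0 1] x,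
    (ε * ‖p - x‖ < inner ℝ (p - x) ν → p ∉ V) ∧ (inner ℝ (p - x) ν < -(ε * ‖p - x‖) → p ∈ V)

open Classical in
/-- The outward unit normal `n(x)`, where it exists (almost everywhere on a Lipschitz boundary; it
is then unique). -/
def outwardNormal (V : Set (Euc (n + 1))) (x : Euc (n + 1)) : Euc (n + 1) :=
  if h : ∃ ν, IsOutwardNormal V x ν then h.choose else 0

/-- A subset `S` of `S₁ ∧ S₂(r)` is the disjoint union of its part in `S'_1` and its part in
`M₂ = S'_2 \ S_{21}`. -/
def sheet (S : Set (Wedge n r)) (i : Fin 2) : Set (Euc (n + 1)) :=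
  if i = 0 then part S 0 else part S 1 \ annulus n r

/-- The surface area of the unit sphere of `ℝⁿ`. -/
def sphereArea (n : ℕ) : ℝ := n * (volume (ball (0 : Euc n) 1)).toReal

/-- The integrand `C_M(x,y) n(x) f(x)`, for the representatives `x ∈ S'_i` and `y ∈ S'_j`, where
`n(x)` is the outward normal of `V`. Its value depends only on the point of `S₁ ∧ S₂(r)`
represented by `x`, and not on the representative. -/
def cauchyIntegrand (V : Set (Wedge n r)) (F : Fin 2 → Euc (n + 1) → Cl (n + 1))
    (j : Fin 2) (y : Euc (n + 1)) (i : Fin 2) (x : Euc (n + 1)) : Cl (n + 1) :=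
  cauchyKernel i x j y * vec (outwardNormal (part V i) x) * F i x

end GluedSpheres

end

noncomputable section

open MeasureTheory Set Metric Topology
open scoped NNReal

namespace GluedSpheres

/-! ### The area formula -/

section AreaFormula

open Module Filter
open scoped ENNReal

set_option linter.unusedSectionVars false

variable {E F G : Type*} [NormedAddCommGroup E] [InnerProductSpace ℝ E] [FiniteDimensional ℝ E]
  [MeasurableSpace E] [BorelSpace E] [NormedAddCommGroup F] [InnerProductSpace ℝ F]
  [FiniteDimensional ℝ F] [MeasurableSpace F] [BorelSpace F]
  [NormedAddCommGroup G] [NormedSpace ℝ G]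

/-! The gluing map is the restriction of an isometry of the whole sphere, so the glued manifold is
again a round sphere. Points of `S'_1` are kept, points of `S'_2` are reflected, and since `r > 1`
the two caps cover everything (`isClosedEmbedding_toSphere`). The transition rule of the bundle says
exactly that the representatives of a section fit together to one function `g` on the sphere
(`sphereSection`), and the integrand becomes a constant times `G(x - y) n(x) g(x)`
(`cauchyIntegrand_eq`). What remains is Cauchy's formula for a domain `V` of the sphere,
`IsCauchyDomain.cauchy_formula`.

That formula rests on conformal covariance. Put `d = u + e` in a stereographic chart. The derivative
of the chart sends `v` to a multiple of `d v d`, and `(c(u) - y) d` is affine in `u`. So the left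
`d` turns `G(x - y)` into a Euclidean kernel and the right `d` is the spinor weight of `g`
(`conf_smul_cauchyG_mul`). The new kernel solves the Dirac equation from the right away from its
pole (`kern_monogenic`), and at a pole in the chart it is a constant times `G(u - v)` (`kern_pole`).

For a test function `η` compare `∫_V G(x - y) ∇η g` with `∫_{∂V} η G(x - y) n g`. If `η` lives in
`V` away from `y`, both vanish, because `K ∇ζ h` is a divergence when `K D = 0` and `D h = 0`. If
`η` lives near a boundary point, they agree (`IsGraphPatch.setIntegral_boundary`). If `η` is a
cutoff `b` equal to 1 near `y`, the volume integral is `ω_n g(y)` (`integral_kern_pole`).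
Telescoping over finitely many cutoffs gives agreement for `1 - b`, which is 1 on `∂V` and has
gradient `-∇b`; hence the boundary integral is `-ω_n g(y)`.

The boundary case is the divergence theorem below a Lipschitz graph, pulled back by a Möbius map.
The graph function is mollified, the indicator of the region below it is replaced by smooth steps,
and Rademacher's theorem with dominated convergence gives the limit (`integral_below_graph`). An
area formula for injective maps into a space of larger dimension turns the flux into a Hausdorff
integral, where all conformal factors cancel. `V` may lie on both sides of its boundary; there no
outward normal exists, its default value is 0, and the two one-sided fluxes cancel as well. -/

theorem continuous_normDet : Continuous fun A : E →L[ℝ] F => A.toLinearMap.normDet := by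
  have h : (fun A : E →L[ℝ] F => A.toLinearMap.normDet) = fun A : E →L[ℝ] F =>
      √((Matrix.gram ℝ (fun i => A (stdOrthonormalBasis ℝ E i))).det) := by
    funext A
    have h1 := LinearMap.normDet_sq_eq_det_gram A.toLinearMap (stdOrthonormalBasis ℝ E)
    rw [← Real.sqrt_sq (LinearMap.normDet_nonneg _)]
    exact congrArg Real.sqrt h1
  rw [h]
  refine Real.continuous_sqrt.comp (Continuous.matrix_det ?_)
  refine continuous_matrix fun i j => ?_
  simp only [Matrix.gram_apply]
  fun_prop

/-- The hypothesis makes `f ∘ g⁻¹` a well-defined `K`-Lipschitz map on `g '' s`. Comparing two maps,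
and not a map with its domain, allows a nonlinear `f` to be compared with its linearization in both
directions. -/
theorem euclideanHausdorffMeasure_image_le_of_lipschitz {X : Type*} {f : X → E} {g : X → F}
    {s : Set X} {K : ℝ≥0} (d : ℕ)
    (h : ∀ x ∈ s, ∀ y ∈ s, dist (f x) (f y) ≤ K * dist (g x) (g y)) :
    (Measure.euclideanHausdorffMeasure d : Measure E) (f '' s) ≤
      (K : ℝ≥0∞) ^ d * (Measure.euclideanHausdorffMeasure d : Measure F) (g '' s) := by
  rcases s.eq_empty_or_nonempty with rfl | ⟨x₀, hx₀⟩
  · simp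
  have : Nonempty X := ⟨x₀⟩
  have hinv : ∀ y ∈ g '' s, Function.invFunOn g s y ∈ s ∧ g (Function.invFunOn g s y) = y :=
    fun y hy => ⟨Function.invFunOn_mem hy, Function.invFunOn_eq hy⟩
  have hL : LipschitzOnWith K (f ∘ Function.invFunOn g s) (g '' s) := by
    refine LipschitzOnWith.of_dist_le_mul fun a ha b hb => ?_
    have := h _ (hinv a ha).1 _ (hinv b hb).1
    rwa [(hinv a ha).2, (hinv b hb).2] at this
  have himg : f '' s = (f ∘ Function.invFunOn g s) '' (g '' s) := by
    rw [image_image]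
    refine image_congr fun x hx => ?_
    have h1 := hinv (g x) (mem_image_of_mem g hx)
    have := h x hx _ h1.1
    rw [h1.2, dist_self, mul_zero] at this
    exact dist_le_zero.1 this
  rw [himg, Measure.euclideanHausdorffMeasure_def, Measure.euclideanHausdorffMeasure_def,
    Measure.smul_apply, Measure.smul_apply, Measure.nnreal_smul_coe_apply,
    Measure.nnreal_smul_coe_apply, mul_left_comm]
  gcongr
  have := hL.hausdorffMeasure_image_le (d := (d : ℝ)) (by positivity)
  simpa using this

/-- Both determinants are read off as the factor by which the unit ball changes its Hausdorff
measure, so the comparison of measures above applies. -/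
theorem normDet_le_of_norm_le {A B : E →L[ℝ] F} {K : ℝ≥0} (h : ∀ v, ‖A v‖ ≤ K * ‖B v‖) :
    A.toLinearMap.normDet ≤ K ^ finrank ℝ E * B.toLinearMap.normDet := by
  have h1 := euclideanHausdorffMeasure_image_le_of_lipschitz (f := A) (g := B)
    (s := ball (0 : E) 1) (K := K) (finrank ℝ E) (fun x _ y _ => by
      rw [dist_eq_norm, dist_eq_norm, ← map_sub, ← map_sub]; exact h _)
  have e1 := LinearMap.euclideanHausdorffMeasure_image_eq_normDet_mul_volume A.toLinearMap
    (ball (0 : E) 1)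
  have e2 := LinearMap.euclideanHausdorffMeasure_image_eq_normDet_mul_volume B.toLinearMap
    (ball (0 : E) 1)
  simp only [ContinuousLinearMap.coe_coe] at e1 e2
  rw [e1, e2, ← mul_assoc] at h1
  have hv : volume (ball (0 : E) 1) ≠ 0 := (measure_ball_pos _ _ one_pos).ne'
  have hv' : volume (ball (0 : E) 1) ≠ ⊤ := measure_ball_lt_top.ne
  rw [ENNReal.mul_le_mul_iff_left hv hv'] at h1
  have hB := LinearMap.normDet_nonneg B.toLinearMap
  rw [← ENNReal.coe_pow, ← ENNReal.ofReal_coe_nnreal, ← ENNReal.ofReal_mul (by positivity),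
    ENNReal.ofReal_le_ofReal_iff (by positivity)] at h1
  simpa using h1

/-- The two-sided estimate on a piece on which `f` and its derivative are close to `B`. -/
theorem euclideanHausdorffMeasure_image_piece {f : E → F} {f' : E → E →L[ℝ] F} {B : E →L[ℝ] F}
    {p : Set E} {K : ℝ≥0} (hp : MeasurableSet p)
    (h1 : ∀ x ∈ p, ∀ y ∈ p, dist (f x) (f y) ≤ K * dist (B x) (B y))
    (h2 : ∀ x ∈ p, ∀ y ∈ p, dist (B x) (B y) ≤ K * dist (f x) (f y))
    (h3 : ∀ x ∈ p, ∀ v, ‖f' x v‖ ≤ K * ‖B v‖)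
    (h4 : ∀ x ∈ p, ∀ v, ‖B v‖ ≤ K * ‖f' x v‖) :
    (Measure.euclideanHausdorffMeasure (finrank ℝ E) : Measure F) (f '' p) ≤
      ((K : ℝ≥0∞) ^ finrank ℝ E) ^ 2 *
        ∫⁻ x in p, ENNReal.ofReal (f' x).toLinearMap.normDet ∧
    ∫⁻ x in p, ENNReal.ofReal (f' x).toLinearMap.normDet ≤ ((K : ℝ≥0∞) ^ finrank ℝ E) ^ 2 *
      (Measure.euclideanHausdorffMeasure (finrank ℝ E) : Measure F) (f '' p) := by
  have e2 := LinearMap.euclideanHausdorffMeasure_image_eq_normDet_mul_volume B.toLinearMap p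
  simp only [ContinuousLinearMap.coe_coe] at e2
  have hK : ∀ {a b : ℝ}, 0 ≤ b → a ≤ K ^ finrank ℝ E * b →
      ENNReal.ofReal a ≤ (K : ℝ≥0∞) ^ finrank ℝ E * ENNReal.ofReal b := by
    intro a b hb hab
    rw [← ENNReal.coe_pow, ← ENNReal.ofReal_coe_nnreal, ← ENNReal.ofReal_mul (by positivity)]
    exact ENNReal.ofReal_le_ofReal (by simpa using hab)
  have i1 : ENNReal.ofReal B.toLinearMap.normDet * volume p ≤ (K : ℝ≥0∞) ^ finrank ℝ E *
      ∫⁻ x in p, ENNReal.ofReal (f' x).toLinearMap.normDet := by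
    rw [← lintegral_const_mul' _ _ (by finiteness), ← setLIntegral_const]
    refine setLIntegral_mono' hp fun x hx => ?_
    exact hK (LinearMap.normDet_nonneg _) (normDet_le_of_norm_le (h4 x hx))
  have i2 : ∫⁻ x in p, ENNReal.ofReal (f' x).toLinearMap.normDet ≤ (K : ℝ≥0∞) ^ finrank ℝ E *
      (ENNReal.ofReal B.toLinearMap.normDet * volume p) := by
    rw [← mul_assoc, ← setLIntegral_const]
    refine setLIntegral_mono' hp fun x hx => ?_
    exact hK (LinearMap.normDet_nonneg _) (normDet_le_of_norm_le (h3 x hx))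
  constructor
  · refine (euclideanHausdorffMeasure_image_le_of_lipschitz (finrank ℝ E) h1).trans ?_
    rw [e2, sq, mul_assoc]
    gcongr
  · refine i2.trans ?_
    rw [← e2, sq, mul_assoc]
    gcongr
    exact euclideanHausdorffMeasure_image_le_of_lipschitz (finrank ℝ E) h2

/-- The error is at most `(1 - 1/K) ‖B v‖`, so `‖a‖` lies between `‖B v‖ / K` and `(2 - 1/K) ‖B v‖`,
and `2 - 1/K ≤ K`. -/
theorem norm_le_of_norm_sub_le {B : E →L[ℝ] F} {K c δ : ℝ} (hK : 1 < K)
    (hδ : δ = (1 - K⁻¹) * c) (hB : ∀ v, c * ‖v‖ ≤ ‖B v‖) {a : F} {v : E}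
    (h : ‖a - B v‖ ≤ δ * ‖v‖) : ‖a‖ ≤ K * ‖B v‖ ∧ ‖B v‖ ≤ K * ‖a‖ := by
  have hK0 : 0 < K := one_pos.trans hK
  have hK1 : K⁻¹ < 1 := inv_lt_one_of_one_lt₀ hK
  have h1 : ‖a - B v‖ ≤ (1 - K⁻¹) * ‖B v‖ := by
    refine h.trans ?_
    rw [hδ, mul_assoc]
    exact mul_le_mul_of_nonneg_left (hB v) (by linarith)
  have h2 : K⁻¹ * K = 1 := inv_mul_cancel₀ hK0.ne'
  have hb := norm_nonneg (B v)
  constructor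
  · have : ‖a‖ ≤ ‖B v‖ + ‖a - B v‖ := by
      simpa using norm_add_le (B v) (a - B v)
    have h3 : 2 - K⁻¹ ≤ K := by
      have : 0 < K⁻¹ := by positivity
      nlinarith [mul_self_nonneg (K - 1)]
    nlinarith
  · have : ‖B v‖ ≤ ‖a‖ + ‖a - B v‖ := by
      have := norm_sub_le a (a - B v)
      simpa using this
    have h3 : K⁻¹ * ‖B v‖ ≤ ‖a‖ := by linarith
    calc ‖B v‖ = K * (K⁻¹ * ‖B v‖) := by rw [← mul_assoc, mul_inv_cancel₀ hK0.ne', one_mul]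
      _ ≤ K * ‖a‖ := by gcongr

/-- An injective linear map is bounded below, so every map close enough to it distorts lengths by a
factor at most `K` relative to it. Separability gives countably many model maps; Mathlib's partition
into pieces of approximate linearity is then refined by which model map is near `f' x`. -/
theorem exists_cover_pieces {f : E → F} {f' : E → E →L[ℝ] F} {s : Set E}
    (hs : MeasurableSet s) (hm : Measurable f')
    (hf' : ∀ x ∈ s, HasFDerivWithinAt f (f' x) s x)
    (hi : ∀ x ∈ s, Function.Injective (f' x)) {K : ℝ≥0} (hK : 1 < K) :
    ∃ (p : ℕ × ℕ → Set E) (B : ℕ × ℕ → E →L[ℝ] F), Pairwise (Function.onFun Disjoint p) ∧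
      (∀ i, MeasurableSet (p i)) ∧ (⋃ i, p i) = s ∧ ∀ i,
      (∀ x ∈ p i, ∀ y ∈ p i, dist (f x) (f y) ≤ K * dist (B i x) (B i y)) ∧
      (∀ x ∈ p i, ∀ y ∈ p i, dist (B i x) (B i y) ≤ K * dist (f x) (f y)) ∧
      (∀ x ∈ p i, ∀ v, ‖f' x v‖ ≤ K * ‖B i v‖) ∧
      (∀ x ∈ p i, ∀ v, ‖B i v‖ ≤ K * ‖f' x v‖) := by
  rcases s.eq_empty_or_nonempty with rfl | ⟨x₀, hx₀⟩
  · exact ⟨fun _ => ∅, fun _ => 0, fun _ _ _ => by simp [Function.onFun], by simp, by simp,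
      by simp⟩
  have hc : ∀ A : {A : E →L[ℝ] F // Function.Injective A}, ∃ c : ℝ, 0 < c ∧
      ∀ v, c * ‖v‖ ≤ ‖A.1 v‖ := by
    intro A
    obtain ⟨k, hk, hA⟩ := LinearMap.exists_antilipschitzWith A.1.toLinearMap
      (LinearMap.ker_eq_bot.2 A.2)
    refine ⟨(k : ℝ)⁻¹, by positivity, fun v => ?_⟩
    have := hA.le_mul_dist v 0
    simp only [ContinuousLinearMap.coe_coe, dist_zero_right, map_zero] at this
    rwa [inv_mul_le_iff₀ (by positivity)]
  choose c hc0 hcA using hc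
  have hK' : (1 : ℝ) < K := by exact_mod_cast hK
  have hK1 : 0 < 1 - (K : ℝ)⁻¹ := by
    have := inv_lt_one_of_one_lt₀ hK'
    linarith
  set δ : {A : E →L[ℝ] F // Function.Injective A} → ℝ := fun A => (1 - (K : ℝ)⁻¹) * c A with hδ
  have hδ0 : ∀ A, 0 < δ A := fun A => mul_pos hK1 (hc0 A)
  -- The Lindelöf property of the space of linear maps: countably many balls around injective maps
  -- suffice.
  obtain ⟨T, hT, hTU⟩ := TopologicalSpace.isOpen_iUnion_countable
    (fun A : {A : E →L[ℝ] F // Function.Injective A} => ball A.1 (δ A / 4))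
    (fun A => isOpen_ball)
  have hcov : ∀ x ∈ s, ∃ A ∈ T, f' x ∈ ball A.1 (δ A / 4) := by
    intro x hx
    have h1 : f' x ∈ ⋃ A : {A : E →L[ℝ] F // Function.Injective A}, ball A.1 (δ A / 4) :=
      mem_iUnion.2 ⟨⟨f' x, hi x hx⟩, mem_ball_self (by linarith [hδ0 ⟨f' x, hi x hx⟩])⟩
    rw [← hTU] at h1
    simpa using h1
  obtain ⟨a, rfl⟩ : ∃ a : ℕ → {A : E →L[ℝ] F // Function.Injective A}, T = range a :=
    hT.exists_eq_range (let ⟨A, hA, _⟩ := hcov x₀ hx₀; ⟨A, hA⟩)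
  set D : ℕ → Set (E →L[ℝ] F) := disjointed fun i => ball (a i).1 (δ (a i) / 4) with hD
  have hDm : ∀ i, MeasurableSet (D i) :=
    MeasurableSet.disjointed fun i => isOpen_ball.measurableSet
  have hDs : ∀ i, D i ⊆ ball (a i).1 (δ (a i) / 4) := fun i => disjointed_subset _ _
  -- The tolerances add up: `δ / 2` for the linear approximation of `f` on a piece and `δ / 4` for
  -- the distance of that linear map, a value of `f'`, from the model map.
  have hpart := fun i => exists_partition_approximatesLinearOn_of_hasFDerivWithinAt f
    (s ∩ f' ⁻¹' D i) f' (fun x hx => (hf' x hx.1).mono inter_subset_left)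
    (fun _ => (δ (a i) / 2).toNNReal)
    (fun _ => by
      have := hδ0 (a i)
      simp only [ne_eq, Real.toNNReal_eq_zero, not_le]
      linarith)
  choose t A ht1 ht2 ht3 ht4 ht5 using hpart
  refine ⟨fun i => (s ∩ f' ⁻¹' D i.1) ∩ t i.1 i.2, fun i => (a i.1).1, ?_, ?_, ?_, ?_⟩
  · rintro ⟨i, k⟩ ⟨i', k'⟩ hne
    rw [Function.onFun, Set.disjoint_left]
    rintro x ⟨⟨hx1, hx2⟩, hx3⟩ ⟨⟨_, hx4⟩, hx5⟩
    dsimp only at hx2 hx3 hx4 hx5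
    have hii : i = i' := by
      by_contra hne'
      exact Set.disjoint_left.1 (disjoint_disjointed (fun i => ball (a i).1 (δ (a i) / 4)) hne') hx2 hx4
    subst hii
    have hkk : k ≠ k' := fun h => hne (by rw [h])
    exact Set.disjoint_left.1 (ht1 i hkk) hx3 hx5
  · exact fun i => (hs.inter (hm (hDm i.1))).inter (ht2 _ _)
  · ext x
    simp only [mem_iUnion]
    constructor
    · rintro ⟨i, hx, _⟩
      exact hx.1
    · intro hx
      obtain ⟨_, ⟨i, rfl⟩, hA⟩ := hcov x hx
      have h1 : f' x ∈ ⋃ i, D i := by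
        rw [hD, iUnion_disjointed]
        exact mem_iUnion.2 ⟨i, hA⟩
      obtain ⟨j, hj⟩ := mem_iUnion.1 h1
      obtain ⟨k, hk⟩ := mem_iUnion.1 (ht3 j ⟨hx, hj⟩)
      exact ⟨(j, k), ⟨hx, hj⟩, hk⟩
  · rintro ⟨i, k⟩
    dsimp only
    have hδi := hδ0 (a i)
    have key : ∀ x ∈ (s ∩ f' ⁻¹' D i) ∩ t i k, ∀ y ∈ (s ∩ f' ⁻¹' D i) ∩ t i k,
        ‖(f x - f y) - (a i).1 (x - y)‖ ≤ δ (a i) * ‖x - y‖ := by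
      intro x hx y hy
      have h1 := ht4 i k x hx y hy
      rw [Real.coe_toNNReal _ (by linarith)] at h1
      obtain ⟨z, hz, hAz⟩ := ht5 i ⟨x, hx.1⟩ k
      have h2 : ‖(A i k - (a i).1) (x - y)‖ ≤ δ (a i) / 4 * ‖x - y‖ := by
        refine (ContinuousLinearMap.le_opNorm _ _).trans ?_
        gcongr
        have := hDs i hz.2
        rw [mem_ball, dist_eq_norm, ← hAz] at this
        exact this.le
      calc ‖(f x - f y) - (a i).1 (x - y)‖
          = ‖(f x - f y - A i k (x - y)) + (A i k - (a i).1) (x - y)‖ := by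
            congr 1
            rw [sub_apply]
            abel
        _ ≤ δ (a i) / 2 * ‖x - y‖ + δ (a i) / 4 * ‖x - y‖ := (norm_add_le _ _).trans (by gcongr)
        _ ≤ δ (a i) * ‖x - y‖ := by nlinarith [norm_nonneg (x - y)]
    have key2 : ∀ x ∈ (s ∩ f' ⁻¹' D i) ∩ t i k, ∀ v,
        ‖f' x v - (a i).1 v‖ ≤ δ (a i) * ‖v‖ := by
      intro x hx v
      rw [← sub_apply]
      refine (ContinuousLinearMap.le_opNorm _ _).trans ?_
      gcongr
      have := hDs i hx.1.2
      rw [mem_ball, dist_eq_norm] at this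
      linarith
    refine ⟨fun x hx y hy => ?_, fun x hx y hy => ?_, fun x hx v => ?_, fun x hx v => ?_⟩
    · rw [dist_eq_norm, dist_eq_norm, ← map_sub]
      exact (norm_le_of_norm_sub_le hK' rfl (hcA (a i)) (key x hx y hy)).1
    · rw [dist_eq_norm, dist_eq_norm, ← map_sub]
      exact (norm_le_of_norm_sub_le hK' rfl (hcA (a i)) (key x hx y hy)).2
    · exact (norm_le_of_norm_sub_le hK' rfl (hcA (a i)) (key2 x hx v)).1
    · exact (norm_le_of_norm_sub_le hK' rfl (hcA (a i)) (key2 x hx v)).2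

/-- The estimates on the pieces lose a factor `K ^ d` twice, once for `f` and once for its
derivative; the loss disappears as `K → 1`. -/
theorem le_of_forall_mul_pow_le {a b : ℝ≥0∞} (d : ℕ)
    (h : ∀ K : ℝ≥0, 1 < K → a ≤ ((K : ℝ≥0∞) ^ d) ^ 2 * b) : a ≤ b := by
  have hu : Tendsto (fun i : ℕ => 1 + 1 / ((i : ℝ≥0) + 1)) atTop (𝓝 1) := by
    have := (tendsto_one_div_add_atTop_nhds_zero_nat (𝕜 := ℝ≥0)).const_add 1
    simpa using this
  have h2 : Tendsto (fun i : ℕ => (((1 + 1 / ((i : ℝ≥0) + 1) : ℝ≥0) : ℝ≥0∞) ^ d) ^ 2 * b) atTop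
      (𝓝 (((1 : ℝ≥0∞) ^ d) ^ 2 * b)) := by
    refine ENNReal.Tendsto.mul_const ?_ (Or.inl (by simp))
    have h3 : Tendsto (fun i : ℕ => (((1 + 1 / ((i : ℝ≥0) + 1) : ℝ≥0)) ^ d) ^ 2) atTop
        (𝓝 (((1 : ℝ≥0) ^ d) ^ 2)) := (hu.pow d).pow 2
    have h4 := (ENNReal.continuous_coe.tendsto _).comp h3
    simpa [Function.comp_def] using h4
  have h5 : a ≤ ((1 : ℝ≥0∞) ^ d) ^ 2 * b :=
    ge_of_tendsto' h2 fun i => h _ (by simp)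
  simpa using h5

/-- The area formula. -/
theorem lintegral_normDet_fderiv_eq {f : E → F} {f' : E → E →L[ℝ] F} {s : Set E}
    (hs : MeasurableSet s) (hm : Measurable f')
    (hf' : ∀ x ∈ s, HasFDerivWithinAt f (f' x) s x)
    (hi : ∀ x ∈ s, Function.Injective (f' x)) (hinj : InjOn f s) :
    (Measure.euclideanHausdorffMeasure (finrank ℝ E) : Measure F) (f '' s) =
      ∫⁻ x in s, ENNReal.ofReal (f' x).toLinearMap.normDet := by
  have hcont : ContinuousOn f s := fun x hx => (hf' x hx).continuousWithinAt
  have main : ∀ K : ℝ≥0, 1 < K →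
      (Measure.euclideanHausdorffMeasure (finrank ℝ E) : Measure F) (f '' s) ≤
        ((K : ℝ≥0∞) ^ finrank ℝ E) ^ 2 *
          ∫⁻ x in s, ENNReal.ofReal (f' x).toLinearMap.normDet ∧
      ∫⁻ x in s, ENNReal.ofReal (f' x).toLinearMap.normDet ≤ ((K : ℝ≥0∞) ^ finrank ℝ E) ^ 2 *
        (Measure.euclideanHausdorffMeasure (finrank ℝ E) : Measure F) (f '' s) := by
    intro K hK
    obtain ⟨p, B, hp1, hp2, rfl, hp4⟩ := exists_cover_pieces hs hm hf' hi hK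
    have hsub : ∀ i, p i ⊆ ⋃ i, p i := fun i => subset_iUnion p i
    have e1 : (Measure.euclideanHausdorffMeasure (finrank ℝ E) : Measure F) (f '' ⋃ i, p i) =
        ∑' i, (Measure.euclideanHausdorffMeasure (finrank ℝ E) : Measure F) (f '' p i) := by
      rw [image_iUnion, measure_iUnion]
      · intro i j hij
        exact (hp1 hij).image hinj (hsub i) (hsub j)
      · intro i
        exact (hp2 i).image_of_continuousOn_injOn (hcont.mono (hsub i)) (hinj.mono (hsub i))
    rw [e1, lintegral_iUnion hp2 hp1, ← ENNReal.tsum_mul_left, ← ENNReal.tsum_mul_left]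
    have := fun i => euclideanHausdorffMeasure_image_piece (f' := f') (hp2 i) (hp4 i).1 (hp4 i).2.1
      (hp4 i).2.2.1 (hp4 i).2.2.2
    exact ⟨ENNReal.tsum_le_tsum fun i => (this i).1, ENNReal.tsum_le_tsum fun i => (this i).2⟩
  exact le_antisymm (le_of_forall_mul_pow_le _ fun K hK => (main K hK).1)
    (le_of_forall_mul_pow_le _ fun K hK => (main K hK).2)

/-- The area formula applied to `s ∩ f ⁻¹' t` for every measurable `t`. As an identity of measures
it yields the change of variables for integrability and for vector-valued integrals. -/
theorem map_withDensity_normDet {f : E → F} {f' : E → E →L[ℝ] F} {s : Set E}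
    (hs : MeasurableSet s) (hm : Measurable f')
    (hf' : ∀ x ∈ s, HasFDerivWithinAt f (f' x) s x)
    (hi : ∀ x ∈ s, Function.Injective (f' x)) (hinj : InjOn f s) :
    Measure.map (s.domRestrict f) (Measure.comap (↑)
        ((volume : Measure E).withDensity fun x => ENNReal.ofReal (f' x).toLinearMap.normDet)) =
      (Measure.euclideanHausdorffMeasure (finrank ℝ E) : Measure F).restrict (f '' s) := by
  have hcont : ContinuousOn f s := fun x hx => (hf' x hx).continuousWithinAt
  have hmeas : Measurable (s.domRestrict f) :=
    (continuousOn_iff_continuous_domRestrict.1 hcont).measurable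
  ext t ht
  rw [Measure.map_apply hmeas ht, Measure.restrict_apply ht, Measure.comap_apply _
    Subtype.val_injective (fun u hu => (MeasurableEmbedding.subtype_coe hs).measurableSet_image.2 hu)
    _ (hmeas ht)]
  have e1 : Subtype.val '' (s.domRestrict f ⁻¹' t) = s ∩ f ⁻¹' t := by
    ext x
    simp [and_comm]
  have hm1 : MeasurableSet (s ∩ f ⁻¹' t) := by
    rw [← e1]
    exact (MeasurableEmbedding.subtype_coe hs).measurableSet_image.2 (hmeas ht)
  rw [e1, withDensity_apply _ hm1, ← lintegral_normDet_fderiv_eq hm1 hm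
    (fun x hx => (hf' x hx.1).mono inter_subset_left) (fun x hx => hi x hx.1)
    (hinj.mono inter_subset_left), image_inter_preimage, inter_comm]

theorem measurableEmbedding_domRestrict {f : E → F} {s : Set E} (hs : MeasurableSet s)
    (hcont : ContinuousOn f s) (hinj : InjOn f s) : MeasurableEmbedding (s.domRestrict f) := by
  exact hcont.measurableEmbedding hs hinj

/-- Needed to discard the points where a Lipschitz graph has no tangent plane. -/
theorem euclideanHausdorffMeasure_image_null {f : E → F} {s : Set E} {K : ℝ≥0}
    (hf : LipschitzOnWith K f s) (hs : volume s = 0) :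
    (Measure.euclideanHausdorffMeasure (finrank ℝ E) : Measure F) (f '' s) = 0 := by
  have := euclideanHausdorffMeasure_image_le_of_lipschitz (f := f) (g := fun x : E => x)
    (finrank ℝ E) (fun x hx y hy => hf.dist_le_mul x hx y hy)
  rw [image_id', InnerProductSpace.euclideanHausdorffMeasure_eq_volume, hs, mul_zero] at this
  exact le_antisymm this zero_le

theorem measurable_ofReal_normDet {f' : E → E →L[ℝ] F} (hm : Measurable f') :
    Measurable fun x => (f' x).toLinearMap.normDet.toNNReal :=
  (continuous_normDet.measurable.comp hm).real_toNNReal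

theorem integrableOn_image_iff_normDet_smul {f : E → F} {f' : E → E →L[ℝ] F} {s : Set E}
    (hs : MeasurableSet s) (hm : Measurable f')
    (hf' : ∀ x ∈ s, HasFDerivWithinAt f (f' x) s x)
    (hi : ∀ x ∈ s, Function.Injective (f' x)) (hinj : InjOn f s) (g : F → G) :
    IntegrableOn g (f '' s) (Measure.euclideanHausdorffMeasure (finrank ℝ E)) ↔
      IntegrableOn (fun x => (f' x).toLinearMap.normDet • g (f x)) s := by
  have hcont : ContinuousOn f s := fun x hx => (hf' x hx).continuousWithinAt
  rw [IntegrableOn, ← map_withDensity_normDet hs hm hf' hi hinj,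
    (measurableEmbedding_domRestrict hs hcont hinj).integrable_map_iff]
  simp only [Set.domRestrict_eq, ← Function.comp_assoc, ENNReal.ofReal]
  rw [← (MeasurableEmbedding.subtype_coe hs).integrable_map_iff, map_comap_subtype_coe hs,
    restrict_withDensity hs, integrable_withDensity_iff_integrable_coe_smul₀]
  · simp_rw [IntegrableOn, Real.coe_toNNReal _ (LinearMap.normDet_nonneg _), Function.comp_apply]
  · exact (measurable_ofReal_normDet hm).aemeasurable

theorem integral_image_eq_normDet_smul {f : E → F} {f' : E → E →L[ℝ] F} {s : Set E}
    (hs : MeasurableSet s) (hm : Measurable f')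
    (hf' : ∀ x ∈ s, HasFDerivWithinAt f (f' x) s x)
    (hi : ∀ x ∈ s, Function.Injective (f' x)) (hinj : InjOn f s) (g : F → G) :
    ∫ y in f '' s, g y ∂(Measure.euclideanHausdorffMeasure (finrank ℝ E)) =
      ∫ x in s, (f' x).toLinearMap.normDet • g (f x) := by
  have hcont : ContinuousOn f s := fun x hx => (hf' x hx).continuousWithinAt
  rw [← map_withDensity_normDet hs hm hf' hi hinj,
    (measurableEmbedding_domRestrict hs hcont hinj).integral_map]
  simp only [Set.domRestrict_apply, ← Function.comp_apply (f := g), ENNReal.ofReal]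
  rw [← (MeasurableEmbedding.subtype_coe hs).integral_map, map_comap_subtype_coe hs,
    setIntegral_withDensity_eq_setIntegral_smul₀
      (measurable_ofReal_normDet hm).aemeasurable _ hs]
  congr with x
  rw [NNReal.smul_def, Real.coe_toNNReal _ (LinearMap.normDet_nonneg _)]

end AreaFormula

/-! ### The Clifford algebra as a finite-dimensional normed space -/

section CliffordNorm

instance (m : ℕ) : FiniteDimensional ℝ (Cl m) := (clBasis m).finiteDimensional_of_finite

instance (m : ℕ) : CompleteSpace (Cl m) := FiniteDimensional.complete ℝ (Cl m)

/-- Multiplication of `Clₘ` as a continuous bilinear map. -/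
def mulL (m : ℕ) : Cl m →L[ℝ] Cl m →L[ℝ] Cl m :=
  LinearMap.toContinuousLinearMap
    ((LinearMap.toContinuousLinearMap : (Cl m →ₗ[ℝ] Cl m) ≃ₗ[ℝ] _).toLinearMap ∘ₗ
      LinearMap.mul ℝ (Cl m))

@[simp] theorem mulL_apply {m : ℕ} (a b : Cl m) : mulL m a b = a * b := rfl

instance (m : ℕ) : ContinuousMul (Cl m) :=
  ⟨by simpa using (mulL m).isBoundedBilinearMap.continuous⟩

/-- The inclusion of vectors as a continuous linear map. -/
def vecL (m : ℕ) : Euc m →L[ℝ] Cl m := LinearMap.toContinuousLinearMap vec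

@[simp] theorem vecL_apply {m : ℕ} (x : Euc m) : vecL m x = vec x := rfl

@[fun_prop] theorem continuous_vec {m : ℕ} : Continuous (vec : Euc m → Cl m) :=
  (vecL m).continuous

theorem clCoord_clBasis (m : ℕ) (s : Finset (Fin m)) :
    clCoord m (clBasis m s) = EuclideanSpace.single s 1 := by
  ext t
  simp [clCoord, Finsupp.single_apply, eq_comm]

theorem norm_sq_sum_clBasis {m : ℕ} {ι : Type*} [Fintype ι] (g : ι → Finset (Fin m))
    (hg : Function.Injective g) (a : ι → ℝ) :
    ‖∑ i, a i • clBasis m (g i)‖ ^ 2 = ∑ i, a i ^ 2 := by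
  have h1 : ‖∑ i, a i • clBasis m (g i)‖ =
      ‖∑ i, a i • EuclideanSpace.basisFun (Finset (Fin m)) ℝ (g i)‖ := by
    change ‖clCoord m (∑ i, a i • clBasis m (g i))‖ = _
    rw [map_sum]
    simp only [map_smul, clCoord_clBasis, EuclideanSpace.basisFun_apply]
  have ho : Orthonormal ℝ fun i => EuclideanSpace.basisFun (Finset (Fin m)) ℝ (g i) :=
    (EuclideanSpace.basisFun (Finset (Fin m)) ℝ).orthonormal.comp g hg
  rw [h1, ← real_inner_self_eq_norm_sq, ho.inner_sum]
  simp [sq]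

theorem clBasis_singleton {m : ℕ} (i : Fin m) :
    clBasis m {i} = vec (EuclideanSpace.single i (1 : ℝ)) := by
  rw [clBasis_apply]; simp

theorem clBasis_empty (m : ℕ) : clBasis m ∅ = 1 := by
  rw [clBasis_apply]; simp

theorem euc_eq_sum {m : ℕ} (x : Euc m) :
    x = ∑ i, x i • (EuclideanSpace.single i (1 : ℝ) : Euc m) := by
  ext j
  simp [Finset.sum_apply, Pi.single_apply]

theorem norm_vec {m : ℕ} (x : Euc m) : ‖vec x‖ = ‖x‖ := by
  rw [← sq_eq_sq₀ (norm_nonneg _) (norm_nonneg _)]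
  have h1 : vec x = ∑ i, x i • clBasis m {i} := by
    conv_lhs => rw [euc_eq_sum x]
    simp only [map_sum, map_smul, clBasis_singleton]
  rw [h1, norm_sq_sum_clBasis _ Finset.singleton_injective, EuclideanSpace.norm_sq_eq]
  simp

theorem emb_single {n : ℕ} (i : Fin n) :
    emb (EuclideanSpace.single i (1 : ℝ)) = EuclideanSpace.single i.castSucc (1 : ℝ) := by
  ext j
  refine Fin.lastCases ?_ (fun j => ?_) j
  · simp [emb, (Fin.castSucc_ne_last _).symm]
  · simp [emb]

theorem clBasis_pair {n : ℕ} (i : Fin n) :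
    clBasis (n + 1) {i.castSucc, Fin.last n} =
      vec (emb (EuclideanSpace.single i (1 : ℝ))) * vec (pole n) := by
  have h : i.castSucc < Fin.last n := Fin.castSucc_lt_last i
  have h2 : ({i.castSucc, Fin.last n} : Finset (Fin (n + 1))).sort (· ≤ ·) =
      [i.castSucc, Fin.last n] := by
    rw [Finset.sort_insert]
    · simp
    · simp [h.le]
    · simp [h.ne]
  rw [clBasis_apply, h2, emb_single]
  simp [pole]

/-- The products `e_i e` and the unit are distinct elements of the orthonormal basis; `none` indexes
the unit and `some i` the product. -/
theorem norm_pole_mul_sub_one {n : ℕ} (u : Euc n) :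
    ‖vec (pole n) * vec (emb u) - 1‖ ^ 2 = ‖u‖ ^ 2 + 1 := by
  let g : Option (Fin n) → Finset (Fin (n + 1)) := fun o =>
    o.elim ∅ fun i => {i.castSucc, Fin.last n}
  have hg : Function.Injective g := by
    rintro (_ | i) (_ | j) h
    · rfl
    · exact absurd h.symm (Finset.insert_ne_empty _ _)
    · exact absurd h (Finset.insert_ne_empty _ _)
    · simp only [g, Option.elim] at h
      have h1 : i.castSucc ∈ ({j.castSucc, Fin.last n} : Finset (Fin (n + 1))) := by
        rw [← h]; simp
      simp only [Finset.mem_insert, Fin.castSucc_inj, Finset.mem_singleton,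
        Fin.castSucc_ne_last, or_false] at h1
      rw [h1]
  have h1 : vec (pole n) * vec (emb u) - 1 =
      ∑ o, (o.elim (-1) fun i => - u i : ℝ) • clBasis (n + 1) (g o) := by
    rw [Fintype.sum_option]
    simp only [g, Option.elim, clBasis_empty, clBasis_pair, neg_smul, one_smul,
      Finset.sum_neg_distrib, ← smul_mul_assoc, ← Finset.sum_mul]
    have : vec (emb u) = ∑ i, u i • vec (emb (EuclideanSpace.single i (1 : ℝ))) := by
      conv_lhs => rw [euc_eq_sum u]
      simp only [map_sum, map_smul]
    rw [← this, neg_mul, vec_emb_mul_pole]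
    abel
  rw [h1, norm_sq_sum_clBasis g hg, Fintype.sum_option, EuclideanSpace.norm_sq_eq]
  simp [add_comm]

end CliffordNorm

/-! ### The charts and their spinor weights -/

section Charts

variable {n : ℕ}

/-- The inclusion `ℝⁿ ⊂ ℝⁿ⁺¹` as a linear isometry. -/
def embL (n : ℕ) : Euc n →ₗᵢ[ℝ] Euc (n + 1) := ⟨emb, norm_emb⟩

@[simp] theorem embL_apply (u : Euc n) : embL n u = emb u := rfl

@[fun_prop] theorem continuous_emb : Continuous (emb : Euc n → Euc (n + 1)) :=
  (embL n).continuous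

theorem inner_emb (u v : Euc n) : inner ℝ (emb u) (emb v) = inner ℝ u v :=
  (embL n).inner_map_map u v

theorem inner_emb_pole (u : Euc n) : inner ℝ (emb u) (pole n) = 0 := by
  simp [pole, emb, EuclideanSpace.inner_single_right]

theorem inner_pole_emb (u : Euc n) : inner ℝ (pole n) (emb u) = 0 := by
  rw [real_inner_comm, inner_emb_pole]

theorem inner_pole_pole : inner ℝ (pole n) (pole n) = 1 := by
  rw [real_inner_self_eq_norm_sq, norm_pole]; norm_num

theorem inner_pole_right (x : Euc (n + 1)) : inner ℝ x (pole n) = x (Fin.last n) := by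
  simp [pole, EuclideanSpace.inner_single_right]

theorem vec_pole_mul_self : vec (pole n) * vec (pole n) = (-1 : Cl (n + 1)) := by
  rw [vec_mul_self, norm_pole]; simp

/-- The denominator `u + e` of the Cayley transformation, as a vector. -/
def den (u : Euc n) : Euc (n + 1) := emb u + pole n

theorem norm_den_sq (u : Euc n) : ‖den u‖ ^ 2 = ‖u‖ ^ 2 + 1 := by
  rw [den, norm_add_sq_real, inner_emb_pole, norm_emb, norm_pole]; ring

theorem norm_den_pos (u : Euc n) : 0 < ‖den u‖ := by
  have := norm_den_sq u
  by_contra h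
  have h0 : ‖den u‖ = 0 := le_antisymm (not_lt.1 h) (norm_nonneg _)
  rw [h0] at this
  nlinarith [sq_nonneg ‖u‖]

theorem inner_den_emb (u v : Euc n) : inner ℝ (den u) (emb v) = inner ℝ u v := by
  rw [den, inner_add_left, inner_emb, inner_pole_emb, add_zero]

theorem vec_den (u : Euc n) : vec (den u) = vec (emb u) + vec (pole n) := by
  rw [den, map_add]

theorem vec_den_mul_self (u : Euc n) :
    vec (den u) * vec (den u) = -(‖den u‖ ^ 2 • (1 : Cl (n + 1))) := by
  rw [vec_mul_self, Algebra.algebraMap_eq_smul_one, neg_smul]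

/-- This form exhibits the chart as an inversion centred at `e`; everything about the charts is
computed from the single vector `den u`. -/
theorem cayley_eq (u : Euc n) : cayley u = pole n - (2 / ‖den u‖ ^ 2) • den u := by
  have h := norm_den_sq u
  have h0 : ‖u‖ ^ 2 + 1 ≠ 0 := by positivity
  rw [cayley, h, inv_smul_eq_iff₀ h0, smul_sub, smul_smul, mul_div_cancel₀ _ h0, den]
  module

theorem norm_chartDen (κ : Bool) (u : Euc n) : ‖chartDen κ u‖ = ‖den u‖ := by
  cases κ
  · simp only [chartDen, Bool.false_eq_true, if_false]
    rw [← vec_den, norm_vec]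
  · rw [← sq_eq_sq₀ (norm_nonneg _) (norm_nonneg _), norm_den_sq]
    simpa [chartDen] using norm_pole_mul_sub_one u

/-- The constant `1` or `e` by which the two charts differ. -/
def twist (n : ℕ) (κ : Bool) : Cl (n + 1) := if κ then vec (pole n) else 1

/-- Since `e² = -1`, the denominator of the second chart is `e (u + e)`, so the two spinor weights
differ only by the constant right factor `e`. -/
theorem weight_chartDen (κ : Bool) (u : Euc n) :
    weight n (chartDen κ u) = (‖den u‖ ^ n)⁻¹ • (vec (den u) * twist n κ) := by
  rw [weight, norm_chartDen]
  congr 1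
  cases κ
  · simp [chartDen, twist, vec_den]
  · simp only [chartDen, if_true, map_sub, CliffordAlgebra.reverse.map_mul,
      CliffordAlgebra.reverse_ι, CliffordAlgebra.reverse.map_one, twist, vec_den, add_mul,
      vec_pole_mul_self]
    abel

theorem weight_pole_zero : weight n (glueDen n 0) = vec (pole n) := by
  simp [weight, glueDen, norm_vec, norm_pole]

theorem weight_pole_one : weight n (glueDen n 1) = -vec (pole n) := by
  simp [weight, glueDen, norm_vec, norm_pole]

/-- The reflection in the equator as a linear isometry. -/
def reflectL (n : ℕ) : Euc (n + 1) →ₗᵢ[ℝ] Euc (n + 1) where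
  toFun := reflect
  map_add' x y := by simp only [reflect, PiLp.add_apply]; module
  map_smul' a x := by simp only [reflect, PiLp.smul_apply, smul_eq_mul, RingHom.id_apply]; module
  norm_map' x := by
    rw [← sq_eq_sq₀ (norm_nonneg _) (norm_nonneg _)]
    change ‖reflect x‖ ^ 2 = _
    rw [reflect, norm_sub_sq_real, norm_smul, norm_pole, inner_smul_right, inner_pole_right,
      mul_one, Real.norm_eq_abs, sq_abs]
    ring

@[simp] theorem reflectL_apply (x : Euc (n + 1)) : reflectL n x = reflect x := rfl

theorem reflect_sub (x y : Euc (n + 1)) : reflect (x - y) = reflect x - reflect y :=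
  (reflectL n).map_sub x y

theorem norm_reflect (x : Euc (n + 1)) : ‖reflect x‖ = ‖x‖ := (reflectL n).norm_map x

@[simp] theorem reflect_reflect (x : Euc (n + 1)) : reflect (reflect x) = x := by
  have h : (pole n) (Fin.last n) = 1 := by simp [pole]
  simp only [reflect, PiLp.sub_apply, PiLp.smul_apply, h, smul_eq_mul]
  module

theorem vec_reflect (x : Euc (n + 1)) :
    vec (reflect x) = vec (pole n) * vec x * vec (pole n) := by
  have h := congrArg (· * vec (pole n)) (reflect_spec x)
  simp only [mul_assoc, vec_pole_mul_self, neg_mul, mul_neg, mul_one] at h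
  rw [mul_assoc]
  exact neg_injective h

theorem cauchyG_reflect (x : Euc (n + 1)) :
    cauchyG n (reflect x) = vec (pole n) * cauchyG n x * vec (pole n) := by
  rw [cauchyG, cauchyG, norm_reflect, vec_reflect]
  simp

/-- The reflection belonging to the chart `κ`. -/
def flip (n : ℕ) (κ : Bool) : Euc (n + 1) →ₗᵢ[ℝ] Euc (n + 1) :=
  if κ then reflectL n else LinearIsometry.id

theorem chart_eq (κ : Bool) (u : Euc n) : chart κ u = flip n κ (cayley u) := by
  cases κ <;> simp [chart, flip]

@[simp] theorem flip_flip (κ : Bool) (x : Euc (n + 1)) : flip n κ (flip n κ x) = x := by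
  cases κ <;> simp [flip]

theorem norm_flip (κ : Bool) (x : Euc (n + 1)) : ‖flip n κ x‖ = ‖x‖ := (flip n κ).norm_map x

theorem vec_flip (κ : Bool) (x : Euc (n + 1)) :
    vec (flip n κ x) = twist n κ * vec x * twist n κ := by
  cases κ <;> simp [flip, twist, vec_reflect]

/-- The sign of `e²` or `1²`. -/
def sgn (κ : Bool) : ℝ := if κ then -1 else 1

theorem sgn_mul_self (κ : Bool) : sgn κ * sgn κ = 1 := by cases κ <;> simp [sgn]

theorem twist_mul_self (κ : Bool) : twist n κ * twist n κ = sgn κ • 1 := by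
  cases κ
  · simp [twist, sgn]
  · simp only [twist, if_true, vec_pole_mul_self, sgn, neg_smul, one_smul]

theorem cauchyG_flip (κ : Bool) (x : Euc (n + 1)) :
    cauchyG n (flip n κ x) = twist n κ * cauchyG n x * twist n κ := by
  rw [cauchyG, cauchyG, norm_flip, vec_flip]
  simp

/-- The inverse of `weight n (chartDen κ u)`. -/
def unweight (κ : Bool) (u : Euc n) : Cl (n + 1) :=
  (-(sgn κ * (‖den u‖ ^ n / ‖den u‖ ^ 2))) • (twist n κ * vec (den u))

/-- Vectors are invertible, and the squares of `den u` and of the twist are scalars. -/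
theorem unweight_mul_weight (κ : Bool) (u : Euc n) (f : Cl (n + 1)) :
    unweight κ u * (weight n (chartDen κ u) * f) = f := by
  have h := (norm_den_pos u).ne'
  rw [weight_chartDen, unweight, ← mul_assoc, smul_mul_smul_comm, ← mul_assoc,
    mul_assoc (twist n κ) _ (vec (den u)), vec_den_mul_self, mul_neg, mul_smul_comm, mul_one,
    neg_mul, ← neg_smul]
  simp only [smul_mul_assoc, twist_mul_self, smul_smul, one_mul]
  convert one_smul ℝ f using 2
  field_simp
  rw [sq, sgn_mul_self]

/-- The conformal factor of the charts. -/
def confFactor (u : Euc n) : ℝ := 2 / ‖den u‖ ^ 2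

theorem confFactor_pos (u : Euc n) : 0 < confFactor u :=
  div_pos two_pos (pow_pos (norm_den_pos u) 2)

/-- The derivative of the chart `κ`. -/
def chartDeriv (κ : Bool) (u : Euc n) : Euc n →L[ℝ] Euc (n + 1) :=
  (flip n κ).toContinuousLinearMap ∘L
    ((-confFactor u) • (embL n).toContinuousLinearMap +
      (confFactor u ^ 2 • innerSL ℝ u).smulRight (den u))

theorem chartDeriv_apply (κ : Bool) (u v : Euc n) : chartDeriv κ u v =
    flip n κ ((confFactor u ^ 2 * inner ℝ u v) • den u - confFactor u • emb v) := by
  simp only [chartDeriv, ContinuousLinearMap.comp_apply, LinearIsometry.coe_toContinuousLinearMap,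
    add_apply, smul_apply, embL_apply, ContinuousLinearMap.smulRight_apply, innerSL_apply_apply,
    smul_eq_mul]
  congr 1
  module

theorem hasFDerivAt_den (u : Euc n) :
    HasFDerivAt (den : Euc n → Euc (n + 1)) (embL n).toContinuousLinearMap u :=
  ((embL n).toContinuousLinearMap.hasFDerivAt (x := u)).add_const (pole n)

theorem hasFDerivAt_chart (κ : Bool) (u : Euc n) :
    HasFDerivAt (chart κ : Euc n → Euc (n + 1)) (chartDeriv κ u) u := by
  have hq : HasFDerivAt (fun u : Euc n => ‖den u‖ ^ 2) (2 • innerSL ℝ u) u := by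
    have h1 := (hasStrictFDerivAt_norm_sq u).hasFDerivAt
    refine (h1.add_const 1).congr_of_eventuallyEq ?_
    exact Filter.Eventually.of_forall fun v => norm_den_sq v
  have h0 : ‖den u‖ ^ 2 ≠ 0 := (pow_pos (norm_den_pos u) 2).ne'
  have h2 : HasFDerivAt (fun u : Euc n => 2 / ‖den u‖ ^ 2)
      (-(confFactor u ^ 2 • innerSL ℝ u)) u := by
    have h3 := ((hasDerivAt_inv h0).comp_hasFDerivAt u hq).const_mul 2
    refine HasFDerivAt.congr_fderiv h3 ?_
    ext v
    simp [confFactor]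
    field_simp
    try ring
  have h4 := ((h2.smul (hasFDerivAt_den u)).const_sub (pole n))
  have h5 : HasFDerivAt (cayley : Euc n → Euc (n + 1)) _ u :=
    h4.congr_of_eventuallyEq (Filter.Eventually.of_forall fun v => cayley_eq v)
  have h6 := (flip n κ).toContinuousLinearMap.hasFDerivAt.comp u h5
  refine (h6.congr_of_eventuallyEq (Filter.Eventually.of_forall fun v => chart_eq κ v)).congr_fderiv
    ?_
  ext1 v
  rw [chartDeriv_apply]
  simp only [ContinuousLinearMap.comp_apply, LinearIsometry.coe_toContinuousLinearMap,
    neg_apply, add_apply, smul_apply, embL_apply, ContinuousLinearMap.smulRight_apply,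
    innerSL_apply_apply, smul_eq_mul]
  congr 1
  simp only [confFactor]
  module

/-- The derivative is `-confFactor u` times the reflection in the hyperplane orthogonal to `den u`;
the cross terms cancel because `confFactor u * ‖den u‖ ^ 2 = 2`. -/
theorem norm_chartDeriv (κ : Bool) (u v : Euc n) :
    ‖chartDeriv κ u v‖ = confFactor u * ‖v‖ := by
  rw [← sq_eq_sq₀ (norm_nonneg _) (mul_nonneg (confFactor_pos u).le (norm_nonneg _)),
    chartDeriv_apply, norm_flip, norm_sub_sq_real, norm_smul, norm_smul, inner_smul_left,
    inner_smul_right, inner_den_emb, norm_emb]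
  simp only [mul_pow, Real.norm_eq_abs, sq_abs, conj_trivial]
  have h0 : ‖den u‖ ≠ 0 := (norm_den_pos u).ne'
  have : confFactor u * ‖den u‖ ^ 2 = 2 := by rw [confFactor]; field_simp
  linear_combination (confFactor u ^ 3 * (inner ℝ u v) ^ 2) * this

theorem norm_chart (κ : Bool) (u : Euc n) : ‖chart κ u‖ = 1 := by
  have h0 : ‖den u‖ ≠ 0 := (norm_den_pos u).ne'
  rw [chart_eq, norm_flip, ← sq_eq_sq₀ (norm_nonneg _) one_pos.le, cayley_eq, norm_sub_sq_real,
    norm_smul, norm_pole, inner_smul_right, den, inner_add_right, inner_pole_emb, inner_pole_pole,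
    ← den, Real.norm_eq_abs, mul_pow, sq_abs]
  field_simp
  ring

/-- A reflection is a sandwich `d v d` in the Clifford algebra. In this form one factor `d` can be
given to the kernel and the other to the section. -/
theorem vec_cayleyDeriv (u v : Euc n) :
    vec ((confFactor u ^ 2 * inner ℝ u v) • den u - confFactor u • emb v) =
      (-(confFactor u ^ 2 / 2)) • (vec (den u) * vec (emb v) * vec (den u)) := by
  have h := vec_mul_add (den u) (emb v)
  rw [inner_den_emb, Algebra.algebraMap_eq_smul_one] at h
  have h0 : ‖den u‖ ≠ 0 := (norm_den_pos u).ne'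
  have hc : confFactor u ^ 2 / 2 * ‖den u‖ ^ 2 = confFactor u := by
    rw [confFactor]; field_simp
  rw [eq_sub_of_add_eq h, sub_mul, mul_assoc (vec (emb v)), vec_den_mul_self, map_sub, map_smul,
    map_smul, smul_mul_assoc, one_mul, mul_neg, mul_smul_comm, mul_one]
  rw [show confFactor u • vec (emb v) =
    (confFactor u ^ 2 / 2 * ‖den u‖ ^ 2) • vec (emb v) by rw [hc]]
  module

end Charts

/-! ### The Cauchy kernel of the sphere in the charts -/

section Kernel

variable {n : ℕ}

/-- The product of `x - y` and the denominator at `x = c(u)`, an affine function of `u`. -/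
def kernL (y : Euc (n + 1)) (u : Euc n) : Cl (n + 1) :=
  vec (pole n - y) * vec (den u) + (2 : ℝ) • 1

/-- The square of the norm of `kernL y u`. -/
def kernQ (y : Euc (n + 1)) (u : Euc n) : ℝ :=
  ‖pole n - y‖ ^ 2 * ‖den u‖ ^ 2 - 4 * inner ℝ (pole n - y) (den u) + 4

/-- The pole of the chart is cancelled by the denominator, since `d · d` is a scalar. -/
theorem vec_cayley_sub_mul_den (y : Euc (n + 1)) (u : Euc n) :
    vec (cayley u - y) * vec (den u) = kernL y u := by
  have h0 : ‖den u‖ ≠ 0 := (norm_den_pos u).ne'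
  rw [kernL, cayley_eq, sub_right_comm, map_sub _ (pole n - y), sub_mul, map_smul, smul_mul_assoc,
    vec_den_mul_self, smul_neg, smul_smul, div_mul_cancel₀ _ (pow_ne_zero 2 h0), sub_neg_eq_add]

theorem kernQ_eq (y : Euc (n + 1)) (u : Euc n) :
    kernQ y u = (‖cayley u - y‖ * ‖den u‖) ^ 2 := by
  have h0 : ‖den u‖ ≠ 0 := (norm_den_pos u).ne'
  rw [kernQ, cayley_eq, sub_right_comm, mul_pow, norm_sub_sq_real (pole n - y), norm_smul,
    inner_smul_right, Real.norm_eq_abs, mul_pow, sq_abs]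
  field_simp
  ring

/-- The kernel `G(x - y)` in the chart `c`, with the spinor weight in `x`. -/
def kern₀ (y : Euc (n + 1)) (u : Euc n) : Cl (n + 1) :=
  (kernQ y u ^ (-(n / 2 : ℝ))) • kernL y u

/-- The kernel `G(x - y)` in the chart `κ`, with the spinor weight in `x`. -/
def kern (κ : Bool) (y : Euc (n + 1)) (u : Euc n) : Cl (n + 1) :=
  (-(sgn κ * 2 ^ n / 2)) • (twist n κ * kern₀ (flip n κ y) u)

theorem flip_chart (κ : Bool) (u : Euc n) : flip n κ (chart κ u) = cayley u := by
  rw [chart_eq, flip_flip]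

theorem kernQ_pos {κ : Bool} {y : Euc (n + 1)} {u : Euc n} (h : chart κ u ≠ y) :
    0 < kernQ (flip n κ y) u := by
  rw [kernQ_eq]
  have h1 : cayley u - flip n κ y ≠ 0 := by
    rw [← flip_chart κ, ← map_sub]
    intro h2
    have h3 : flip n κ (chart κ u - y) = flip n κ 0 := by rw [h2, map_zero]
    exact h (sub_eq_zero.1 ((flip n κ).injective h3))
  have := norm_den_pos u
  have := norm_pos_iff.2 h1
  positivity

theorem kernQ_rpow (y : Euc (n + 1)) (u : Euc n) :
    kernQ y u ^ (-(n / 2 : ℝ)) = (‖cayley u - y‖ ^ n)⁻¹ * (‖den u‖ ^ n)⁻¹ := by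
  have h0 : 0 ≤ ‖cayley u - y‖ * ‖den u‖ := by positivity
  rw [kernQ_eq, Real.rpow_neg (by positivity), ← Real.rpow_natCast (_ * _) 2,
    ← Real.rpow_mul h0, ← mul_inv, ← mul_pow, ← Real.rpow_natCast]
  congr 2
  push_cast
  ring

/-- Conformal covariance of the Cauchy form. The normalized derivative contributes `d v d`; the left
`d` combines with `x - y` to `kernL`, the right `d` with `f` to the weighted section, and the powers
of `‖den u‖` match because the Jacobian is `confFactor u ^ n`. -/
theorem conf_smul_cauchyG_mul (κ : Bool) (y : Euc (n + 1)) (u v : Euc n) (f : Cl (n + 1)) :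
    confFactor u ^ n • (cauchyG n (chart κ u - y) *
      vec ((confFactor u ^ 2)⁻¹ • chartDeriv κ u v) * f) =
    kern κ y u * vec (emb v) * (weight n (chartDen κ u) * f) := by
  have h0 : ‖den u‖ ≠ 0 := (norm_den_pos u).ne'
  have hc := (confFactor_pos u).ne'
  have e1 : chart κ u - y = flip n κ (cayley u - flip n κ y) := by
    rw [map_sub, flip_flip, chart_eq]
  rw [e1, cauchyG_flip, chartDeriv_apply, map_smul, vec_flip, vec_cayleyDeriv, weight_chartDen,
    kern, kern₀, kernQ_rpow, ← vec_cayley_sub_mul_den, cauchyG]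
  simp only [mul_smul_comm, smul_mul_assoc, mul_assoc, smul_smul]
  rw [← mul_assoc (twist n κ) (twist n κ), twist_mul_self]
  simp only [mul_smul_comm, smul_mul_assoc, smul_smul, one_mul]
  congr 1
  rw [confFactor, div_pow, ← pow_mul]
  field_simp
  ring

theorem sum_mul_self (a : Cl (n + 1)) :
    ∑ i : Fin n, a * vec (emb (EuclideanSpace.single i (1 : ℝ))) *
      vec (emb (EuclideanSpace.single i (1 : ℝ))) = -((n : ℝ) • a) := by
  simp only [mul_assoc, vec_mul_self, norm_emb, PiLp.norm_single, norm_one]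
  simp [Algebra.algebraMap_eq_smul_one, Nat.cast_smul_eq_nsmul]

theorem sum_inner_emb (d : Euc (n + 1)) :
    ∑ i : Fin n, (inner ℝ d (emb (EuclideanSpace.single i (1 : ℝ))) : ℝ) •
      emb (EuclideanSpace.single i (1 : ℝ)) = d - (d (Fin.last n)) • pole n := by
  ext j
  simp only [emb_single, EuclideanSpace.inner_single_right]
  refine Fin.lastCases ?_ (fun j => ?_) j
  · simp [Finset.sum_apply, pole, (Fin.castSucc_ne_last _).symm]
  · simp [Finset.sum_apply, pole, Pi.single_apply]

/-- The Clifford form of `x · x = -‖x‖²`: multiplying `kernL` by the gradient of its squared norm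
gives back the coefficient of `kernL`. -/
theorem kernL_mul_grad (y : Euc (n + 1)) (u : Euc n) :
    kernL y u * vec ((2 * ‖pole n - y‖ ^ 2) • den u - (4 : ℝ) • (pole n - y)) =
      (-2 * kernQ y u) • vec (pole n - y) := by
  have h := vec_mul_add (pole n - y) (den u)
  rw [Algebra.algebraMap_eq_smul_one] at h
  set d := pole n - y with hdy
  have hd : vec d * vec d = -(‖d‖ ^ 2 • (1 : Cl (n + 1))) := by
    rw [vec_mul_self, Algebra.algebraMap_eq_smul_one, neg_smul]
  have h1 : vec d * vec (den u) * vec d =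
      (‖d‖ ^ 2) • vec (den u) - (2 * inner ℝ d (den u)) • vec d := by
    rw [eq_sub_of_add_eq h, sub_mul, mul_assoc, hd]
    simp only [mul_neg, mul_smul_comm, smul_mul_assoc, mul_one, one_mul]
    module
  have h2 : vec d * vec (den u) * vec (den u) = -(‖den u‖ ^ 2 • vec d) := by
    rw [mul_assoc, vec_den_mul_self, mul_neg, mul_smul_comm, mul_one]
  rw [kernL, kernQ, ← hdy, map_sub vec ((2 * ‖d‖ ^ 2) • den u), map_smul, map_smul, mul_sub, mul_smul_comm, mul_smul_comm, add_mul,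
    add_mul, h1, h2, smul_mul_assoc, smul_mul_assoc, one_mul, one_mul]
  module

/-- For `y` on the unit sphere this makes the `e`-component of the vector in `kernL_mul_grad`
vanish, so that this vector is the gradient of `kernQ` within `ℝⁿ`. -/
theorem two_mul_inner_pole {y : Euc (n + 1)} (hy : ‖y‖ = 1) :
    2 * (pole n - y) (Fin.last n) = ‖pole n - y‖ ^ 2 := by
  rw [norm_sub_sq_real, hy, norm_pole, ← inner_pole_right, inner_sub_left, inner_pole_pole,
    real_inner_comm]
  ring

/-- Write `d = e - y`. Differentiating `kernL` contributes `-n d`, by `e_i² = -1`; differentiating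
the power of `kernQ` contributes `+n d`, by `kernL_mul_grad`. The exponent `-n/2` is what makes the
two cancel. -/
theorem kern₀_monogenic {y : Euc (n + 1)} (hy : ‖y‖ = 1) {u : Euc n} (h : 0 < kernQ y u) :
    ∃ K' : Euc n →L[ℝ] Cl (n + 1), HasFDerivAt (kern₀ y) K' u ∧
      ∑ i : Fin n, K' (EuclideanSpace.single i (1 : ℝ)) *
        vec (emb (EuclideanSpace.single i (1 : ℝ))) = 0 := by
  set d := pole n - y with hd
  have hq : HasFDerivAt (fun u : Euc n => ‖den u‖ ^ 2) (2 • innerSL ℝ u) u := by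
    have h1 := (hasStrictFDerivAt_norm_sq u).hasFDerivAt
    refine (h1.add_const 1).congr_of_eventuallyEq ?_
    exact Filter.Eventually.of_forall fun v => norm_den_sq v
  have hQ : HasFDerivAt (kernQ y) ((‖d‖ ^ 2) • (2 • innerSL ℝ u) -
      (4 : ℝ) • ((innerSL ℝ d) ∘L (embL n).toContinuousLinearMap)) u :=
    ((hq.const_mul _).sub
      (((innerSL ℝ d).hasFDerivAt.comp u (hasFDerivAt_den u)).const_mul 4)).add_const 4
  have hL : HasFDerivAt (kernL y) ((mulL (n + 1) (vec d)) ∘L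
      ((vecL (n + 1)) ∘L (embL n).toContinuousLinearMap)) u :=
    (((mulL (n + 1) (vec d)).hasFDerivAt.comp u
      ((vecL (n + 1)).hasFDerivAt.comp u (hasFDerivAt_den u)))).add_const _
  have hK := (hQ.rpow_const (p := -(n / 2 : ℝ)) (Or.inl h.ne')).smul hL
  refine ⟨_, hK, ?_⟩
  have key := kernL_mul_grad y u
  have hgrad : ∑ i : Fin n, (‖d‖ ^ 2 * (2 * inner ℝ u (EuclideanSpace.single i (1 : ℝ))) -
      4 * inner ℝ d (emb (EuclideanSpace.single i (1 : ℝ)))) •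
        vec (emb (EuclideanSpace.single i (1 : ℝ))) =
      vec ((2 * ‖d‖ ^ 2) • den u - (4 : ℝ) • d) := by
    have e1 : ∑ i : Fin n, (inner ℝ u (EuclideanSpace.single i (1 : ℝ)) : ℝ) •
        emb (EuclideanSpace.single i (1 : ℝ)) = emb u := by
      conv_rhs => rw [euc_eq_sum u, map_sum]
      simp only [map_smul, EuclideanSpace.inner_single_right]
      simp
    have e2 := sum_inner_emb d
    have e3 := two_mul_inner_pole hy
    rw [← hd] at e3
    have e1' := congrArg vec e1
    have e2' := congrArg vec e2
    simp only [map_sum, map_smul] at e1' e2'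
    simp only [sub_smul, mul_smul, Finset.sum_sub_distrib, ← Finset.smul_sum]
    rw [e1', e2', ← e3, den]
    simp only [map_sub, map_smul, map_add]
    module
  have e4 : ∀ i : Fin n, ((kernQ y u ^ (-(n / 2 : ℝ))) • ((mulL (n + 1) (vec d)) ∘L
      ((vecL (n + 1)) ∘L (embL n).toContinuousLinearMap)) +
      ((-(n / 2 : ℝ) * kernQ y u ^ (-(n / 2 : ℝ) - 1)) • ((‖d‖ ^ 2) • (2 • innerSL ℝ u) -
      (4 : ℝ) • ((innerSL ℝ d) ∘L (embL n).toContinuousLinearMap))).smulRight (kernL y u))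
        (EuclideanSpace.single i (1 : ℝ)) * vec (emb (EuclideanSpace.single i (1 : ℝ))) =
      (kernQ y u ^ (-(n / 2 : ℝ))) • (vec d * vec (emb (EuclideanSpace.single i (1 : ℝ))) *
        vec (emb (EuclideanSpace.single i (1 : ℝ)))) +
      (-(n / 2 : ℝ) * kernQ y u ^ (-(n / 2 : ℝ) - 1)) • (kernL y u *
        ((‖d‖ ^ 2 * (2 * inner ℝ u (EuclideanSpace.single i (1 : ℝ))) -
      4 * inner ℝ d (emb (EuclideanSpace.single i (1 : ℝ)))) •
        vec (emb (EuclideanSpace.single i (1 : ℝ))))) := by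
    intro i
    simp only [add_apply, smul_apply, ContinuousLinearMap.comp_apply, mulL_apply, vecL_apply,
      LinearIsometry.coe_toContinuousLinearMap, embL_apply, ContinuousLinearMap.smulRight_apply,
      sub_apply, innerSL_apply_apply, smul_eq_mul, add_mul, smul_mul_assoc, mul_smul_comm,
      smul_smul, nsmul_eq_mul]
    norm_num
  rw [Finset.sum_congr rfl fun i _ => e4 i, Finset.sum_add_distrib, ← Finset.smul_sum,
    ← Finset.smul_sum, ← Finset.mul_sum, hgrad, key, sum_mul_self, Real.rpow_sub_one h.ne',
    smul_neg, smul_smul, smul_smul, ← neg_smul, ← add_smul]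
  convert zero_smul ℝ (vec d)
  field_simp
  ring

theorem kern_monogenic {κ : Bool} {y : Euc (n + 1)} (hy : ‖y‖ = 1) {u : Euc n}
    (h : chart κ u ≠ y) : ∃ K' : Euc n →L[ℝ] Cl (n + 1), HasFDerivAt (kern κ y) K' u ∧
      ∑ i : Fin n, K' (EuclideanSpace.single i (1 : ℝ)) *
        vec (emb (EuclideanSpace.single i (1 : ℝ))) = 0 := by
  obtain ⟨K', h1, h2⟩ := kern₀_monogenic (y := flip n κ y) (by rwa [norm_flip]) (kernQ_pos h)
  have h3 : HasFDerivAt (kern κ y) _ u :=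
    ((mulL (n + 1) (twist n κ)).hasFDerivAt.comp u h1).const_smul (-(sgn κ * 2 ^ n / 2))
  refine ⟨_, h3, ?_⟩
  simp only [smul_apply, ContinuousLinearMap.comp_apply, mulL_apply, smul_mul_assoc, mul_assoc]
  rw [← Finset.smul_sum, ← Finset.mul_sum, h2, mul_zero, smul_zero]

/-- The Cauchy kernel of `ℝⁿ`. -/
def euclG (w : Euc n) : Cl (n + 1) := (‖w‖ ^ n)⁻¹ • vec (emb w)

/-- Near its pole the spherical kernel is exactly, not only asymptotically, a constant left multiple
of the Euclidean one, and the constant undoes the spinor weight at the pole. So the residue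
reproduces the section itself. -/
theorem kern_pole (κ : Bool) (v u : Euc n) :
    kern κ (chart κ v) u = unweight κ v * euclG (u - v) := by
  have hv := (norm_den_pos v).ne'
  have hu := (norm_den_pos u).ne'
  have e0 : den u - den v = emb (u - v) := by rw [den, den, map_sub]; abel
  have e1 : cayley u - cayley v = (2 / ‖den v‖ ^ 2) • den v - (2 / ‖den u‖ ^ 2) • den u := by
    rw [cayley_eq, cayley_eq]; abel
  -- The chordal distance of stereographic projection.
  have e2 : ‖cayley u - cayley v‖ * ‖den u‖ = 2 * ‖u - v‖ / ‖den v‖ := by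
    rw [← sq_eq_sq₀ (by positivity) (by positivity), mul_pow, e1, div_pow, mul_pow,
      ← norm_emb (u - v), ← e0, norm_sub_sq_real, norm_sub_sq_real, norm_smul, norm_smul,
      inner_smul_left, inner_smul_right, real_inner_comm (den v) (den u)]
    simp only [Real.norm_eq_abs, mul_pow, sq_abs, conj_trivial]
    field_simp
  have e3 : kernL (cayley v) u = (2 / ‖den v‖ ^ 2) • (vec (den v) * vec (emb (u - v))) := by
    rw [kernL, ← e0, map_sub vec (den u), mul_sub, vec_den_mul_self,
      show pole n - cayley v = (2 / ‖den v‖ ^ 2) • den v by rw [cayley_eq]; abel, map_smul,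
      smul_mul_assoc, smul_sub, smul_neg, smul_smul, div_mul_cancel₀ _ (pow_ne_zero 2 hv),
      sub_neg_eq_add]
  rw [kern, kern₀, flip_chart, kernQ_rpow, ← mul_inv, ← mul_pow, e2, e3, unweight, euclG]
  simp only [mul_smul_comm, smul_mul_assoc, mul_assoc, smul_smul]
  congr 1
  rw [div_pow, mul_pow]
  field_simp

end Kernel

/-! ### Inverse charts -/

section ChartInverse

variable {n : ℕ}

/-- The projection `ℝⁿ⁺¹ → ℝⁿ` that forgets the last coordinate. -/
def projL (n : ℕ) : Euc (n + 1) →L[ℝ] Euc n := (embL n).toContinuousLinearMap.adjoint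

theorem projL_emb (u : Euc n) : projL n (emb u) = u := by
  have := (embL n).adjoint_comp_self
  exact congrArg (fun f : Euc n →L[ℝ] Euc n => f u) this

theorem projL_pole : projL n (pole n) = 0 := by
  refine ext_inner_left ℝ fun v => ?_
  rw [projL, ContinuousLinearMap.adjoint_inner_right]
  simp [inner_emb_pole]

theorem emb_projL_add (x : Euc (n + 1)) : emb (projL n x) + x (Fin.last n) • pole n = x := by
  have h2 := sum_inner_emb x
  have h3 : projL n x = ∑ i : Fin n, (inner ℝ x (emb (EuclideanSpace.single i (1 : ℝ))) : ℝ) •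
      EuclideanSpace.single i (1 : ℝ) := by
    conv_lhs => rw [euc_eq_sum (projL n x)]
    refine Finset.sum_congr rfl fun i _ => ?_
    congr 1
    have : (projL n x) i = inner ℝ (projL n x) (EuclideanSpace.single i (1 : ℝ)) := by
      simp [EuclideanSpace.inner_single_right]
    rw [this, projL, ContinuousLinearMap.adjoint_inner_left]
    rfl
  rw [h3, map_sum]
  simp only [map_smul]
  rw [h2]
  abel

/-- The inverse of the chart `κ`. -/
def chartInv (κ : Bool) (x : Euc (n + 1)) : Euc n :=
  (-(1 - (flip n κ x) (Fin.last n))⁻¹) • projL n (flip n κ x)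

theorem one_sub_cayley_last (u : Euc n) : 1 - (cayley u) (Fin.last n) = confFactor u := by
  rw [← inner_pole_right, cayley_eq, inner_sub_left, inner_pole_pole, inner_smul_left, den,
    inner_add_left, inner_emb_pole, inner_pole_pole, ← den, confFactor]
  simp

@[simp] theorem chartInv_chart (κ : Bool) (u : Euc n) : chartInv κ (chart κ u) = u := by
  have hc := (confFactor_pos u).ne'
  rw [chartInv, flip_chart, one_sub_cayley_last, cayley_eq, map_sub, map_smul, den, map_add,
    projL_emb, projL_pole, ← den, ← confFactor, zero_sub, add_zero, smul_neg, neg_smul, neg_neg,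
    smul_smul, inv_mul_cancel₀ hc, one_smul]

theorem chart_injective (κ : Bool) : Function.Injective (chart κ : Euc n → Euc (n + 1)) :=
  Function.LeftInverse.injective (chartInv_chart κ)

theorem last_lt_one {x : Euc (n + 1)} (hx : ‖x‖ = 1) (h : x ≠ pole n) : x (Fin.last n) < 1 := by
  rw [← inner_pole_right]
  exact (inner_lt_one_iff_real_of_norm_eq_one hx (norm_pole n)).2 h

theorem chart_chartInv {κ : Bool} {x : Euc (n + 1)} (hx : ‖x‖ = 1) (h : flip n κ x ≠ pole n) :
    chart κ (chartInv κ x) = x := by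
  have hz : ‖flip n κ x‖ = 1 := by rw [norm_flip, hx]
  rw [chart_eq, chartInv]
  set z := flip n κ x
  have hl := last_lt_one hz h
  have hs : 1 - z (Fin.last n) ≠ 0 := by linarith
  have hpr : ‖projL n z‖ ^ 2 = 1 - z (Fin.last n) ^ 2 := by
    have h1 := congrArg (fun w => ‖w‖ ^ 2) (emb_projL_add z)
    simp only [hz] at h1
    rw [norm_add_sq_real, inner_smul_right, inner_emb_pole, norm_emb, norm_smul, norm_pole,
      Real.norm_eq_abs, mul_one, sq_abs] at h1
    linarith
  have hden : ‖den ((-(1 - z (Fin.last n))⁻¹) • projL n z)‖ ^ 2 = 2 / (1 - z (Fin.last n)) := by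
    rw [norm_den_sq, norm_smul, mul_pow, hpr, Real.norm_eq_abs, sq_abs]
    field_simp
    ring
  have : cayley ((-(1 - z (Fin.last n))⁻¹) • projL n z) = z := by
    conv_rhs => rw [← emb_projL_add z]
    rw [cayley_eq, hden, den, map_smul, div_div_eq_mul_div, mul_div_cancel_left₀ _ two_ne_zero,
      smul_add, smul_smul, mul_neg, mul_inv_cancel₀ hs]
    module
  rw [this, flip_flip]

theorem continuousAt_chartInv {κ : Bool} {x : Euc (n + 1)} (hx : ‖x‖ = 1)
    (h : flip n κ x ≠ pole n) : ContinuousAt (chartInv κ) x := by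
  have hz : ‖flip n κ x‖ = 1 := by rw [norm_flip, hx]
  have hl := last_lt_one hz h
  have h1 : Continuous fun x : Euc (n + 1) => (flip n κ x) (Fin.last n) := by
    simp only [← inner_pole_right]
    exact (flip n κ).continuous.inner continuous_const
  unfold chartInv
  have h2 : ContinuousAt (fun x : Euc (n + 1) => -(1 - (flip n κ x) (Fin.last n))⁻¹) x :=
    ((continuous_const.sub h1).continuousAt.inv₀ (sub_pos.2 hl).ne').neg
  exact h2.smul ((projL n).continuous.comp (flip n κ).continuous).continuousAt

theorem continuous_chart (κ : Bool) : Continuous (chart κ : Euc n → Euc (n + 1)) :=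
  continuous_iff_continuousAt.2 fun u => (hasFDerivAt_chart κ u).continuousAt

theorem flip_chart_ne_pole (κ : Bool) (u : Euc n) : flip n κ (chart κ u) ≠ pole n := by
  intro h
  have h1 := one_sub_cayley_last u
  rw [← flip_chart κ, h] at h1
  have := confFactor_pos u
  rw [← h1] at this
  simp [pole] at this

/-- Each chart maps the closed unit ball onto a closed hemisphere, and the two charts are exchanged
by the reflection. -/
theorem exists_chart_eq {x : Euc (n + 1)} (hx : ‖x‖ = 1) :
    ∃ (κ : Bool) (u : Euc n), ‖u‖ ≤ 1 ∧ chart κ u = x := by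
  have aux : ∀ κ : Bool, (flip n κ x) (Fin.last n) ≤ 0 →
      ∃ (κ : Bool) (u : Euc n), ‖u‖ ≤ 1 ∧ chart κ u = x := by
    intro κ hle
    have hne : flip n κ x ≠ pole n := by
      intro h
      rw [h] at hle
      simp [pole] at hle
      linarith
    have h1 := chart_chartInv hx hne
    refine ⟨κ, _, ?_, h1⟩
    have h2 := one_sub_cayley_last (chartInv κ x)
    rw [← flip_chart κ, h1, confFactor, norm_den_sq, eq_div_iff (by positivity)] at h2
    by_contra h3
    nlinarith [norm_nonneg (chartInv κ x), sq_nonneg ‖chartInv κ x‖]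
  by_cases h : x (Fin.last n) ≤ 0
  · exact aux false (by simpa [flip] using h)
  · refine aux true ?_
    have hp : (pole n) (Fin.last n) = 1 := by simp [pole]
    simp only [flip, if_true, reflectL_apply, reflect, PiLp.sub_apply, PiLp.smul_apply, hp,
      smul_eq_mul]
    linarith

end ChartInverse

/-! ### The divergence theorem for compactly supported fields -/

section Divergence

/-- The divergence theorem on a box so large that the fields vanish on its faces. Only the total
divergence has to be continuous, since the single partial derivatives of the fields used later need
not be. -/
theorem integral_divergence_eq_zero {m : ℕ} {E : Type*} [NormedAddCommGroup E] [NormedSpace ℝ E]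
    [CompleteSpace E]
    {f : Fin (m + 1) → Euc (m + 1) → E} {f' : Fin (m + 1) → Euc (m + 1) → Euc (m + 1) →L[ℝ] E}
    (hf : ∀ i u, HasFDerivAt (f i) (f' i u) u) (hs : ∀ i, HasCompactSupport (f i))
    (hc : Continuous fun u => ∑ i, f' i u (EuclideanSpace.single i (1 : ℝ))) :
    ∫ u, ∑ i, f' i u (EuclideanSpace.single i (1 : ℝ)) = 0 := by
  let eL : (Fin (m + 1) → ℝ) ≃L[ℝ] Euc (m + 1) := (EuclideanSpace.equiv (Fin (m + 1)) ℝ).symm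
  have hbd : ∃ R : ℝ, 0 < R ∧ ∀ i u, R ≤ ‖u‖ → f i u = 0 := by
    have hK : IsCompact (⋃ i, tsupport (f i)) := isCompact_iUnion fun i => hs i
    obtain ⟨R, hR⟩ := hK.isBounded.exists_norm_le
    refine ⟨max R 0 + 1, by positivity, fun i u hu => ?_⟩
    by_contra h
    have := hR u (mem_iUnion.2 ⟨i, subset_tsupport _ h⟩)
    have := le_max_left R 0
    linarith
  obtain ⟨R, hR, hfR⟩ := hbd
  have hge : ∀ (w : Fin (m + 1) → ℝ) j, |w j| = R → R ≤ ‖eL w‖ := by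
    intro w j hj
    rw [← hj]
    exact PiLp.norm_apply_le (eL w) j
  have hout : ∀ u : Euc (m + 1), R < ‖u‖ →
      ∑ i, f' i u (EuclideanSpace.single i (1 : ℝ)) = 0 := by
    intro u hu
    refine Finset.sum_eq_zero fun i _ => ?_
    have : f i =ᶠ[𝓝 u] fun _ => 0 := by
      filter_upwards [(isOpen_lt continuous_const continuous_norm).mem_nhds hu] with w hw
      exact hfR i w hw.le
    rw [(hf i u).unique ((hasFDerivAt_const (0 : E) u).congr_of_eventuallyEq this)]
    simp
  have hmp : MeasurePreserving eL volume volume :=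
    (EuclideanSpace.volume_preserving_symm_measurableEquiv_toLp (Fin (m + 1))).symm
  have hemb : MeasurableEmbedding eL := eL.toHomeomorph.measurableEmbedding
  rw [← hmp.integral_comp hemb]
  have h1 := integral_divergence_of_hasFDerivAt_off_countable' (fun _ : Fin (m + 1) => -R)
    (fun _ => R) (fun _ => by dsimp only; linarith) (fun i w => f i (eL w))
    (fun i w => (f' i (eL w)).comp eL.toContinuousLinearMap) ∅ countable_empty
    (fun i => (continuous_iff_continuousAt.2 fun u =>
      (hf i u).continuousAt).comp eL.continuous |>.continuousOn)
    (fun w _ i => (hf i (eL w)).comp w eL.hasFDerivAt)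
    (by
      refine Continuous.integrableOn_Icc ?_
      exact hc.comp eL.continuous)
  have h2 : ∀ (w : Fin (m + 1) → ℝ),
      ∑ i, ((f' i (eL w)).comp eL.toContinuousLinearMap) (Pi.single i 1) =
      ∑ i, f' i (eL w) (EuclideanSpace.single i (1 : ℝ)) := fun w => rfl
  simp only [h2] at h1
  rw [setIntegral_eq_integral_of_forall_compl_eq_zero] at h1
  · rw [h1]
    refine Finset.sum_eq_zero fun i _ => ?_
    rw [sub_eq_zero]
    trans (0 : E)
    · refine integral_eq_zero_of_ae (Filter.Eventually.of_forall fun x => ?_)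
      exact hfR i _ (hge _ i (by simp [abs_of_pos hR]))
    · symm
      refine integral_eq_zero_of_ae (Filter.Eventually.of_forall fun x => ?_)
      exact hfR i _ (hge _ i (by simp [abs_of_pos hR]))
  · intro w hw
    refine hout _ ?_
    by_contra hle
    refine hw ⟨fun i => ?_, fun i => ?_⟩
    · exact (abs_le.1 ((PiLp.norm_apply_le (eL w) i).trans (not_lt.1 hle))).1
    · exact (abs_le.1 ((PiLp.norm_apply_le (eL w) i).trans (not_lt.1 hle))).2

/-- The gradient as an element of the Clifford algebra. -/
theorem vec_emb_gradient {n : ℕ} {ζ : Euc n → ℝ} {u : Euc n} :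
    vec (emb (gradient ζ u)) = ∑ i : Fin n, (fderiv ℝ ζ u (EuclideanSpace.single i (1 : ℝ))) •
      vec (emb (EuclideanSpace.single i (1 : ℝ))) := by
  conv_lhs => rw [euc_eq_sum (gradient ζ u)]
  simp only [map_sum, map_smul]
  refine Finset.sum_congr rfl fun i _ => ?_
  congr 1
  have h1 : (gradient ζ u) i = inner ℝ (gradient ζ u) (EuclideanSpace.single i (1 : ℝ)) := by
    rw [EuclideanSpace.inner_single_right]
    simp
  rw [h1, inner_gradient_left]

/-- `K` is annihilated by the Dirac operator acting from the right at `u`. -/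
def IsRightMonogenicAt {n : ℕ} (K : Euc n → Cl (n + 1)) (u : Euc n) : Prop :=
  ∃ K' : Euc n →L[ℝ] Cl (n + 1), HasFDerivAt K K' u ∧
    ∑ i : Fin n, K' (EuclideanSpace.single i (1 : ℝ)) *
      vec (emb (EuclideanSpace.single i (1 : ℝ))) = 0

/-- `h` is annihilated by the Dirac operator acting from the left at `u`. -/
def IsLeftMonogenicAt {n : ℕ} (h : Euc n → Cl (n + 1)) (u : Euc n) : Prop :=
  DifferentiableAt ℝ h u ∧ dirac h u = 0

theorem continuous_gradient {n : ℕ} {ζ : Euc n → ℝ} (hζ : ContDiff ℝ 1 ζ) :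
    Continuous (gradient ζ) :=
  (InnerProductSpace.toDual ℝ (Euc n)).symm.continuous.comp (hζ.continuous_fderiv one_ne_zero)

theorem gradient_eq_zero_of_notMem_tsupport {n : ℕ} {ζ : Euc n → ℝ} {u : Euc n}
    (hu : u ∉ tsupport ζ) : gradient ζ u = 0 := by
  have : fderiv ℝ ζ u = 0 := by
    by_contra h
    exact hu (support_fderiv_subset ℝ h)
  rw [gradient, this, map_zero]

theorem continuous_kernel_gradient {n : ℕ} {K h : Euc n → Cl (n + 1)} {ζ : Euc n → ℝ}
    (hζ : ContDiff ℝ 1 ζ) (hK : ∀ u ∈ tsupport (gradient ζ), ContinuousAt K u)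
    (hh : ∀ u ∈ tsupport (gradient ζ), ContinuousAt h u) :
    Continuous fun u => K u * vec (emb (gradient ζ u)) * h u := by
  refine continuous_iff_continuousAt.2 fun u => ?_
  by_cases hu : u ∈ tsupport (gradient ζ)
  · have h1 : Continuous fun u => (vec (emb (gradient ζ u)) : Cl (n + 1)) :=
      continuous_vec.comp (continuous_emb.comp (continuous_gradient hζ))
    exact ((hK u hu).mul h1.continuousAt).mul (hh u hu)
  · have : (fun u => K u * vec (emb (gradient ζ u)) * h u) =ᶠ[𝓝 u] fun _ => 0 := by
      filter_upwards [(isClosed_tsupport _).isOpen_compl.mem_nhds hu] with w hw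
      rw [image_eq_zero_of_notMem_tsupport hw]
      simp
    exact continuousAt_const.congr this.symm

theorem tsupport_gradient_subset {n : ℕ} {ζ : Euc n → ℝ} :
    tsupport (gradient ζ) ⊆ tsupport ζ := by
  refine closure_minimal (fun u hu => ?_) (isClosed_tsupport ζ)
  by_contra h
  exact hu (gradient_eq_zero_of_notMem_tsupport h)

/-- The integrand is the divergence of the fields `ζ K e_i h`: by the product rule the terms with `K
D` and `D h` vanish, and only the gradient of `ζ` survives. -/
theorem integral_kernel_gradient_eq_zero {m : ℕ} {K h : Euc (m + 1) → Cl (m + 2)}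
    {ζ : Euc (m + 1) → ℝ} (hζ : ContDiff ℝ 1 ζ) (hs : HasCompactSupport ζ)
    (hK : ∀ u ∈ tsupport ζ, IsRightMonogenicAt K u)
    (hh : ∀ u ∈ tsupport ζ, IsLeftMonogenicAt h u) :
    ∫ u, K u * vec (emb (gradient ζ u)) * h u = 0 := by
  let e : Fin (m + 1) → Cl (m + 2) := fun i => vec (emb (EuclideanSpace.single i (1 : ℝ)))
  let f : Fin (m + 1) → Euc (m + 1) → Cl (m + 2) := fun i u => ζ u • (K u * e i * h u)
  have hdζ : ∀ u, HasFDerivAt ζ (fderiv ℝ ζ u) u := fun u =>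
    (hζ.differentiable one_ne_zero u).hasFDerivAt
  have hdiff : ∀ u, ∃ g : Fin (m + 1) → Euc (m + 1) →L[ℝ] Cl (m + 2),
      (∀ i, HasFDerivAt (f i) (g i) u) ∧
      ∑ i, g i (EuclideanSpace.single i (1 : ℝ)) = K u * vec (emb (gradient ζ u)) * h u := by
    intro u
    by_cases hu : u ∈ tsupport ζ
    · obtain ⟨K', hK1, hK2⟩ := hK u hu
      obtain ⟨hh1, hh2⟩ := hh u hu
      have hprod : ∀ i, HasFDerivAt (fun u => K u * e i * h u) _ u := fun i =>
        (mulL (m + 2)).hasFDerivAt_of_bilinear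
          (((mulL (m + 2)).flip (e i)).hasFDerivAt.comp u hK1) hh1.hasFDerivAt
      refine ⟨fun i => _, fun i => (hdζ u).smul (hprod i), ?_⟩
      rw [vec_emb_gradient]
      simp only [add_apply, smul_apply, ContinuousLinearMap.smulRight_apply,
        ContinuousLinearMap.precompR_apply, ContinuousLinearMap.precompL_apply, mulL_apply,
        ContinuousLinearMap.compL_apply, ContinuousLinearMap.comp_apply,
        ContinuousLinearMap.flip_apply]
      rw [Finset.sum_add_distrib, ← Finset.smul_sum, Finset.sum_add_distrib, ← Finset.sum_mul, hK2]
      simp only [mul_assoc]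
      rw [← Finset.mul_sum]
      change ζ u • (K u * dirac h u + 0 * h u) + _ = _
      rw [hh2, mul_zero, zero_mul, add_zero, smul_zero, zero_add, Finset.sum_mul, Finset.mul_sum]
      simp only [mul_smul_comm, smul_mul_assoc, e]
    · refine ⟨fun i => 0, fun i => ?_, ?_⟩
      · refine (hasFDerivAt_const (0 : Cl (m + 2)) u).congr_of_eventuallyEq ?_
        filter_upwards [(isClosed_tsupport _).isOpen_compl.mem_nhds hu] with w hw
        simp [f, image_eq_zero_of_notMem_tsupport hw]
      · rw [gradient_eq_zero_of_notMem_tsupport hu]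
        simp
  choose g hg1 hg2 using hdiff
  have h1 := integral_divergence_eq_zero (f := f) (f' := fun i u => g u i)
    (fun i u => hg1 u i)
    (fun i => hs.smul_right)
    (by
      simp only [hg2]
      refine continuous_kernel_gradient hζ (fun u hu => ?_) (fun u hu => ?_)
      · obtain ⟨K', hK1, _⟩ := hK u (tsupport_gradient_subset hu)
        exact hK1.continuousAt
      · exact (hh u (tsupport_gradient_subset hu)).1.continuousAt)
  simpa only [hg2] using h1

end Divergence

/-! ### The reproducing property of the kernel at its pole -/

section Pole

open Filter

/-- A smooth function that is `1` for `s ≤ 1/2` and `0` for `s ≥ 1`. -/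
def cutoff (s : ℝ) : ℝ := Real.smoothTransition (2 - 2 * s)

theorem contDiff_cutoff : ContDiff ℝ 1 cutoff :=
  (Real.smoothTransition.contDiff (n := 1)).comp (contDiff_const.sub (contDiff_const.mul contDiff_id))

theorem cutoff_of_le {s : ℝ} (h : s ≤ 1 / 2) : cutoff s = 1 :=
  Real.smoothTransition.one_of_one_le (by linarith)

theorem cutoff_of_ge {s : ℝ} (h : 1 ≤ s) : cutoff s = 0 :=
  Real.smoothTransition.zero_of_nonpos (by linarith)

theorem antitone_cutoff : Antitone cutoff := fun a b h =>
  Real.smoothTransition.monotone (by linarith)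

theorem hasDerivAt_cutoff (s : ℝ) : HasDerivAt cutoff (deriv cutoff s) s :=
  (contDiff_cutoff.differentiable one_ne_zero s).hasDerivAt

theorem deriv_cutoff_of_gt {s : ℝ} (h : 1 < s) : deriv cutoff s = 0 := by
  have : cutoff =ᶠ[𝓝 s] fun _ => 0 := by
    filter_upwards [Ioi_mem_nhds h] with t ht
    exact cutoff_of_ge ht.le
  rw [this.deriv_eq, deriv_const]

variable {n : ℕ}

/-- The cutoff function of the ball of radius `ε` at `v`. -/
def ballCutoff (v : Euc n) (ε : ℝ) (u : Euc n) : ℝ := cutoff (‖u - v‖ ^ 2 / ε ^ 2)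

/-- The radial profile of `G ∇(ballCutoff)`. -/
def profile (n : ℕ) (ε t : ℝ) : ℝ :=
  -(2 / ε ^ 2 * deriv cutoff (t ^ 2 / ε ^ 2)) * (t ^ 2 * (t ^ n)⁻¹)

theorem contDiff_ballCutoff (v : Euc n) (ε : ℝ) : ContDiff ℝ 1 (ballCutoff v ε) :=
  contDiff_cutoff.comp (((contDiff_id.sub contDiff_const).norm_sq ℝ).div_const _)

theorem ballCutoff_of_le {v : Euc n} {ε : ℝ} (hε : 0 < ε) {u : Euc n} (h : ‖u - v‖ ≤ ε / 2) :
    ballCutoff v ε u = 1 := by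
  refine cutoff_of_le ?_
  rw [div_le_iff₀ (by positivity)]
  nlinarith [norm_nonneg (u - v)]

theorem ballCutoff_of_ge {v : Euc n} {ε : ℝ} (hε : 0 < ε) {u : Euc n} (h : ε ≤ ‖u - v‖) :
    ballCutoff v ε u = 0 := by
  refine cutoff_of_ge ?_
  rw [le_div_iff₀ (by positivity)]
  nlinarith [norm_nonneg (u - v)]

theorem tsupport_ballCutoff {v : Euc n} {ε : ℝ} (hε : 0 < ε) :
    tsupport (ballCutoff v ε) ⊆ closedBall v ε := by
  refine closure_minimal (fun u hu => ?_) isClosed_closedBall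
  rw [mem_closedBall, dist_eq_norm]
  by_contra h
  exact hu (ballCutoff_of_ge hε (not_le.1 h).le)

theorem gradient_ballCutoff (v : Euc n) (ε : ℝ) (u : Euc n) :
    gradient (ballCutoff v ε) u = (2 / ε ^ 2 * deriv cutoff (‖u - v‖ ^ 2 / ε ^ 2)) • (u - v) := by
  refine HasGradientAt.gradient (hasGradientAt_iff_hasFDerivAt.2 ?_)
  have h1 : HasFDerivAt (fun u : Euc n => ‖u - v‖ ^ 2) (2 • innerSL ℝ (u - v)) u := by
    have := ((hasFDerivAt_id (𝕜 := ℝ) u).sub_const v).norm_sq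
    exact this
  have h2 := (hasDerivAt_cutoff (‖u - v‖ ^ 2 / ε ^ 2)).comp_hasFDerivAt u
    (h1.mul_const (ε ^ 2)⁻¹)
  refine HasFDerivAt.congr_fderiv h2 ?_
  ext w
  simp
  ring

/-- The gradient of a radial function is parallel to the argument of the kernel, so their product is
a scalar: the kernel acts as an approximate identity. -/
theorem euclG_mul_gradient_ballCutoff (v : Euc n) (ε : ℝ) (u : Euc n) (a : Cl (n + 1)) :
    euclG (u - v) * vec (emb (gradient (ballCutoff v ε) u)) * a = profile n ε ‖u - v‖ • a := by
  rw [gradient_ballCutoff, euclG, map_smul, map_smul, smul_mul_smul_comm, vec_mul_self, norm_emb,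
    Algebra.algebraMap_eq_smul_one, smul_smul, smul_mul_assoc, one_mul, profile]
  congr 1
  ring

theorem profile_of_gt {ε t : ℝ} (hε : 0 < ε) (h : ε < t) : profile n ε t = 0 := by
  rw [profile, deriv_cutoff_of_gt]
  · simp
  · rw [lt_div_iff₀ (by positivity)]
    nlinarith

theorem profile_nonneg {ε t : ℝ} (ht : 0 ≤ t) : 0 ≤ profile n ε t := by
  have h1 : deriv cutoff (t ^ 2 / ε ^ 2) ≤ 0 := antitone_cutoff.deriv_nonpos
  have h2 : 2 / ε ^ 2 * deriv cutoff (t ^ 2 / ε ^ 2) ≤ 0 :=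
    mul_nonpos_of_nonneg_of_nonpos (by positivity) h1
  exact mul_nonneg (by linarith) (by positivity)

theorem sphereArea_pos (m : ℕ) : 0 < sphereArea (m + 1) := by
  refine mul_pos (by positivity) (ENNReal.toReal_pos ?_ ?_)
  · exact (measure_ball_pos _ _ one_pos).ne'
  · exact measure_ball_lt_top.ne

/-- In polar coordinates the powers of the radius cancel and the derivative of the cutoff is left,
which integrates to its total drop 1. -/
theorem integral_profile {m : ℕ} {ε : ℝ} (hε : 0 < ε) (v : Euc (m + 1)) :
    ∫ u, profile (m + 1) ε ‖u - v‖ = sphereArea (m + 1) := by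
  rw [integral_sub_right_eq_self (fun u : Euc (m + 1) => profile (m + 1) ε ‖u‖) v,
    integral_fun_norm_addHaar volume (profile (m + 1) ε), finrank_euclideanSpace_fin]
  have h1 : ∫ y in Ioi (0 : ℝ), y ^ (m + 1 - 1) • profile (m + 1) ε y = 1 := by
    have hd : ∀ y : ℝ, HasDerivAt (fun y : ℝ => -cutoff (y ^ 2 / ε ^ 2))
        (-(deriv cutoff (y ^ 2 / ε ^ 2) * (2 * y / ε ^ 2))) y := by
      intro y
      have h2 : HasDerivAt (fun y : ℝ => y ^ 2 / ε ^ 2) (2 * y / ε ^ 2) y := by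
        simpa using (hasDerivAt_pow 2 y).div_const (ε ^ 2)
      exact ((hasDerivAt_cutoff _).comp y h2).neg
    have h3 : ∀ y ∈ Ioi (0 : ℝ), y ^ (m + 1 - 1) • profile (m + 1) ε y =
        -(deriv cutoff (y ^ 2 / ε ^ 2) * (2 * y / ε ^ 2)) := by
      intro y hy
      have hy' : y ≠ 0 := (mem_Ioi.1 hy).ne'
      rw [profile, Nat.add_sub_cancel, smul_eq_mul]
      field_simp
      try ring
    rw [setIntegral_congr_fun measurableSet_Ioi h3,
      integral_Ioi_of_hasDerivAt_of_nonneg' (l := 0) (fun y _ => hd y)]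
    · simp [cutoff_of_le]
    · intro y hy
      have : deriv cutoff (y ^ 2 / ε ^ 2) ≤ 0 := antitone_cutoff.deriv_nonpos
      have hy' : 0 < y := hy
      have : 0 ≤ 2 * y / ε ^ 2 := by positivity
      nlinarith
    · refine tendsto_const_nhds.congr' ?_
      filter_upwards [eventually_ge_atTop ε] with y hy
      rw [cutoff_of_ge, neg_zero]
      rw [le_div_iff₀ (by positivity)]
      nlinarith
  rw [h1, sphereArea]
  simp [Measure.real]

/-- A Bochner integral that is not 0 can only come from an integrable function. -/
theorem integrable_profile {m : ℕ} {ε : ℝ} (hε : 0 < ε) (v : Euc (m + 1)) :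
    Integrable fun u => profile (m + 1) ε ‖u - v‖ :=
  .of_integral_ne_zero (by rw [integral_profile hε]; exact (sphereArea_pos m).ne')

theorem hasCompactSupport_kernel_gradient {K h : Euc n → Cl (n + 1)} {ζ : Euc n → ℝ}
    (hs : HasCompactSupport ζ) :
    HasCompactSupport fun u => K u * vec (emb (gradient ζ u)) * h u := by
  refine HasCompactSupport.mono' hs fun u hu => ?_
  by_contra h
  exact hu (by simp [gradient_eq_zero_of_notMem_tsupport h])

theorem notMem_tsupport_gradient {ζ : Euc n → ℝ} {v : Euc n} {c : ℝ} (h : ∀ᶠ u in 𝓝 v, ζ u = c) :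
    v ∉ tsupport (gradient ζ) := by
  rw [notMem_tsupport_iff_eventuallyEq]
  filter_upwards [h.eventually_nhds] with u hu
  have h1 : ζ =ᶠ[𝓝 u] fun _ => c := hu
  have h2 : fderiv ℝ ζ u = 0 := by rw [h1.fderiv_eq]; simp
  rw [gradient, h2, map_zero, Pi.zero_apply]

/-- The residue. The value does not change when `ζ` is replaced by a cutoff of an arbitrarily small
ball, because the difference vanishes near the pole and the divergence theorem applies to it. On
small balls the kernel times the gradient is a positive scalar of total mass `sphereArea`, and `h`
is nearly constant. -/
theorem integral_kern_pole {m : ℕ} (κ : Bool) (v : Euc (m + 1)) {h : Euc (m + 1) → Cl (m + 2)}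
    {ζ : Euc (m + 1) → ℝ} (hζ : ContDiff ℝ 1 ζ) (hs : HasCompactSupport ζ)
    (hζ1 : ∀ᶠ u in 𝓝 v, ζ u = 1) (hh : ∀ u ∈ tsupport ζ, IsLeftMonogenicAt h u) :
    ∫ u, kern κ (chart κ v) u * vec (emb (gradient ζ u)) * h u =
      sphereArea (m + 1) • (unweight κ v * h v) := by
  have hvs : v ∈ tsupport ζ := by
    refine subset_tsupport ζ ?_
    rw [Function.mem_support, hζ1.self_of_nhds]
    exact one_ne_zero
  have hkmono : ∀ u, u ≠ v → IsRightMonogenicAt (kern κ (chart κ v)) u := fun u hu =>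
    kern_monogenic (norm_chart κ v) fun h => hu (chart_injective κ h)
  have hkcont : ∀ u, u ≠ v → ContinuousAt (kern κ (chart κ v)) u := fun u hu => by
    obtain ⟨_, h1, _⟩ := hkmono u hu
    exact h1.continuousAt
  set X := ∫ u, kern κ (chart κ v) u * vec (emb (gradient ζ u)) * h u with hX
  have key : ∀ η > 0, ∃ Y, X = unweight κ v * Y ∧
      ‖Y - sphereArea (m + 1) • h v‖ ≤ η * sphereArea (m + 1) := by
    intro η hη
    have hcv : ContinuousAt h v := (hh v hvs).1.continuousAt
    obtain ⟨δ, hδ, hδ1⟩ := Metric.eventually_nhds_iff.1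
      (hζ1.and (Metric.continuousAt_iff'.1 hcv η hη))
    have hε : 0 < δ / 2 := by positivity
    set ε := δ / 2 with hεδ
    have hball : ∀ u ∈ closedBall v ε, ζ u = 1 ∧ dist (h u) (h v) < η := by
      intro u hu
      refine hδ1 (lt_of_le_of_lt (mem_closedBall.1 hu) ?_)
      linarith
    have hts : tsupport (ballCutoff v ε) ⊆ tsupport ζ := by
      refine (tsupport_ballCutoff hε).trans fun u hu => subset_tsupport ζ ?_
      rw [Function.mem_support, (hball u hu).1]
      exact one_ne_zero
    have hBs : HasCompactSupport (ballCutoff v ε) := hs.of_isClosed_subset (isClosed_tsupport _) hts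
    have hB1 : ∀ᶠ u in 𝓝 v, ballCutoff v ε u = 1 := by
      filter_upwards [ball_mem_nhds v (half_pos hε)] with u hu
      refine ballCutoff_of_le hε ?_
      rw [← dist_eq_norm]
      exact (mem_ball.1 hu).le
    have hBc := contDiff_ballCutoff v ε
    have hdsub : ContDiff ℝ 1 (fun u => ζ u - ballCutoff v ε u) := hζ.sub hBc
    have htsub : tsupport (fun u => ζ u - ballCutoff v ε u) ⊆ tsupport ζ :=
      (tsupport_sub ζ (ballCutoff v ε)).trans (union_subset subset_rfl hts)
    have hne : ∀ u ∈ tsupport (fun u => ζ u - ballCutoff v ε u), u ≠ v := by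
      rintro u hu rfl
      refine absurd hu ?_
      rw [notMem_tsupport_iff_eventuallyEq]
      filter_upwards [hζ1, hB1] with w hw1 hw2
      rw [hw1, hw2, sub_self, Pi.zero_apply]
    have h0 := integral_kernel_gradient_eq_zero (K := kern κ (chart κ v)) (h := h) hdsub
      (hs.of_isClosed_subset (isClosed_tsupport _) htsub)
      (fun u hu => hkmono u (hne u hu)) (fun u hu => hh u (htsub hu))
    have hint : ∀ {ξ : Euc (m + 1) → ℝ} (K : Euc (m + 1) → Cl (m + 2)),
        (∀ u, u ≠ v → ContinuousAt K u) → ContDiff ℝ 1 ξ → HasCompactSupport ξ →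
        tsupport ξ ⊆ tsupport ζ → (∀ᶠ u in 𝓝 v, ξ u = 1) →
        Integrable fun u => K u * vec (emb (gradient ξ u)) * h u := by
      intro ξ K hK hξ hξs hξt hξ1
      refine (continuous_kernel_gradient hξ ?_ ?_).integrable_of_hasCompactSupport
        (hasCompactSupport_kernel_gradient hξs)
      · intro u hu
        refine hK u ?_
        rintro rfl
        exact notMem_tsupport_gradient hξ1 hu
      · exact fun u hu => (hh u (hξt (tsupport_gradient_subset hu))).1.continuousAt
    have hgr : ∀ u, gradient (fun u => ζ u - ballCutoff v ε u) u =
        gradient ζ u - gradient (ballCutoff v ε) u := by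
      intro u
      rw [gradient, fderiv_fun_sub (hζ.differentiable one_ne_zero u)
        (hBc.differentiable one_ne_zero u), map_sub]
      rfl
    have hXB : X = ∫ u, kern κ (chart κ v) u * vec (emb (gradient (ballCutoff v ε) u)) * h u := by
      rw [← sub_eq_zero, hX, ← integral_sub (hint _ hkcont hζ hs subset_rfl hζ1)
        (hint _ hkcont hBc hBs hts hB1), ← h0]
      refine integral_congr_ae (Eventually.of_forall fun u => ?_)
      simp only [hgr, map_sub, mul_sub, sub_mul]
    have hEc : ∀ u, u ≠ v → ContinuousAt (fun u => (euclG (u - v) : Cl (m + 2))) u := by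
      intro u hu
      have hu' : ‖u - v‖ ^ (m + 1) ≠ 0 := pow_ne_zero _ (norm_ne_zero_iff.2 (sub_ne_zero.2 hu))
      have h1 : Continuous fun u => ‖u - v‖ ^ (m + 1) :=
        ((continuous_id.sub continuous_const).norm).pow _
      exact (h1.continuousAt.inv₀ hu').smul
        (continuous_vec.comp (continuous_emb.comp (continuous_id.sub continuous_const))).continuousAt
    have hPint := hint (fun u => euclG (u - v)) hEc hBc hBs hts hB1
    simp only [euclG_mul_gradient_ballCutoff] at hPint
    refine ⟨∫ u, profile (m + 1) ε ‖u - v‖ • h u, ?_, ?_⟩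
    · rw [hXB]
      have : ∀ u, kern κ (chart κ v) u * vec (emb (gradient (ballCutoff v ε) u)) * h u =
          mulL (m + 2) (unweight κ v) (profile (m + 1) ε ‖u - v‖ • h u) := by
        intro u
        rw [kern_pole, mul_assoc, mul_assoc, ← mul_assoc (euclG _), euclG_mul_gradient_ballCutoff,
          mulL_apply]
      simp only [this]
      rw [ContinuousLinearMap.integral_comp_comm _ hPint, mulL_apply]
    · rw [← integral_profile hε v, ← integral_smul_const, ← integral_sub hPint
        ((integrable_profile hε v).smul_const _), ← integral_const_mul]
      refine norm_integral_le_of_norm_le ((integrable_profile hε v).const_mul η)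
        (Eventually.of_forall fun u => ?_)
      rw [← smul_sub, norm_smul, Real.norm_eq_abs, abs_of_nonneg (profile_nonneg (norm_nonneg _))]
      by_cases hu : u ∈ closedBall v ε
      · rw [mul_comm]
        refine mul_le_mul_of_nonneg_right ?_ (profile_nonneg (norm_nonneg _))
        rw [← dist_eq_norm]
        exact (hball u hu).2.le
      · rw [mem_closedBall, dist_eq_norm, not_le] at hu
        rw [profile_of_gt hε hu]
        simp
  rw [← mul_smul_comm, ← sub_eq_zero, ← norm_le_zero_iff]
  refine le_of_forall_pos_le_add fun τ hτ => ?_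
  -- The added 1 keeps the divisor positive even if the operator norm were 0.
  set A := ‖mulL (m + 2) (unweight κ v)‖ * sphereArea (m + 1) + 1 with hA
  have hA0 : 0 < A := by have := sphereArea_pos m; positivity
  obtain ⟨Y, hY1, hY2⟩ := key (τ / A) (by positivity)
  rw [hY1, ← mul_sub, ← mulL_apply, zero_add]
  calc _ ≤ ‖mulL (m + 2) (unweight κ v)‖ * ‖Y - sphereArea (m + 1) • h v‖ :=
        ContinuousLinearMap.le_opNorm _ _
    _ ≤ ‖mulL (m + 2) (unweight κ v)‖ * (τ / A * sphereArea (m + 1)) := by gcongr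
    _ = (τ / A) * (A - 1) := by rw [hA]; ring
    _ ≤ (τ / A) * A := by gcongr; linarith
    _ = τ := div_mul_cancel₀ _ hA0.ne'

end Pole

/-! ### The divergence theorem below a Lipschitz graph -/

section Mollify

open Filter Convolution ContinuousLinearMap

variable {m : ℕ}

/-- Differentiation under the integral sign: difference quotients of `φ` are bounded by `L`, and `φ`
is differentiable almost everywhere by Rademacher's theorem. -/
theorem lipschitz_hasFDerivAt_bump_convolution {φ : Euc m → ℝ} {L : ℝ≥0}
    (hφ : LipschitzWith L φ) (ρ : ContDiffBump (0 : Euc m)) (x : Euc m) :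
    HasFDerivAt (ρ.normed volume ⋆[lsmul ℝ ℝ, volume] φ)
      ((ρ.normed volume ⋆[lsmul ℝ ℝ, volume] (fderiv ℝ φ) : Euc m → Euc m →L[ℝ] ℝ) x) x := by
  have hρc : Continuous (ρ.normed (volume : Measure (Euc m))) := ρ.continuous_normed
  have hρi : Integrable (ρ.normed (volume : Measure (Euc m))) := ρ.integrable_normed
  refine (hasFDerivAt_integral_of_dominated_loc_of_lip
    (bound := fun t => ρ.normed volume t * L) (s := univ) univ_mem ?_ ?_ ?_ ?_ ?_ ?_).2
  · refine Eventually.of_forall fun y => ?_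
    exact (hρc.smul (hφ.continuous.comp (continuous_const.sub continuous_id))).aestronglyMeasurable
  · exact (hρc.smul (hφ.continuous.comp
      (continuous_const.sub continuous_id))).integrable_of_hasCompactSupport
      ρ.hasCompactSupport_normed.smul_right
  · refine (hρc.aestronglyMeasurable).smul ?_
    exact ((measurable_fderiv ℝ φ).comp (measurable_const.sub measurable_id)).aestronglyMeasurable
  · refine Eventually.of_forall fun t => ?_
    refine LipschitzOnWith.of_dist_le_mul fun y _ z _ => ?_
    simp only [lsmul_apply, smul_eq_mul, Real.dist_eq, ← mul_sub, abs_mul, Real.coe_nnabs,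
      abs_of_nonneg (ρ.nonneg_normed t), NNReal.abs_eq]
    rw [mul_assoc]
    refine mul_le_mul_of_nonneg_left ?_ (ρ.nonneg_normed t)
    have := hφ.dist_le_mul (y - t) (z - t)
    rwa [Real.dist_eq, dist_sub_right] at this
  · exact hρi.mul_const _
  · have h1 : ∀ᵐ t : Euc m, DifferentiableAt ℝ φ (x - t) := by
      have h2 := hφ.ae_differentiableAt (μ := volume)
      exact (Measure.measurePreserving_sub_left volume x).quasiMeasurePreserving.ae h2
    filter_upwards [h1] with t ht
    have h3 : HasFDerivAt (fun y => φ (y - t)) (fderiv ℝ φ (x - t)) x := by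
      have := ht.hasFDerivAt.comp x ((hasFDerivAt_id (𝕜 := ℝ) x).sub_const t)
      exact this
    exact h3.const_smul (ρ.normed volume t)

/-- The gradient of a mollification is the mollification of the gradient. It is therefore bounded by
`L` and converges at every Lebesgue point. -/
theorem lipschitz_exists_contDiff_approx {φ : Euc m → ℝ} {L : ℝ≥0} (hφ : LipschitzWith L φ) :
    ∃ ψ : ℕ → Euc m → ℝ, (∀ k, ContDiff ℝ 1 (ψ k)) ∧ (∀ k x, ‖gradient (ψ k) x‖ ≤ L) ∧
      (∀ x, Tendsto (fun k => ψ k x) atTop (𝓝 (φ x))) ∧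
      ∀ᵐ x, Tendsto (fun k => gradient (ψ k) x) atTop (𝓝 (gradient φ x)) := by
  -- The fixed ratio 2 of the outer to the inner radius is what the Lebesgue differentiation of
  -- convolutions asks for.
  let ρ : ℕ → ContDiffBump (0 : Euc m) := fun k =>
    ⟨1 / ((k : ℝ) + 1), 2 * (1 / ((k : ℝ) + 1)), by positivity, by
      have : 0 < 1 / ((k : ℝ) + 1) := by positivity
      linarith⟩
  have hρ : Tendsto (fun k => (ρ k).rOut) atTop (𝓝 0) := by
    have := (tendsto_one_div_add_atTop_nhds_zero_nat (𝕜 := ℝ)).const_mul 2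
    rw [mul_zero] at this
    exact this
  have hd := fun k => lipschitz_hasFDerivAt_bump_convolution hφ (ρ k)
  refine ⟨fun k => (ρ k).normed volume ⋆[lsmul ℝ ℝ, volume] φ, fun k => ?_, fun k x => ?_,
    fun x => ?_, ?_⟩
  · exact (ρ k).hasCompactSupport_normed.contDiff_convolution_left _
      ((ρ k).contDiff_normed (n := 1)) hφ.continuous.locallyIntegrable
  · rw [gradient, LinearIsometryEquiv.norm_map, (hd k x).fderiv, convolution_def]
    refine (norm_integral_le_of_norm_le (g := fun t => (ρ k).normed volume t * L)
      ((ρ k).integrable_normed.mul_const _) (Eventually.of_forall fun t => ?_)).trans ?_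
    · rw [lsmul_apply, norm_smul, Real.norm_eq_abs, abs_of_nonneg ((ρ k).nonneg_normed t)]
      exact mul_le_mul_of_nonneg_left (norm_fderiv_le_of_lipschitz ℝ hφ) ((ρ k).nonneg_normed t)
    · rw [integral_mul_const, (ρ k).integral_normed, one_mul]
  · exact ContDiffBump.convolution_tendsto_right_of_continuous hρ hφ.continuous x
  · have hloc : LocallyIntegrable (fderiv ℝ φ) volume := by
      refine (locallyIntegrable_const (L : ℝ)).mono
        (measurable_fderiv ℝ φ).aestronglyMeasurable (Eventually.of_forall fun x => ?_)
      rw [Real.norm_eq_abs, NNReal.abs_eq]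
      exact norm_fderiv_le_of_lipschitz ℝ hφ
    have h1 := ContDiffBump.ae_convolution_tendsto_right_of_locallyIntegrable (K := 2) hρ
      (Eventually.of_forall fun k => le_rfl) hloc
    filter_upwards [h1] with x hx
    have h2 := ((InnerProductSpace.toDual ℝ (Euc m)).symm.continuous.tendsto _).comp hx
    refine h2.congr fun k => ?_
    rw [gradient, (hd k x).fderiv]
    rfl

end Mollify

/-! ### Passage to the limit in the divergence theorem below a Lipschitz graph. -/

section Graph

open Filter

variable {m : ℕ} {F : Type*} [NormedAddCommGroup F] [NormedSpace ℝ F]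

/-- The point of `ℝᵐ⁺¹` over `x` at height `t`. -/
def join (x : Euc m) (t : ℝ) : Euc (m + 1) := emb x + t • pole m

theorem continuous_join : Continuous fun p : Euc m × ℝ => join p.1 p.2 :=
  (continuous_emb.comp continuous_fst).add (continuous_snd.smul continuous_const)

theorem norm_join_sq (x : Euc m) (t : ℝ) : ‖join x t‖ ^ 2 = ‖x‖ ^ 2 + t ^ 2 := by
  rw [join, norm_add_sq_real, inner_smul_right, inner_emb_pole, norm_emb, norm_smul, norm_pole,
    Real.norm_eq_abs, mul_one, sq_abs]
  ring

theorem pole_last : (pole m) (Fin.last m) = 1 := by simp [pole]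

theorem emb_last (x : Euc m) : (emb x) (Fin.last m) = 0 := by simp [emb]

@[simp] theorem projL_join (x : Euc m) (t : ℝ) : projL m (join x t) = x := by
  rw [join, map_add, map_smul, projL_emb, projL_pole, smul_zero, add_zero]

@[simp] theorem join_last (x : Euc m) (t : ℝ) : (join x t) (Fin.last m) = t := by
  rw [join, PiLp.add_apply, PiLp.smul_apply, emb_last, pole_last, zero_add, smul_eq_mul, mul_one]

theorem join_projL (z : Euc (m + 1)) : join (projL m z) (z (Fin.last m)) = z := emb_projL_add z

/-- `join` as an isometry from the `L²` product. -/
def joinL (m : ℕ) : WithLp 2 (Euc m × ℝ) ≃ₗᵢ[ℝ] Euc (m + 1) :=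
  LinearIsometry.toLinearIsometryEquiv
    { toFun := fun p => join p.fst p.snd
      map_add' := fun p q => by simp only [join, WithLp.add_fst, WithLp.add_snd, map_add]; module
      map_smul' := fun a p => by
        simp only [join, WithLp.smul_fst, WithLp.smul_snd, map_smul, smul_eq_mul,
          RingHom.id_apply]
        module
      norm_map' := fun p => by
        rw [← sq_eq_sq₀ (norm_nonneg _) (norm_nonneg _)]
        change ‖join p.fst p.snd‖ ^ 2 = _
        rw [norm_join_sq, WithLp.prod_norm_sq_eq_of_L2, Real.norm_eq_abs, sq_abs] }
    (by
      rw [(WithLp.linearEquiv 2 ℝ (Euc m × ℝ)).finrank_eq]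
      simp)

theorem measurePreserving_join :
    MeasurePreserving (fun p : Euc m × ℝ => join p.1 p.2) volume volume :=
  (joinL m).measurePreserving.comp (WithLp.volume_preserving_toLp (Euc m) ℝ)

theorem measurableEmbedding_join : MeasurableEmbedding fun p : Euc m × ℝ => join p.1 p.2 :=
  (joinL m).toHomeomorph.measurableEmbedding.comp
    (MeasurableEquiv.toLp 2 (Euc m × ℝ)).measurableEmbedding

theorem integral_eq_integral_join {g : Euc (m + 1) → F} (hg : Integrable g) :
    ∫ z, g z = ∫ x, ∫ t, g (join x t) := by
  rw [← measurePreserving_join.integral_comp measurableEmbedding_join, Measure.volume_eq_prod,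
    integral_prod]
  rw [← Measure.volume_eq_prod]
  exact (measurePreserving_join.integrable_comp_emb measurableEmbedding_join).2 hg

theorem volume_graph_eq_zero {φ : Euc m → ℝ} (hφ : Continuous φ) :
    volume {z : Euc (m + 1) | z (Fin.last m) = φ (projL m z)} = 0 := by
  rw [← measurePreserving_join.measure_preimage_emb measurableEmbedding_join]
  have h1 : (fun p : Euc m × ℝ => join p.1 p.2) ⁻¹' {z | z (Fin.last m) = φ (projL m z)} =
      {p : Euc m × ℝ | p.2 = φ p.1} := by
    ext p; simp
  rw [h1, Measure.volume_eq_prod, Measure.measure_prod_null]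
  · refine Eventually.of_forall fun x => ?_
    have : Prod.mk x ⁻¹' {p : Euc m × ℝ | p.2 = φ p.1} = {φ x} := by ext t; simp
    change volume (Prod.mk x ⁻¹' {p : Euc m × ℝ | p.2 = φ p.1}) = 0
    rw [this]
    simp
  · exact (isClosed_eq continuous_snd (hφ.comp continuous_fst)).measurableSet

/-- The normal field of the graph of `φ`, pointing upwards. -/
def graphNormal (φ : Euc m → ℝ) (x : Euc m) : Euc (m + 1) := pole m - emb (gradient φ x)

/-- Smoothed indicator functions of the part below the graph of `ψ`. -/
def step (k : ℕ) (ψ : Euc m → ℝ) (z : Euc (m + 1)) : ℝ :=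
  Real.smoothTransition (((k : ℝ) + 1) * (ψ (projL m z) - z (Fin.last m)))

theorem continuous_last : Continuous fun z : Euc (m + 1) => z (Fin.last m) := by
  simp only [← inner_pole_right]
  exact continuous_id.inner continuous_const

theorem contDiff_last : ContDiff ℝ 1 fun z : Euc (m + 1) => z (Fin.last m) := by
  simp only [← inner_pole_right]
  exact contDiff_id.inner ℝ contDiff_const

theorem contDiff_step (k : ℕ) {ψ : Euc m → ℝ} (hψ : ContDiff ℝ 1 ψ) : ContDiff ℝ 1 (step k ψ) :=
  (Real.smoothTransition.contDiff (n := 1)).comp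
    (contDiff_const.mul ((hψ.comp (projL m).contDiff).sub contDiff_last))

theorem gradient_step (k : ℕ) {ψ : Euc m → ℝ} (hψ : ContDiff ℝ 1 ψ) (z : Euc (m + 1)) :
    gradient (step k ψ) z = -((((k : ℝ) + 1) * deriv Real.smoothTransition
      (((k : ℝ) + 1) * (ψ (projL m z) - z (Fin.last m)))) • graphNormal ψ (projL m z)) := by
  refine HasGradientAt.gradient (hasGradientAt_iff_hasFDerivAt.2 ?_)
  have h1 : HasFDerivAt (fun z : Euc (m + 1) => z (Fin.last m)) (innerSL ℝ (pole m)) z := by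
    have h2 : (fun z : Euc (m + 1) => z (Fin.last m)) = innerSL ℝ (pole m) := by
      funext z
      rw [innerSL_apply_apply, real_inner_comm, inner_pole_right]
    rw [h2]
    exact (innerSL ℝ (pole m)).hasFDerivAt
  have h3 := ((hψ.differentiable one_ne_zero (projL m z)).hasFDerivAt.comp z
    (projL m).hasFDerivAt).sub h1
  have h4 := ((Real.smoothTransition.contDiff (n := 1)).differentiable one_ne_zero
    (((k : ℝ) + 1) * (ψ (projL m z) - z (Fin.last m)))).hasDerivAt.comp_hasFDerivAt z
    (h3.const_mul ((k : ℝ) + 1))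
  refine HasFDerivAt.congr_fderiv h4 ?_
  ext w
  have h5 : inner ℝ (emb (gradient ψ (projL m z))) w = fderiv ℝ ψ (projL m z) (projL m w) := by
    rw [← inner_gradient_left, projL, ContinuousLinearMap.adjoint_inner_right]
    rfl
  simp only [smul_apply, sub_apply, ContinuousLinearMap.comp_apply, innerSL_apply_apply,
    smul_eq_mul, InnerProductSpace.toDual_apply_apply, inner_neg_left, inner_smul_left, graphNormal,
    inner_sub_left, h5, conj_trivial]
  ring

theorem deriv_smoothTransition_eq_zero {s : ℝ} (hs : s ∉ Icc (0 : ℝ) 1) :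
    deriv Real.smoothTransition s = 0 := by
  rw [mem_Icc, not_and_or, not_le, not_le] at hs
  rcases hs with hs | hs
  · have : Real.smoothTransition =ᶠ[𝓝 s] fun _ => 0 := by
      filter_upwards [Iio_mem_nhds hs] with t ht
      exact Real.smoothTransition.zero_of_nonpos (le_of_lt ht)
    rw [this.deriv_eq, deriv_const]
  · have : Real.smoothTransition =ᶠ[𝓝 s] fun _ => 1 := by
      filter_upwards [Ioi_mem_nhds hs] with t ht
      exact Real.smoothTransition.one_of_one_le (le_of_lt ht)
    rw [this.deriv_eq, deriv_const]

theorem continuous_deriv_smoothTransition : Continuous (deriv Real.smoothTransition) :=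
  (Real.smoothTransition.contDiff (n := 1)).continuous_deriv le_rfl

theorem integral_deriv_smoothTransition : ∫ s, deriv Real.smoothTransition s = 1 := by
  have hd : ∀ s, HasDerivAt Real.smoothTransition (deriv Real.smoothTransition s) s := fun s =>
    ((Real.smoothTransition.contDiff (n := 1)).differentiable one_ne_zero s).hasDerivAt
  have hz : ∀ s, s ∉ Icc (0 : ℝ) 1 → deriv Real.smoothTransition s = 0 := fun s hs =>
    deriv_smoothTransition_eq_zero hs
  rw [← setIntegral_eq_integral_of_forall_compl_eq_zero hz, integral_Icc_eq_integral_Ioc,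
    ← intervalIntegral.integral_of_le zero_le_one,
    intervalIntegral.integral_eq_sub_of_hasDerivAt (fun s _ => hd s)
      (continuous_deriv_smoothTransition.intervalIntegrable _ _)]
  simp

theorem integrable_deriv_smoothTransition : Integrable (deriv Real.smoothTransition) :=
  .of_integral_ne_zero (by rw [integral_deriv_smoothTransition]; exact one_ne_zero)

/-- The substitution `s = a (c - t)`; it turns a peak of width `1 / a` at `c` into a fixed weight of
mass 1 and a shifted argument. -/
theorem integral_deriv_smoothTransition_smul (a c : ℝ) (ha : 0 < a) (G : ℝ → F) :
    ∫ t, (a * deriv Real.smoothTransition (a * (c - t))) • G t =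
      ∫ s, deriv Real.smoothTransition s • G (c - s / a) := by
  have h1 : ∀ t, (a * deriv Real.smoothTransition (a * (c - t))) • G t =
      (fun t => a • (fun s => deriv Real.smoothTransition s • G (c - s / a)) (a * t)) (c - t) := by
    intro t
    simp only
    rw [mul_div_cancel_left₀ _ ha.ne', sub_sub_cancel, mul_smul]
  simp only [h1]
  rw [integral_sub_left_eq_self (fun t => a • (fun s => deriv Real.smoothTransition s •
    G (c - s / a)) (a * t)) volume c, integral_smul, Measure.integral_comp_mul_left
    (fun s => deriv Real.smoothTransition s • G (c - s / a)), smul_smul,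
    abs_of_pos (inv_pos.2 ha), mul_inv_cancel₀ ha.ne', one_smul]

theorem norm_graphNormal_le {ψ : Euc m → ℝ} {x : Euc m} {L : ℝ} (h : ‖gradient ψ x‖ ≤ L) :
    ‖graphNormal ψ x‖ ≤ 1 + L := by
  refine (norm_sub_le _ _).trans ?_
  rw [norm_pole, norm_emb]
  exact add_le_add_right h 1

theorem gradient_norm_le_of_lipschitz {φ : Euc m → ℝ} {L : ℝ≥0} (hφ : LipschitzWith L φ)
    (x : Euc m) : ‖gradient φ x‖ ≤ L := by
  rw [gradient, LinearIsometryEquiv.norm_map]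
  exact norm_fderiv_le_of_lipschitz ℝ hφ

/-- Off the graph the difference of heights has a nonzero limit, so multiplied by `k + 1` it leaves
the transition interval. -/
theorem tendsto_step {ψ : ℕ → Euc m → ℝ} {φ : Euc m → ℝ} {z : Euc (m + 1)}
    (hψ : Tendsto (fun k => ψ k (projL m z)) atTop (𝓝 (φ (projL m z))))
    (hz : z (Fin.last m) ≠ φ (projL m z)) :
    Tendsto (fun k => step k (ψ k) z) atTop
      (𝓝 ({z : Euc (m + 1) | z (Fin.last m) < φ (projL m z)}.indicator 1 z)) := by
  have h1 : Tendsto (fun k : ℕ => (k : ℝ) + 1) atTop atTop :=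
    tendsto_atTop_add_const_right _ _ tendsto_natCast_atTop_atTop
  have h2 := hψ.sub_const (z (Fin.last m))
  rcases lt_or_gt_of_ne hz with h | h
  · rw [indicator_of_mem (by exact h)]
    have h3 := h1.atTop_mul_pos (sub_pos.2 h) h2
    refine tendsto_const_nhds.congr' ?_
    filter_upwards [h3.eventually_ge_atTop 1] with k hk
    exact (Real.smoothTransition.one_of_one_le hk).symm
  · rw [indicator_of_notMem (by exact not_lt.2 h.le)]
    have h3 := h1.atTop_mul_neg (sub_neg.2 h) h2
    refine tendsto_const_nhds.congr' ?_
    filter_upwards [h3.eventually_le_atBot 0] with k hk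
    exact (Real.smoothTransition.zero_of_nonpos hk).symm

/-- Fubini along vertical lines: the gradient of the step is concentrated in a layer of height `1 /
(k + 1)` below the graph, and integrating through the layer leaves a flux through the graph. -/
theorem integral_apply_gradient_step [CompleteSpace F] {Z : Euc (m + 1) → Euc (m + 1) →L[ℝ] F}
    (hZ : Continuous Z) (hZc : HasCompactSupport Z) (k : ℕ) {ψ : Euc m → ℝ}
    (hψ : ContDiff ℝ 1 ψ) :
    ∫ z, Z z (gradient (step k ψ) z) = -∫ x, ∫ s, deriv Real.smoothTransition s •
      Z (join x (ψ x - s / ((k : ℝ) + 1))) (graphNormal ψ x) := by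
  have hc : Continuous fun z => Z z (gradient (step k ψ) z) :=
    hZ.clm_apply (continuous_gradient (contDiff_step k hψ))
  have hs : HasCompactSupport fun z => Z z (gradient (step k ψ) z) := by
    refine hZc.mono fun z hz => ?_
    contrapose! hz
    rw [Function.notMem_support] at hz ⊢
    rw [hz]; rfl
  rw [integral_eq_integral_join (hc.integrable_of_hasCompactSupport hs), ← integral_neg]
  refine integral_congr_ae (Eventually.of_forall fun x => ?_)
  simp only [gradient_step k hψ, projL_join, join_last, map_neg, map_smul, integral_neg]
  rw [integral_deriv_smoothTransition_smul _ _ (by positivity)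
    fun t => Z (join x t) (graphNormal ψ x)]

/-- The divergence theorem below the graph of a Lipschitz function. -/
theorem integral_below_graph [CompleteSpace F] {φ : Euc m → ℝ} {L : ℝ≥0} (hφ : LipschitzWith L φ)
    {Z : Euc (m + 1) → Euc (m + 1) →L[ℝ] F} (hZ : Continuous Z) (hZc : HasCompactSupport Z)
    {q : Euc (m + 1) → F} (hq : Integrable q)
    (h : ∀ X : Euc (m + 1) → ℝ, ContDiff ℝ 1 X →
      (∫ z, X z • q z) + ∫ z, Z z (gradient X z) = 0) :
    ∫ z in {z | z (Fin.last m) < φ (projL m z)}, q z =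
      ∫ x, Z (join x (φ x)) (graphNormal φ x) := by
  obtain ⟨ψ, hψ1, hψ2, hψ3, hψ4⟩ := lipschitz_exists_contDiff_approx hφ
  have hmeas : MeasurableSet {z : Euc (m + 1) | z (Fin.last m) < φ (projL m z)} :=
    (isOpen_lt continuous_last (hφ.continuous.comp (projL m).continuous)).measurableSet
  have h1 : Tendsto (fun k => ∫ z, step k (ψ k) z • q z) atTop
      (𝓝 (∫ z in {z | z (Fin.last m) < φ (projL m z)}, q z)) := by
    rw [← integral_indicator hmeas]
    refine tendsto_integral_of_dominated_convergence (fun z => ‖q z‖) (fun k => ?_) hq.norm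
      (fun k => Eventually.of_forall fun z => ?_) ?_
    · exact (contDiff_step k (hψ1 k)).continuous.aestronglyMeasurable.smul hq.1
    · rw [norm_smul, Real.norm_eq_abs, step, abs_of_nonneg (Real.smoothTransition.nonneg _)]
      exact mul_le_of_le_one_left (norm_nonneg _) (Real.smoothTransition.le_one _)
    · have h2 : ∀ᵐ z : Euc (m + 1), z (Fin.last m) ≠ φ (projL m z) :=
        measure_eq_zero_iff_ae_notMem.1 (volume_graph_eq_zero hφ.continuous)
      filter_upwards [h2] with z hz
      have h3 := (tendsto_step (hψ3 (projL m z)) hz).smul_const (q z)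
      convert h3 using 2
      by_cases h4 : z ∈ {z : Euc (m + 1) | z (Fin.last m) < φ (projL m z)}
      · simp [indicator_of_mem h4]
      · simp [indicator_of_notMem h4]
  have h2 : Tendsto (fun k => ∫ z, Z z (gradient (step k (ψ k)) z)) atTop
      (𝓝 (-∫ x, Z (join x (φ x)) (graphNormal φ x))) := by
    obtain ⟨C, hC⟩ := hZ.bounded_above_of_compact_support hZc
    have hC0 : 0 ≤ C := (norm_nonneg _).trans (hC 0)
    obtain ⟨R, hR⟩ := hZc.isBounded.subset_closedBall 0
    have hzero : ∀ x t, x ∉ closedBall (0 : Euc m) R → Z (join x t) = 0 := by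
      intro x t hx
      refine image_eq_zero_of_notMem_tsupport fun hxt => hx ?_
      have h3 := hR hxt
      rw [mem_closedBall_zero_iff] at h3 ⊢
      refine le_trans ?_ h3
      rw [← sq_le_sq₀ (norm_nonneg _) (norm_nonneg _), norm_join_sq]
      nlinarith [sq_nonneg t]
    let H : ℕ → Euc m × ℝ → F := fun k p => deriv Real.smoothTransition p.2 •
      Z (join p.1 (ψ k p.1 - p.2 / ((k : ℝ) + 1))) (graphNormal (ψ k) p.1)
    -- A majorant independent of `k`: the support of `Z` projects into a fixed ball, and the
    -- gradients of all `ψ k` are bounded by `L`.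
    let b : Euc m × ℝ → ℝ := fun p => (closedBall (0 : Euc m) R).indicator (fun _ => C * (1 + L)) p.1
      * ‖deriv Real.smoothTransition p.2‖
    have hb : Integrable b (volume.prod volume) := by
      refine Integrable.mul_prod ?_ integrable_deriv_smoothTransition.norm
      exact (integrable_indicator_iff measurableSet_closedBall).2
        (integrableOn_const measure_closedBall_lt_top.ne)
    have hHc : ∀ k, Continuous (H k) := by
      intro k
      refine (continuous_deriv_smoothTransition.comp continuous_snd).smul ?_
      refine (hZ.comp (continuous_join.comp (continuous_fst.prodMk
        (((hψ1 k).continuous.comp continuous_fst).sub (continuous_snd.div_const _))))).clm_apply ?_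
      exact continuous_const.sub (continuous_emb.comp
        ((continuous_gradient (hψ1 k)).comp continuous_fst))
    have hHb : ∀ k p, ‖H k p‖ ≤ b p := by
      intro k p
      by_cases hp : p.1 ∈ closedBall (0 : Euc m) R
      · simp only [H, b, indicator_of_mem hp, norm_smul]
        rw [mul_comm]
        refine mul_le_mul_of_nonneg_right ?_ (norm_nonneg _)
        refine (ContinuousLinearMap.le_opNorm _ _).trans ?_
        exact mul_le_mul (hC _) (norm_graphNormal_le (hψ2 k p.1)) (norm_nonneg _) hC0
      · simp only [H, b, indicator_of_notMem hp, hzero _ _ hp, zero_apply,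
          smul_zero, norm_zero, zero_mul, le_refl]
    have hHi : ∀ k, Integrable (H k) (volume.prod volume) := fun k =>
      hb.mono' (hHc k).aestronglyMeasurable (Eventually.of_forall (hHb k))
    have hlim : ∀ᵐ p : Euc m × ℝ ∂(volume.prod volume), Tendsto (fun k => H k p) atTop
        (𝓝 (deriv Real.smoothTransition p.2 • Z (join p.1 (φ p.1)) (graphNormal φ p.1))) := by
      have h5 := Measure.quasiMeasurePreserving_fst (μ := (volume : Measure (Euc m)))
        (ν := (volume : Measure ℝ)) |>.ae hψ4
      filter_upwards [h5] with p hp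
      have h6 : Tendsto (fun k : ℕ => p.2 / ((k : ℝ) + 1)) atTop (𝓝 0) :=
        tendsto_const_nhds.div_atTop
          (tendsto_atTop_add_const_right _ _ tendsto_natCast_atTop_atTop)
      have h7 := (hψ3 p.1).sub h6
      rw [sub_zero] at h7
      have h8 : Tendsto (fun k => Z (join p.1 (ψ k p.1 - p.2 / ((k : ℝ) + 1)))) atTop
          (𝓝 (Z (join p.1 (φ p.1)))) :=
        ((hZ.comp (continuous_join.comp (Continuous.prodMk_right p.1))).tendsto _).comp h7
      have h9 : Tendsto (fun k => graphNormal (ψ k) p.1) atTop (𝓝 (graphNormal φ p.1)) :=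
        ((continuous_emb.tendsto _).comp hp).const_sub (pole m)
      exact ((isBoundedBilinearMap_apply.continuous.tendsto (_, _)).comp
        (h8.prodMk_nhds h9)).const_smul (deriv Real.smoothTransition p.2)
    have h10 := tendsto_integral_of_dominated_convergence b
      (fun k => (hHc k).aestronglyMeasurable) hb (fun k => Eventually.of_forall (hHb k)) hlim
    have h11 : Integrable (fun p : Euc m × ℝ => deriv Real.smoothTransition p.2 •
        Z (join p.1 (φ p.1)) (graphNormal φ p.1)) (volume.prod volume) := by
      refine hb.mono' (aestronglyMeasurable_of_tendsto_ae _
        (fun k => (hHc k).aestronglyMeasurable) hlim) ?_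
      filter_upwards [hlim] with p hp
      exact le_of_tendsto hp.norm (Eventually.of_forall fun k => hHb k p)
    rw [integral_prod _ h11] at h10
    simp only [integral_smul_const, integral_deriv_smoothTransition, one_smul] at h10
    refine h10.neg.congr fun k => ?_
    rw [integral_prod _ (hHi k), integral_apply_gradient_step hZ hZc k (hψ1 k)]
  have h3 := h1.add h2
  -- The hypothesis is used only for the smooth steps, whose two integrals thus always add up to 0;
  -- the limits inherit this.
  have h4 : (fun k => (∫ z, step k (ψ k) z • q z) + ∫ z, Z z (gradient (step k (ψ k)) z)) =
      fun _ => (0 : F) := funext fun k => h _ (contDiff_step k (hψ1 k))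
  rw [h4] at h3
  have h5 := tendsto_nhds_unique h3 tendsto_const_nhds
  rwa [← sub_eq_add_neg, sub_eq_zero] at h5

end Graph

/-! ### Conformal linear maps and Möbius transformations -/

section Conformal

variable {E F G : Type*} [NormedAddCommGroup E] [InnerProductSpace ℝ E] [FiniteDimensional ℝ E]
  [NormedAddCommGroup F] [InnerProductSpace ℝ F] [FiniteDimensional ℝ F]
  [NormedAddCommGroup G] [InnerProductSpace ℝ G] [FiniteDimensional ℝ G]

set_option linter.unusedSectionVars false in
theorem inner_map_map_of_conformal {A : E →L[ℝ] F} {c : ℝ} (h : ∀ v, ‖A v‖ = c * ‖v‖) (v w : E) :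
    inner ℝ (A v) (A w) = c ^ 2 * inner ℝ v w := by
  rw [real_inner_eq_norm_add_mul_self_sub_norm_mul_self_sub_norm_mul_self_div_two,
    real_inner_eq_norm_add_mul_self_sub_norm_mul_self_sub_norm_mul_self_div_two, ← map_add, h, h, h]
  ring

/-- A conformal `A` satisfies `A* A = c²`, so it multiplies the Gram operator of `B` by `c²`. -/
theorem normDet_conformal_comp {A : E →L[ℝ] F} {c : ℝ} (hc : 0 ≤ c) (h : ∀ v, ‖A v‖ = c * ‖v‖)
    (B : G →L[ℝ] E) : (A ∘L B).toLinearMap.normDet =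
      c ^ Module.finrank ℝ G * B.toLinearMap.normDet := by
  rw [← sq_eq_sq₀ (LinearMap.normDet_nonneg _)
    (mul_nonneg (pow_nonneg hc _) (LinearMap.normDet_nonneg _)), mul_pow]
  have h1 := LinearMap.normDet_sq (𝕜 := ℝ) (A ∘L B).toLinearMap
  have h2 := LinearMap.normDet_sq (𝕜 := ℝ) B.toLinearMap
  simp only [RCLike.ofReal_real_eq_id, id_eq] at h1 h2
  rw [h1, h2]
  have h3 : (A ∘L B).toLinearMap.adjoint ∘ₗ (A ∘L B).toLinearMap =
      (c ^ 2) • (B.toLinearMap.adjoint ∘ₗ B.toLinearMap) := by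
    refine LinearMap.ext fun v => ext_inner_left ℝ fun w => ?_
    simp only [LinearMap.comp_apply, LinearMap.adjoint_inner_right, LinearMap.smul_apply,
      inner_smul_right]
    exact inner_map_map_of_conformal h _ _
  rw [h3, LinearMap.det_smul]
  ring

theorem normDet_conformal {A : E →L[ℝ] F} {c : ℝ} (hc : 0 ≤ c) (h : ∀ v, ‖A v‖ = c * ‖v‖) :
    A.toLinearMap.normDet = c ^ Module.finrank ℝ E := by
  have := normDet_conformal_comp hc h (ContinuousLinearMap.id ℝ E)
  rw [ContinuousLinearMap.comp_id] at this
  rw [this]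
  exact (congrArg _ LinearMap.normDet_id).trans (mul_one _)

end Conformal

/-! ### The linearized graph and its area factor. -/

section GraphMap

variable {m : ℕ}

/-- The linear parametrization of the graph of a linear form. -/
def graphDeriv (a : Euc m) : Euc m →L[ℝ] Euc (m + 1) :=
  (embL m).toContinuousLinearMap + (innerSL ℝ a).smulRight (pole m)

theorem graphDeriv_apply (a v : Euc m) : graphDeriv a v = emb v + inner ℝ a v • pole m := rfl

/-- The Gram operator is `1 + a ⊗ a`, a rank-one perturbation of determinant `1 + ‖a‖²`, which is
also the squared norm of the normal `e - a`. -/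
theorem normDet_graphDeriv (a : Euc m) :
    (graphDeriv a).toLinearMap.normDet = ‖pole m - emb a‖ := by
  rw [← sq_eq_sq₀ (LinearMap.normDet_nonneg _) (norm_nonneg _)]
  have h1 := LinearMap.normDet_sq (𝕜 := ℝ) (graphDeriv a).toLinearMap
  simp only [RCLike.ofReal_real_eq_id, id_eq] at h1
  have h3 : (graphDeriv a).toLinearMap.adjoint ∘ₗ (graphDeriv a).toLinearMap =
      LinearMap.transvection (innerₗ (Euc m) a) a := by
    refine LinearMap.ext fun v => ext_inner_left ℝ fun w => ?_
    rw [LinearMap.comp_apply, LinearMap.adjoint_inner_right, LinearMap.transvection.apply]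
    simp only [ContinuousLinearMap.coe_coe, graphDeriv_apply, inner_add_left, inner_add_right,
      inner_smul_left, inner_smul_right, inner_emb, inner_emb_pole, inner_pole_emb, inner_pole_pole,
      innerₗ_apply_apply, conj_trivial]
    rw [real_inner_comm a w]
    ring
  rw [h1, h3, LinearMap.transvection.det, norm_sub_sq_real, inner_pole_emb, norm_emb, norm_pole]
  simp only [innerₗ_apply_apply, real_inner_self_eq_norm_sq]
  ring

theorem hasFDerivAt_graph {φ : Euc m → ℝ} {x : Euc m} (h : DifferentiableAt ℝ φ x) :
    HasFDerivAt (fun x => join x (φ x)) (graphDeriv (gradient φ x)) x := by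
  have h1 : HasFDerivAt (fun x => join x (φ x))
      ((embL m).toContinuousLinearMap + (fderiv ℝ φ x).smulRight (pole m)) x :=
    (embL m).toContinuousLinearMap.hasFDerivAt.add (h.hasFDerivAt.smul_const (pole m))
  refine h1.congr_fderiv ?_
  ext v : 1
  rw [graphDeriv_apply, inner_gradient_left]
  rfl

theorem graphDeriv_injective (a : Euc m) : Function.Injective (graphDeriv a) := by
  refine (injective_iff_map_eq_zero _).2 fun v hv => ?_
  rw [graphDeriv_apply] at hv
  have := congrArg (projL m) hv
  rwa [map_add, map_smul, projL_emb, projL_pole, smul_zero, add_zero, map_zero] at this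

end GraphMap

/-! ### Explicit Möbius transformations, their inverses and conformal factors. -/

section Mobius

variable {d : ℕ}

/-- The identity or the inversion `kelvin`. -/
def core (i : Bool) (v : Euc d) : Euc d := if i then kelvin v else v

def coreFactor (i : Bool) (v : Euc d) : ℝ := if i then (‖v‖ ^ 2)⁻¹ else 1

theorem kelvin_eq_inversion (v : Euc d) : kelvin v = EuclideanGeometry.inversion 0 1 v := by
  rw [EuclideanGeometry.inversion, kelvin]
  simp

/-- This also holds at 0, where `kelvin` takes the value 0 by convention. So `Mobius.map` is a
bijection of the whole space, and the pole has to be excluded only for derivatives. -/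
theorem core_core (i : Bool) (v : Euc d) : core i (core i v) = v := by
  cases i
  · rfl
  · simp only [core, if_true, kelvin_eq_inversion]
    exact EuclideanGeometry.inversion_inversion _ one_ne_zero _

theorem core_ne_zero {i : Bool} {v : Euc d} (hv : i = true → v ≠ 0) (hi : i = true) :
    core i v ≠ 0 := by
  have := hv hi
  subst hi
  simp only [core, if_true, kelvin]
  exact smul_ne_zero (inv_ne_zero (pow_ne_zero 2 (norm_ne_zero_iff.2 this))) this

theorem contDiffAt_core {i : Bool} {v : Euc d} (hv : i = true → v ≠ 0) :
    ContDiffAt ℝ 1 (core i) v := by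
  cases i
  · exact contDiffAt_id
  · have h1 : (core true : Euc d → Euc d) = fun v => (‖v‖ ^ 2)⁻¹ • v := rfl
    rw [h1]
    exact ((contDiffAt_id.norm_sq ℝ).inv (pow_ne_zero 2 (norm_ne_zero_iff.2 (hv rfl)))).smul
      contDiffAt_id

theorem coreFactor_pos {i : Bool} {v : Euc d} (hv : i = true → v ≠ 0) : 0 < coreFactor i v := by
  cases i
  · exact one_pos
  · have := norm_pos_iff.2 (hv rfl)
    simp only [coreFactor, if_true]
    positivity

theorem norm_fderiv_core {i : Bool} {v : Euc d} (hv : i = true → v ≠ 0) (w : Euc d) :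
    ‖fderiv ℝ (core i) v w‖ = coreFactor i v * ‖w‖ := by
  cases i
  · have : (core false : Euc d → Euc d) = id := rfl
    rw [this, fderiv_id]
    simp [coreFactor]
  · have h1 : (core true : Euc d → Euc d) = EuclideanGeometry.inversion 0 1 :=
      funext kelvin_eq_inversion
    rw [h1, (EuclideanGeometry.hasFDerivAt_inversion (hv rfl)).fderiv]
    simp [coreFactor, norm_smul]

/-- A Möbius transformation, as a similarity that may be preceded by an inversion. -/
structure Mobius (d : ℕ) where
  rot : Euc d ≃ₗᵢ[ℝ] Euc d
  center : Euc d
  shift : Euc d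
  scale : ℝ
  scale_pos : 0 < scale
  inverts : Bool

namespace Mobius

variable (Q : Mobius d)

def map (z : Euc d) : Euc d := Q.shift + Q.scale • Q.rot (core Q.inverts (z - Q.center))

def inv (u : Euc d) : Euc d := Q.center + core Q.inverts (Q.scale⁻¹ • Q.rot.symm (u - Q.shift))

/-- The complement of the pole. -/
def dom : Set (Euc d) := {z | Q.inverts = true → z ≠ Q.center}

def factor (z : Euc d) : ℝ := Q.scale * coreFactor Q.inverts (z - Q.center)

theorem inv_map (z : Euc d) : Q.inv (Q.map z) = z := by
  rw [inv, map, add_sub_cancel_left, map_smul, smul_smul, inv_mul_cancel₀ Q.scale_pos.ne', one_smul,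
    LinearIsometryEquiv.symm_apply_apply, core_core, add_sub_cancel]

theorem map_inv (u : Euc d) : Q.map (Q.inv u) = u := by
  rw [inv, map, add_sub_cancel_left, core_core, map_smul, smul_smul,
    mul_inv_cancel₀ Q.scale_pos.ne', one_smul,
    LinearIsometryEquiv.apply_symm_apply, add_sub_cancel]

variable {Q} {z : Euc d}

theorem sub_ne_zero_of_dom (hz : z ∈ Q.dom) (h : Q.inverts = true) : z - Q.center ≠ 0 :=
  sub_ne_zero.2 (hz h)

theorem contDiffAt_map (hz : z ∈ Q.dom) : ContDiffAt ℝ 1 Q.map z := by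
  have h1 : ContDiffAt ℝ 1 (fun z => core Q.inverts (z - Q.center)) z :=
    (contDiffAt_core (sub_ne_zero_of_dom hz)).comp z (contDiffAt_id.sub contDiffAt_const)
  exact contDiffAt_const.add ((Q.rot.contDiff.contDiffAt.comp z h1).const_smul Q.scale)

theorem contDiffAt_inv (hz : z ∈ Q.dom) : ContDiffAt ℝ 1 Q.inv (Q.map z) := by
  have h0 : Q.scale⁻¹ • Q.rot.symm (Q.map z - Q.shift) = core Q.inverts (z - Q.center) := by
    rw [map, add_sub_cancel_left, map_smul, smul_smul, inv_mul_cancel₀ Q.scale_pos.ne', one_smul,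
      LinearIsometryEquiv.symm_apply_apply]
  have h1 : ContDiffAt ℝ 1 (core Q.inverts) (Q.scale⁻¹ • Q.rot.symm (Q.map z - Q.shift)) := by
    refine contDiffAt_core fun h => ?_
    rw [h0]
    exact core_ne_zero (sub_ne_zero_of_dom hz) h
  have h2 : ContDiffAt ℝ 1 (fun u => Q.scale⁻¹ • Q.rot.symm (u - Q.shift)) (Q.map z) :=
    (Q.rot.symm.contDiff.contDiffAt.comp _ (contDiffAt_id.sub contDiffAt_const)).const_smul _
  have h3 : ContDiffAt ℝ 1 (core Q.inverts ∘ fun u => Q.scale⁻¹ • Q.rot.symm (u - Q.shift))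
      (Q.map z) := ContDiffAt.comp (Q.map z) h1 h2
  exact contDiffAt_const.add h3

theorem differentiableAt_map (hz : z ∈ Q.dom) : DifferentiableAt ℝ Q.map z :=
  (contDiffAt_map hz).differentiableAt one_ne_zero

theorem factor_pos (hz : z ∈ Q.dom) : 0 < Q.factor z :=
  mul_pos Q.scale_pos (coreFactor_pos (sub_ne_zero_of_dom hz))

theorem continuousAt_factor (hz : z ∈ Q.dom) : ContinuousAt Q.factor z := by
  unfold factor coreFactor
  by_cases h : Q.inverts = true
  · simp only [h, if_true]
    exact continuousAt_const.mul (((continuous_id.sub continuous_const).norm.pow 2).continuousAt.inv₀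
      (pow_ne_zero 2 (norm_ne_zero_iff.2 (sub_ne_zero_of_dom hz h))))
  · simp only [h]
    exact continuousAt_const

theorem norm_fderiv_map (hz : z ∈ Q.dom) (w : Euc d) :
    ‖fderiv ℝ Q.map z w‖ = Q.factor z * ‖w‖ := by
  have h0 := (contDiffAt_core (sub_ne_zero_of_dom hz)).differentiableAt one_ne_zero
  have h1 : HasFDerivAt (fun z => core Q.inverts (z - Q.center))
      (fderiv ℝ (core Q.inverts) (z - Q.center)) z := by
    have := HasFDerivAt.comp z h0.hasFDerivAt ((hasFDerivAt_id (𝕜 := ℝ) z).sub_const Q.center)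
    rwa [ContinuousLinearMap.comp_id] at this
  have h2 : HasFDerivAt Q.map (Q.scale • (Q.rot.toContinuousLinearEquiv.toContinuousLinearMap ∘L
      fderiv ℝ (core Q.inverts) (z - Q.center))) z :=
    ((Q.rot.toContinuousLinearEquiv.toContinuousLinearMap.hasFDerivAt.comp z h1).const_smul
      Q.scale).const_add Q.shift
  rw [h2.fderiv, smul_apply, norm_smul, Real.norm_eq_abs, abs_of_pos Q.scale_pos]
  simp only [ContinuousLinearMap.comp_apply]
  rw [factor, mul_assoc, ← norm_fderiv_core (sub_ne_zero_of_dom hz)]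
  congr 1
  exact Q.rot.norm_map _

end Mobius

end Mobius

/-! ### The divergence theorem below the Möbius image of a Lipschitz graph -/

section MobiusGraph

open Filter

theorem continuous_of_continuousOn_of_zero {X Y : Type*} [TopologicalSpace X] [TopologicalSpace Y]
    [Zero Y] {f : X → Y} {W C : Set X} (hW : IsOpen W) (hf : ContinuousOn f W) (hC : IsClosed C)
    (hCW : C ⊆ W) (h0 : ∀ x, x ∉ C → f x = 0) : Continuous f := by
  refine continuous_iff_continuousAt.2 fun x => ?_
  by_cases hx : x ∈ C
  · exact hf.continuousAt (hW.mem_nhds (hCW hx))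
  · refine continuousAt_const.congr (f := fun _ => (0 : Y)) ?_
    filter_upwards [hC.isOpen_compl.mem_nhds hx] with w hw
    exact (h0 w hw).symm

theorem gradient_mul {n : ℕ} {f g : Euc n → ℝ} {u : Euc n} (hf : DifferentiableAt ℝ f u)
    (hg : DifferentiableAt ℝ g u) :
    gradient (fun u => f u * g u) u = f u • gradient g u + g u • gradient f u := by
  simp only [gradient]
  rw [← map_smul, ← map_smul, ← map_add]
  congr 1
  exact (hf.hasFDerivAt.mul hg.hasFDerivAt).fderiv

/-- Gradients transform by the inverse transpose of the derivative, and for a conformal map of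
factor `c` that is `c⁻²` times the derivative itself. -/
theorem gradient_comp_conformal {d : ℕ} {f X : Euc d → ℝ} {q : Euc d → Euc d}
    {q' : Euc d →L[ℝ] Euc d} {z : Euc d} {c : ℝ} (hc : 0 < c) (hq : HasFDerivAt q q' z)
    (hc' : ∀ v, ‖q' v‖ = c * ‖v‖) (hf : DifferentiableAt ℝ f (q z)) (hX : X =ᶠ[𝓝 z] f ∘ q) :
    gradient f (q z) = (c ^ 2)⁻¹ • q' (gradient X z) := by
  have hinj : Function.Injective q' := by
    refine (injective_iff_map_eq_zero _).2 fun v hv => ?_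
    have := hc' v
    rw [hv, norm_zero] at this
    exact norm_eq_zero.1 ((mul_eq_zero.1 this.symm).resolve_left hc.ne')
  have hsurj : Function.Surjective q' := LinearMap.injective_iff_surjective.1 hinj
  have h1 : fderiv ℝ X z = fderiv ℝ f (q z) ∘L q' := by
    rw [hX.fderiv_eq]
    exact (hf.hasFDerivAt.comp z hq).fderiv
  refine ext_inner_right ℝ fun w => ?_
  obtain ⟨v, rfl⟩ := hsurj w
  rw [inner_smul_left, inner_map_map_of_conformal hc', inner_gradient_left, inner_gradient_left, h1]
  simp [hc.ne']

variable {m : ℕ}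

/-- The linear map `v ↦ a v b` from vectors to the Clifford algebra. -/
def sandwich {n : ℕ} (a b : Cl (n + 1)) : Euc n →L[ℝ] Cl (n + 1) :=
  (mulL (n + 1)).flip b ∘L mulL (n + 1) a ∘L vecL (n + 1) ∘L (embL n).toContinuousLinearMap

@[simp] theorem sandwich_apply {n : ℕ} (a b : Cl (n + 1)) (v : Euc n) :
    sandwich a b v = a * vec (emb v) * b := rfl

theorem continuousAt_sandwich {n : ℕ} {X : Type*} [TopologicalSpace X] {a b : X → Cl (n + 1)}
    {x : X} (ha : ContinuousAt a x) (hb : ContinuousAt b x) :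
    ContinuousAt (fun x => sandwich (a x) (b x)) x := by
  unfold sandwich
  exact ((mulL (n + 1)).flip.continuous.continuousAt.comp hb).clm_comp
    (((mulL (n + 1)).continuous.continuousAt.comp ha).clm_comp continuousAt_const)

/-- The flux form of `ζ K · h`, pulled back by a Möbius transformation. -/
def mobiusFlux (Q : Mobius (m + 1)) (K h : Euc (m + 1) → Cl (m + 2)) (ζ : Euc (m + 1) → ℝ)
    (z : Euc (m + 1)) : Euc (m + 1) →L[ℝ] Cl (m + 2) :=
  (Q.factor z ^ (m + 1) * ζ (Q.map z) * (Q.factor z ^ 2)⁻¹) •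
    (sandwich (K (Q.map z)) (h (Q.map z)) ∘L fderiv ℝ Q.map z)

theorem mobiusFlux_apply (Q : Mobius (m + 1)) (K h : Euc (m + 1) → Cl (m + 2))
    (ζ : Euc (m + 1) → ℝ) (z v : Euc (m + 1)) : mobiusFlux Q K h ζ z v =
      Q.factor z ^ (m + 1) • (ζ (Q.map z) •
        (K (Q.map z) * vec (emb ((Q.factor z ^ 2)⁻¹ • fderiv ℝ Q.map z v)) * h (Q.map z))) := by
  rw [← sandwich_apply, map_smul, smul_smul, smul_smul, mobiusFlux]
  rfl

theorem integral_mobius_image {F : Type*} [NormedAddCommGroup F] [NormedSpace ℝ F] {d : ℕ}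
    (Q : Mobius d) {W : Set (Euc d)}
    (hW : MeasurableSet W) (hWd : W ⊆ Q.dom) (g : Euc d → F) :
    ∫ u in Q.map '' W, g u = ∫ z in W, Q.factor z ^ d • g (Q.map z) := by
  rw [integral_image_eq_integral_abs_det_fderiv_smul volume hW
    (fun z hz => (Mobius.differentiableAt_map (hWd hz)).hasFDerivAt.hasFDerivWithinAt)
    (Function.LeftInverse.injective Q.inv_map).injOn]
  refine setIntegral_congr_fun hW fun z hz => ?_
  have h1 := normDet_conformal (Mobius.factor_pos (hWd hz)).le
    (Mobius.norm_fderiv_map (hWd hz))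
  rw [LinearMap.normDet_eq_abs_det, finrank_euclideanSpace_fin] at h1
  rw [← h1]

section

variable {Q : Mobius (m + 1)} {W C : Set (Euc (m + 1))} {K h : Euc (m + 1) → Cl (m + 2)}
  {ζ : Euc (m + 1) → ℝ}

theorem continuous_mobiusFlux (hW : IsOpen W) (hWd : W ⊆ Q.dom)
    (hK : ∀ z ∈ W, ContinuousAt K (Q.map z)) (hh : ∀ z ∈ W, ContinuousAt h (Q.map z))
    (hζ : Continuous ζ) (hC : IsCompact C) (hCW : C ⊆ W) (hζC : tsupport ζ ⊆ Q.map '' C) :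
    Continuous (mobiusFlux Q K h ζ) := by
  refine continuous_of_continuousOn_of_zero hW (fun z hz => ?_) hC.isClosed hCW fun z hz => ?_
  · have hzd := hWd hz
    have hq := (Mobius.contDiffAt_map hzd).continuousAt
    have hf := Mobius.continuousAt_factor hzd
    have h1 : ContinuousAt (fderiv ℝ Q.map) z :=
      (Mobius.contDiffAt_map hzd).continuousAt_fderiv one_ne_zero
    have h2 : ContinuousAt (fun z => sandwich (K (Q.map z)) (h (Q.map z))) z :=
      continuousAt_sandwich (ContinuousAt.comp (f := Q.map) (hK z hz) hq)
        (ContinuousAt.comp (f := Q.map) (hh z hz) hq)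
    have h3 : ContinuousAt (fun z => Q.factor z ^ (m + 1) * ζ (Q.map z) * (Q.factor z ^ 2)⁻¹) z :=
      ((hf.pow _).mul (hζ.continuousAt.comp hq)).mul
        ((hf.pow 2).inv₀ (pow_ne_zero 2 (Mobius.factor_pos hzd).ne'))
    exact (h3.smul (h2.clm_comp h1)).continuousWithinAt
  · have h1 : ζ (Q.map z) = 0 := by
      refine image_eq_zero_of_notMem_tsupport fun h => hz ?_
      obtain ⟨w, hw, hwz⟩ := hζC h
      rwa [← Function.LeftInverse.injective Q.inv_map hwz]
    rw [mobiusFlux, h1, mul_zero, zero_mul, zero_smul]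

theorem hasCompactSupport_mobiusFlux (hC : IsCompact C) (hζC : tsupport ζ ⊆ Q.map '' C) :
    HasCompactSupport (mobiusFlux Q K h ζ) := by
  refine HasCompactSupport.intro hC fun z hz => ?_
  have h1 : ζ (Q.map z) = 0 := by
    refine image_eq_zero_of_notMem_tsupport fun h => hz ?_
    obtain ⟨w, hw, hwz⟩ := hζC h
    rwa [← Function.LeftInverse.injective Q.inv_map hwz]
  rw [mobiusFlux, h1, mul_zero, zero_mul, zero_smul]

/-- The pullback of `K ∇ζ h` by a Möbius transformation. -/
def mobiusSource (Q : Mobius (m + 1)) (K h : Euc (m + 1) → Cl (m + 2)) (ζ : Euc (m + 1) → ℝ)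
    (z : Euc (m + 1)) : Cl (m + 2) :=
  Q.factor z ^ (m + 1) • (K (Q.map z) * vec (emb (gradient ζ (Q.map z))) * h (Q.map z))

theorem mobiusSource_eq_zero (hζC : tsupport ζ ⊆ Q.map '' C) {z : Euc (m + 1)} (hz : z ∉ C) :
    mobiusSource Q K h ζ z = 0 := by
  have h1 : gradient ζ (Q.map z) = 0 := by
    refine gradient_eq_zero_of_notMem_tsupport fun h => hz ?_
    obtain ⟨w, hw, hwz⟩ := hζC h
    rwa [← Function.LeftInverse.injective Q.inv_map hwz]
  rw [mobiusSource, h1]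
  simp

theorem continuous_mobiusSource (hW : IsOpen W) (hWd : W ⊆ Q.dom)
    (hK : ∀ z ∈ W, ContinuousAt K (Q.map z)) (hh : ∀ z ∈ W, ContinuousAt h (Q.map z))
    (hζ : ContDiff ℝ 1 ζ) (hC : IsCompact C) (hCW : C ⊆ W) (hζC : tsupport ζ ⊆ Q.map '' C) :
    Continuous (mobiusSource Q K h ζ) := by
  refine continuous_of_continuousOn_of_zero hW (fun z hz => ?_) hC.isClosed hCW
    fun z hz => mobiusSource_eq_zero hζC hz
  have hzd := hWd hz
  have hq := (Mobius.contDiffAt_map hzd).continuousAt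
  have hsub : ∀ u ∈ tsupport ζ, ∃ w ∈ W, Q.map w = u := fun u hu => by
    obtain ⟨w, hw, hwu⟩ := hζC hu
    exact ⟨w, hCW hw, hwu⟩
  have h1 : Continuous fun u => K u * vec (emb (gradient ζ u)) * h u := by
    refine continuous_kernel_gradient hζ (fun u hu => ?_) fun u hu => ?_
    · obtain ⟨w, hw, rfl⟩ := hsub u (tsupport_gradient_subset hu)
      exact hK w hw
    · obtain ⟨w, hw, rfl⟩ := hsub u (tsupport_gradient_subset hu)
      exact hh w hw
  exact (((Mobius.continuousAt_factor hzd).pow _).smul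
    (ContinuousAt.comp (f := Q.map) h1.continuousAt hq)).continuousWithinAt

/-- Transporting the test function to the target, instead of the Dirac equation to the source,
avoids spinor weights for `Q`: the divergence theorem is applied to the product of `ζ` with the
transported `X`, and the result is pulled back. -/
theorem integral_mobiusSource_add_flux (hW : IsOpen W) (hWd : W ⊆ Q.dom)
    (hK : ∀ z ∈ W, IsRightMonogenicAt K (Q.map z)) (hh : ∀ z ∈ W, IsLeftMonogenicAt h (Q.map z))
    (hζ : ContDiff ℝ 1 ζ) (hC : IsCompact C) (hCW : C ⊆ W) (hζC : tsupport ζ ⊆ Q.map '' C)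
    {X : Euc (m + 1) → ℝ} (hX : ContDiff ℝ 1 X) :
    (∫ z, X z • mobiusSource Q K h ζ z) + ∫ z, mobiusFlux Q K h ζ z (gradient X z) = 0 := by
  have hKc : ∀ z ∈ W, ContinuousAt K (Q.map z) := fun z hz => by
    obtain ⟨_, h1, _⟩ := hK z hz
    exact h1.continuousAt
  have hhc : ∀ z ∈ W, ContinuousAt h (Q.map z) := fun z hz => (hh z hz).1.continuousAt
  have hinj := Function.LeftInverse.injective Q.inv_map
  have hmem : ∀ z, Q.map z ∈ tsupport ζ → z ∈ C := fun z hz => by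
    obtain ⟨w, hw, hwz⟩ := hζC hz
    rwa [← hinj hwz]
  let χ : Euc (m + 1) → ℝ := fun u => X (Q.inv u) * ζ u
  have hχs : tsupport χ ⊆ tsupport ζ := tsupport_mul_subset_right
  have hXi : ∀ z ∈ W, ContDiffAt ℝ 1 (fun u => X (Q.inv u)) (Q.map z) := fun z hz =>
    ContDiffAt.comp (Q.map z) hX.contDiffAt (Mobius.contDiffAt_inv (hWd hz))
  have hχ : ContDiff ℝ 1 χ := by
    refine contDiff_iff_contDiffAt.2 fun u => ?_
    by_cases hu : u ∈ tsupport ζ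
    · obtain ⟨z, hz, rfl⟩ := hζC hu
      exact (hXi z (hCW hz)).mul hζ.contDiffAt
    · refine contDiffAt_const (c := (0 : ℝ)) |>.congr_of_eventuallyEq ?_
      filter_upwards [(isClosed_tsupport ζ).isOpen_compl.mem_nhds hu] with w hw
      simp only [χ, image_eq_zero_of_notMem_tsupport hw, mul_zero]
  have hQC : IsCompact (Q.map '' C) := hC.image_of_continuousOn fun z hz =>
    (Mobius.contDiffAt_map (hWd (hCW hz))).continuousAt.continuousWithinAt
  have hχc : HasCompactSupport χ := hQC.of_isClosed_subset (isClosed_tsupport χ) (hχs.trans hζC)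
  have h1 : ∫ u, K u * vec (emb (gradient χ u)) * h u = 0 := by
    refine integral_kernel_gradient_eq_zero hχ hχc (fun u hu => ?_) fun u hu => ?_
    · obtain ⟨z, hz, rfl⟩ := hζC (hχs hu)
      exact hK z (hCW hz)
    · obtain ⟨z, hz, rfl⟩ := hζC (hχs hu)
      exact hh z (hCW hz)
  have h2 : ∀ z, z ∈ W → Q.factor z ^ (m + 1) • (K (Q.map z) * vec (emb (gradient χ (Q.map z))) *
      h (Q.map z)) = X z • mobiusSource Q K h ζ z + mobiusFlux Q K h ζ z (gradient X z) := by
    intro z hz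
    have hzd := hWd hz
    have h3 : gradient (fun u => X (Q.inv u)) (Q.map z) =
        (Q.factor z ^ 2)⁻¹ • fderiv ℝ Q.map z (gradient X z) :=
      gradient_comp_conformal (Mobius.factor_pos hzd)
        (Mobius.differentiableAt_map hzd).hasFDerivAt (Mobius.norm_fderiv_map hzd)
        ((hXi z hz).differentiableAt one_ne_zero)
        (Eventually.of_forall fun w => by simp only [Function.comp_apply, Q.inv_map])
    rw [gradient_mul ((hXi z hz).differentiableAt one_ne_zero)
      (hζ.differentiable one_ne_zero _), h3, mobiusFlux_apply, mobiusSource, Q.inv_map,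
      ← sandwich_apply, ← sandwich_apply, ← sandwich_apply, map_add, map_smul, map_smul, smul_add,
      smul_comm (X z)]
  have h0 : ∀ u, u ∉ Q.map '' W → K u * vec (emb (gradient χ u)) * h u = 0 := by
    intro u hu
    rw [gradient_eq_zero_of_notMem_tsupport fun hu' => hu (image_mono hCW (hζC (hχs hu')))]
    simp
  rw [← setIntegral_eq_integral_of_forall_compl_eq_zero h0,
    integral_mobius_image Q hW.measurableSet hWd, setIntegral_congr_fun hW.measurableSet h2,
    setIntegral_eq_integral_of_forall_compl_eq_zero] at h1
  · rw [← integral_add, h1]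
    · refine (hX.continuous.smul (continuous_mobiusSource hW hWd hKc hhc hζ hC hCW
        hζC)).integrable_of_hasCompactSupport (HasCompactSupport.intro hC fun z hz => ?_)
      change X z • mobiusSource Q K h ζ z = 0
      rw [mobiusSource_eq_zero hζC hz, smul_zero]
    · refine ((continuous_mobiusFlux hW hWd hKc hhc hζ.continuous hC hCW hζC).clm_apply
        (continuous_gradient hX)).integrable_of_hasCompactSupport ?_
      refine (hasCompactSupport_mobiusFlux (K := K) (h := h) hC hζC).mono fun z hz => ?_
      contrapose! hz
      rw [Function.notMem_support] at hz ⊢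
      rw [hz]; rfl
  · intro z hz
    have hzC : z ∉ C := fun h => hz (hCW h)
    have h4 : ζ (Q.map z) = 0 :=
      image_eq_zero_of_notMem_tsupport fun h => hzC (hmem z h)
    rw [mobiusSource_eq_zero hζC hzC, smul_zero, zero_add, mobiusFlux_apply, h4, zero_smul,
      smul_zero]

theorem integrable_mobiusSource (hW : IsOpen W) (hWd : W ⊆ Q.dom)
    (hK : ∀ z ∈ W, ContinuousAt K (Q.map z)) (hh : ∀ z ∈ W, ContinuousAt h (Q.map z))
    (hζ : ContDiff ℝ 1 ζ) (hC : IsCompact C) (hCW : C ⊆ W) (hζC : tsupport ζ ⊆ Q.map '' C) :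
    Integrable (mobiusSource Q K h ζ) :=
  (continuous_mobiusSource hW hWd hK hh hζ hC hCW hζC).integrable_of_hasCompactSupport
    (HasCompactSupport.intro hC fun _ hz => mobiusSource_eq_zero hζC hz)

end

theorem measurable_gradient {φ : Euc m → ℝ} : Measurable (gradient φ) :=
  (InnerProductSpace.toDual ℝ (Euc m)).symm.continuous.measurable.comp (measurable_fderiv ℝ φ)

theorem measurable_graphNormal {φ : Euc m → ℝ} : Measurable (graphNormal φ) :=
  measurable_const.sub (continuous_emb.measurable.comp measurable_gradient)

theorem integrable_apply_graphNormal {F : Type*} [NormedAddCommGroup F] [NormedSpace ℝ F]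
    [FiniteDimensional ℝ F] {φ : Euc m → ℝ} {L : ℝ≥0} (hφ : LipschitzWith L φ)
    {Z : Euc (m + 1) → Euc (m + 1) →L[ℝ] F} (hZ : Continuous Z) (hZc : HasCompactSupport Z) :
    Integrable fun x => Z (join x (φ x)) (graphNormal φ x) := by
  obtain ⟨c, hc⟩ := hZ.bounded_above_of_compact_support hZc
  obtain ⟨R, hR⟩ := hZc.isBounded.subset_closedBall 0
  have hzero : ∀ x, x ∉ closedBall (0 : Euc m) R → Z (join x (φ x)) = 0 := by
    intro x hx
    refine image_eq_zero_of_notMem_tsupport fun hxt => hx ?_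
    have h3 := hR hxt
    rw [mem_closedBall_zero_iff] at h3 ⊢
    refine le_trans ?_ h3
    rw [← sq_le_sq₀ (norm_nonneg _) (norm_nonneg _), norm_join_sq]
    nlinarith [sq_nonneg (φ x)]
  have hcont : Continuous fun x => Z (join x (φ x)) :=
    hZ.comp (continuous_join.comp (continuous_id.prodMk hφ.continuous))
  have hmeas : AEStronglyMeasurable (fun x => Z (join x (φ x)) (graphNormal φ x)) volume :=
    isBoundedBilinearMap_apply.continuous.comp_aestronglyMeasurable₂
      (f := fun x => Z (join x (φ x)))
      hcont.aestronglyMeasurable measurable_graphNormal.aestronglyMeasurable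
  refine Integrable.mono' (g := (closedBall (0 : Euc m) R).indicator fun _ => c * (1 + L)) ?_ hmeas
    (Eventually.of_forall fun x => ?_)
  · exact (integrable_indicator_iff measurableSet_closedBall).2
      (integrableOn_const measure_closedBall_lt_top.ne)
  · by_cases hx : x ∈ closedBall (0 : Euc m) R
    · rw [indicator_of_mem hx]
      exact (ContinuousLinearMap.le_opNorm _ _).trans (mul_le_mul (hc _)
        (norm_graphNormal_le (gradient_norm_le_of_lipschitz hφ x)) (norm_nonneg _)
        ((norm_nonneg _).trans (hc 0)))
    · rw [indicator_of_notMem hx, hzero x hx, zero_apply, norm_zero]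

end MobiusGraph

/-! ### Möbius parametrizations of the sphere -/

section Param

open Filter

theorem contDiff_chart {n : ℕ} (κ : Bool) : ContDiff ℝ 1 (chart κ : Euc n → Euc (n + 1)) := by
  have h1 : ContDiff ℝ 1 (cayley : Euc n → Euc (n + 1)) := by
    have h2 : ContDiff ℝ 1 fun u : Euc n => ‖u‖ ^ 2 := contDiff_id.norm_sq ℝ
    have h3 : ContDiff ℝ 1 (emb : Euc n → Euc (n + 1)) := (embL n).contDiff
    exact ((h2.add contDiff_const).inv fun u => by positivity).smul
      ((h3.const_smul (-2 : ℝ)).add ((h2.sub contDiff_const).smul contDiff_const))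
  have h4 : (chart κ : Euc n → Euc (n + 1)) = flip n κ ∘ cayley := funext fun u => chart_eq κ u
  rw [h4]
  exact (flip n κ).contDiff.comp h1

theorem measurable_chartDeriv {n : ℕ} (κ : Bool) :
    Measurable (chartDeriv κ : Euc n → Euc n →L[ℝ] Euc (n + 1)) := by
  have : (chartDeriv κ : Euc n → Euc n →L[ℝ] Euc (n + 1)) = fderiv ℝ (chart κ) :=
    funext fun u => (hasFDerivAt_chart κ u).fderiv.symm
  rw [this]
  exact measurable_fderiv ℝ _

theorem inner_chart_chartDeriv {n : ℕ} (κ : Bool) (u v : Euc n) :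
    inner ℝ (chart κ u) (chartDeriv κ u v) = 0 := by
  have h1 := (hasFDerivAt_chart κ u).norm_sq
  have h2 : (fun u : Euc n => ‖chart κ u‖ ^ 2) = fun _ => 1 := by
    funext u; rw [norm_chart, one_pow]
  have h3 := congrArg (fun T : Euc n →L[ℝ] ℝ => T v) (h1.unique (by rw [h2]; exact hasFDerivAt_const _ _))
  simpa using h3

theorem injective_of_conformal {E F : Type*} [NormedAddCommGroup E] [NormedSpace ℝ E]
    [NormedAddCommGroup F] [NormedSpace ℝ F] {A : E →L[ℝ] F} {c : ℝ} (hc : 0 < c)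
    (h : ∀ v, ‖A v‖ = c * ‖v‖) : Function.Injective A := by
  refine (injective_iff_map_eq_zero _).2 fun v hv => ?_
  have := h v
  rw [hv, norm_zero] at this
  exact norm_eq_zero.1 ((mul_eq_zero.1 this.symm).resolve_left hc.ne')

theorem chartDeriv_injective {n : ℕ} (κ : Bool) (u : Euc n) :
    Function.Injective (chartDeriv κ u) :=
  injective_of_conformal (confFactor_pos u) (norm_chartDeriv κ u)

/-- The range of the derivative of a chart is the tangent space of the sphere. -/
theorem exists_chartDeriv_eq {n : ℕ} (κ : Bool) (u : Euc n) {τ : Euc (n + 1)}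
    (hτ : inner ℝ (chart κ u) τ = 0) : ∃ v, chartDeriv κ u v = τ := by
  have h1 : (chartDeriv κ u).toLinearMap.range = (ℝ ∙ chart κ u)ᗮ := by
    refine Submodule.eq_of_le_of_finrank_eq ?_ ?_
    · rintro _ ⟨v, rfl⟩
      exact Submodule.mem_orthogonal_singleton_iff_inner_right.2 (inner_chart_chartDeriv κ u v)
    · have h2 : chart κ u ≠ 0 := by
        rw [← norm_ne_zero_iff, norm_chart]; exact one_ne_zero
      have : Fact (Module.finrank ℝ (Euc (n + 1)) = n + 1) := ⟨finrank_euclideanSpace_fin⟩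
      rw [Submodule.finrank_orthogonal_span_singleton (n := n) h2,
        LinearMap.finrank_range_of_inj (chartDeriv_injective κ u), finrank_euclideanSpace_fin]
  have h2 : τ ∈ (chartDeriv κ u).toLinearMap.range := by
    rw [h1]
    exact Submodule.mem_orthogonal_singleton_iff_inner_right.2 hτ
  exact h2

/-- The tangential gradient on the unit sphere. -/
def sgrad {n : ℕ} (η : Euc (n + 1) → ℝ) (x : Euc (n + 1)) : Euc (n + 1) :=
  gradient η x - (inner ℝ x (gradient η x) : ℝ) • x

/-- Both sides are tangent to the sphere and have the same inner product with every tangent vector,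
as the derivative of a chart is onto the tangent space. -/
theorem chartDeriv_gradient {n : ℕ} (κ : Bool) (u : Euc n) {η : Euc (n + 1) → ℝ}
    (hη : DifferentiableAt ℝ η (chart κ u)) :
    (confFactor u ^ 2)⁻¹ • chartDeriv κ u (gradient (fun u => η (chart κ u)) u) =
      sgrad η (chart κ u) := by
  have hx : ‖chart κ u‖ = 1 := norm_chart κ u
  have hg : fderiv ℝ (fun u => η (chart κ u)) u = fderiv ℝ η (chart κ u) ∘L chartDeriv κ u :=
    (hη.hasFDerivAt.comp u (hasFDerivAt_chart κ u)).fderiv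
  obtain ⟨v, hv⟩ := exists_chartDeriv_eq κ u (τ := sgrad η (chart κ u)) (by
    rw [sgrad, inner_sub_right, inner_smul_right, real_inner_self_eq_norm_sq, hx]; ring)
  rw [← hv]
  rw [inv_smul_eq_iff₀ (pow_ne_zero 2 (confFactor_pos u).ne'), ← map_smul]
  congr 1
  refine ext_inner_right ℝ fun w => ?_
  rw [inner_gradient_left, hg, inner_smul_left, RCLike.conj_to_real,
    ← inner_map_map_of_conformal (norm_chartDeriv κ u), hv, sgrad, inner_sub_left, inner_smul_left,
    inner_chart_chartDeriv, mul_zero, sub_zero, inner_gradient_left]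
  rfl

/-- The integrand `G(x - y) ∇η g` of the volume integrals over the sphere. -/
def sourceForm {n : ℕ} (g : Euc (n + 1) → Cl (n + 1)) (y : Euc (n + 1)) (η : Euc (n + 1) → ℝ)
    (x : Euc (n + 1)) : Cl (n + 1) := cauchyG n (x - y) * vec (sgrad η x) * g x

/-- The function `g` in the chart `κ`, with the spinor weight. -/
def localRep {n : ℕ} (g : Euc (n + 1) → Cl (n + 1)) (κ : Bool) (u : Euc n) : Cl (n + 1) :=
  weight n (chartDen κ u) * g (chart κ u)

theorem conf_smul_sourceForm {n : ℕ} (κ : Bool) (u : Euc n) (g : Euc (n + 1) → Cl (n + 1))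
    (y : Euc (n + 1)) {η : Euc (n + 1) → ℝ} (hη : DifferentiableAt ℝ η (chart κ u)) :
    confFactor u ^ n • sourceForm g y η (chart κ u) =
      kern κ y u * vec (emb (gradient (fun u => η (chart κ u)) u)) * localRep g κ u := by
  rw [localRep, ← conf_smul_cauchyG_mul, chartDeriv_gradient κ u hη, sourceForm]

theorem integral_chart_image {n : ℕ} {F : Type*} [NormedAddCommGroup F] [NormedSpace ℝ F]
    (κ : Bool) {A : Set (Euc n)} (hA : MeasurableSet A) (f : Euc (n + 1) → F) :
    ∫ x in chart κ '' A, f x ∂(Measure.euclideanHausdorffMeasure n) =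
      ∫ u in A, confFactor u ^ n • f (chart κ u) := by
  have h1 := integral_image_eq_normDet_smul hA (measurable_chartDeriv κ)
    (fun u _ => (hasFDerivAt_chart κ u).hasFDerivWithinAt) (fun u _ => chartDeriv_injective κ u)
    (chart_injective κ).injOn f
  rw [finrank_euclideanSpace_fin] at h1
  rw [h1]
  refine setIntegral_congr_fun hA fun u _ => ?_
  have h2 := normDet_conformal (confFactor_pos u).le (norm_chartDeriv κ u)
  rw [finrank_euclideanSpace_fin] at h2
  rw [← h2]

variable {m : ℕ} (κ : Bool) (Q : Mobius (m + 1))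

/-- A Möbius parametrization of the sphere. -/
def param (z : Euc (m + 1)) : Euc (m + 2) := chart κ (Q.map z)

def paramInv (x : Euc (m + 2)) : Euc (m + 1) := Q.inv (chartInv κ x)

def paramFactor (z : Euc (m + 1)) : ℝ := confFactor (Q.map z) * Q.factor z

def paramDeriv (z : Euc (m + 1)) : Euc (m + 1) →L[ℝ] Euc (m + 2) :=
  chartDeriv κ (Q.map z) ∘L fderiv ℝ Q.map z

theorem paramInv_param (z : Euc (m + 1)) : paramInv κ Q (param κ Q z) = z := by
  rw [paramInv, param, chartInv_chart, Q.inv_map]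

theorem param_injective : Function.Injective (param κ Q) :=
  Function.LeftInverse.injective (paramInv_param κ Q)

theorem norm_param (z : Euc (m + 1)) : ‖param κ Q z‖ = 1 := norm_chart _ _

variable {κ Q}

theorem param_paramInv {x : Euc (m + 2)} (hx : ‖x‖ = 1) (h : flip (m + 1) κ x ≠ pole (m + 1)) :
    param κ Q (paramInv κ Q x) = x := by
  rw [paramInv, param, Q.map_inv, chart_chartInv hx h]

variable {z : Euc (m + 1)}

theorem contDiffAt_param (hz : z ∈ Q.dom) : ContDiffAt ℝ 1 (param κ Q) z :=
  ContDiffAt.comp z (contDiff_chart κ).contDiffAt (Mobius.contDiffAt_map hz)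

theorem hasFDerivAt_param (hz : z ∈ Q.dom) : HasFDerivAt (param κ Q) (paramDeriv κ Q z) z :=
  (hasFDerivAt_chart κ _).comp z (Mobius.differentiableAt_map hz).hasFDerivAt

theorem paramFactor_pos (hz : z ∈ Q.dom) : 0 < paramFactor Q z :=
  mul_pos (confFactor_pos _) (Mobius.factor_pos hz)

theorem norm_paramDeriv (hz : z ∈ Q.dom) (v : Euc (m + 1)) :
    ‖paramDeriv κ Q z v‖ = paramFactor Q z * ‖v‖ := by
  rw [paramDeriv, ContinuousLinearMap.comp_apply, norm_chartDeriv, Mobius.norm_fderiv_map hz,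
    paramFactor, mul_assoc]

theorem inner_param_paramDeriv (v : Euc (m + 1)) :
    inner ℝ (param κ Q z) (paramDeriv κ Q z v) = 0 :=
  inner_chart_chartDeriv κ _ _

theorem continuousAt_paramInv (hz : z ∈ Q.dom) : ContinuousAt (paramInv κ Q) (param κ Q z) := by
  refine ContinuousAt.comp (g := Q.inv) ?_
    (continuousAt_chartInv (norm_param κ Q z) (flip_chart_ne_pole κ _))
  rw [param, chartInv_chart]
  exact (Mobius.contDiffAt_inv hz).continuousAt

theorem mobiusSource_eq (g : Euc (m + 2) → Cl (m + 2)) (y : Euc (m + 2))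
    {η : Euc (m + 2) → ℝ} (hη : DifferentiableAt ℝ η (param κ Q z)) :
    mobiusSource Q (kern κ y) (localRep g κ) (fun u => η (chart κ u)) z =
      paramFactor Q z ^ (m + 1) • sourceForm g y η (param κ Q z) := by
  rw [mobiusSource, ← conf_smul_sourceForm κ _ g y hη, smul_smul, paramFactor, mul_pow, mul_comm,
    param]

/-- The flux form of the composed parametrization depends only on the product of the two conformal
factors. It is therefore intrinsic to the sphere. -/
theorem mobiusFlux_eq (g : Euc (m + 2) → Cl (m + 2)) (y : Euc (m + 2))
    (η : Euc (m + 2) → ℝ) (v : Euc (m + 1)) :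
    mobiusFlux Q (kern κ y) (localRep g κ) (fun u => η (chart κ u)) z v =
      paramFactor Q z ^ (m + 1) • (η (param κ Q z) • (cauchyG (m + 1) (param κ Q z - y) *
        vec ((paramFactor Q z ^ 2)⁻¹ • paramDeriv κ Q z v) * g (param κ Q z))) := by
  rw [mobiusFlux_apply, localRep, ← conf_smul_cauchyG_mul,
    ContinuousLinearMap.map_smul (chartDeriv κ (Q.map z)), smul_smul (_)⁻¹, ← mul_inv, ← mul_pow,
    smul_smul, smul_smul, smul_smul, paramFactor, mul_pow (confFactor _) _ (m + 1), paramDeriv,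
    ContinuousLinearMap.comp_apply, param]
  congr 1
  ring

theorem integral_param_image {F : Type*} [NormedAddCommGroup F] [NormedSpace ℝ F]
    {A : Set (Euc (m + 1))} (hA : MeasurableSet A) (hAd : A ⊆ Q.dom) (f : Euc (m + 2) → F) :
    ∫ x in param κ Q '' A, f x ∂(Measure.euclideanHausdorffMeasure (m + 1)) =
      ∫ z in A, paramFactor Q z ^ (m + 1) • f (param κ Q z) := by
  have h1 := integral_image_eq_normDet_smul hA (measurable_fderiv ℝ (param κ Q))
    (fun z hz => (hasFDerivAt_param (hAd hz)).differentiableAt.hasFDerivAt.hasFDerivWithinAt)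
    (fun z hz => by
      rw [(hasFDerivAt_param (hAd hz)).fderiv]
      exact injective_of_conformal (paramFactor_pos (hAd hz)) (norm_paramDeriv (hAd hz)))
    (param_injective κ Q).injOn f
  rw [finrank_euclideanSpace_fin] at h1
  rw [h1]
  refine setIntegral_congr_fun hA fun z hz => ?_
  have h2 := normDet_conformal (paramFactor_pos (hAd hz)).le (norm_paramDeriv (κ := κ) (hAd hz))
  rw [finrank_euclideanSpace_fin] at h2
  rw [← h2, (hasFDerivAt_param (hAd hz)).fderiv]

/-- The area formula for a Möbius image of a Lipschitz graph. -/
theorem param_graph_area {F : Type*} [NormedAddCommGroup F] [NormedSpace ℝ F]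
    {φ : Euc m → ℝ} {L K : ℝ≥0} (hφ : LipschitzWith L φ) {D : Set (Euc m)} (hD : MeasurableSet D)
    {W : Set (Euc (m + 1))} (hWd : W ⊆ Q.dom) (hDW : ∀ x ∈ D, join x (φ x) ∈ W)
    (hlip : LipschitzOnWith K (param κ Q) W) (f : Euc (m + 2) → F) :
    (IntegrableOn f ((fun x => param κ Q (join x (φ x))) '' D)
        (Measure.euclideanHausdorffMeasure m) ↔
      IntegrableOn (fun x => (paramFactor Q (join x (φ x)) ^ m * ‖graphNormal φ x‖) •
        f (param κ Q (join x (φ x)))) D) ∧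
    ∫ p in (fun x => param κ Q (join x (φ x))) '' D, f p ∂(Measure.euclideanHausdorffMeasure m) =
      ∫ x in D, (paramFactor Q (join x (φ x)) ^ m * ‖graphNormal φ x‖) •
        f (param κ Q (join x (φ x))) := by
  let Γ : Euc m → Euc (m + 2) := fun x => param κ Q (join x (φ x))
  -- The area formula needs a derivative at every point. The points without one are null by
  -- Rademacher's theorem, and so is their Lipschitz image.
  let D' : Set (Euc m) := D ∩ {x | DifferentiableAt ℝ φ x}
  have hD' : MeasurableSet D' := hD.inter (measurableSet_of_differentiableAt ℝ φ)
  have hnull : volume (D \ D') = 0 := by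
    refine measure_mono_null ?_ (ae_iff.1 hφ.ae_differentiableAt)
    exact fun x hx h => hx.2 ⟨hx.1, h⟩
  have hae : D' =ᵐ[volume] D := by
    refine (ae_eq_set.2 ⟨?_, hnull⟩)
    rw [sdiff_eq_empty.2 inter_subset_left, measure_empty]
  have hjl : LipschitzWith (1 + L) fun x => join x (φ x) := by
    refine LipschitzWith.add (embL m).lipschitz (LipschitzWith.of_dist_le_mul fun x y => ?_)
    rw [dist_eq_norm, ← sub_smul, norm_smul, norm_pole, mul_one]
    exact hφ.dist_le_mul x y
  have hΓl : LipschitzOnWith (K * (1 + L)) Γ (D \ D') :=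
    hlip.comp hjl.lipschitzOnWith fun x hx => hDW x hx.1
  have hnull' : Measure.euclideanHausdorffMeasure m (Γ '' (D \ D')) = 0 := by
    have := euclideanHausdorffMeasure_image_null hΓl hnull
    rwa [finrank_euclideanSpace_fin] at this
  have hae' : Γ '' D' =ᵐ[Measure.euclideanHausdorffMeasure m] Γ '' D := by
    refine (ae_eq_set.2 ⟨?_, measure_mono_null ?_ hnull'⟩)
    · rw [sdiff_eq_empty.2 (image_mono inter_subset_left), measure_empty]
    · rintro _ ⟨⟨x, hx, rfl⟩, h⟩
      exact ⟨x, ⟨hx, fun hx' => h ⟨x, hx', rfl⟩⟩, rfl⟩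
  have hder : ∀ x ∈ D', HasFDerivAt Γ
      (paramDeriv κ Q (join x (φ x)) ∘L graphDeriv (gradient φ x)) x := by
    intro x hx
    have h1 := hasFDerivAt_graph hx.2
    have h2 : HasFDerivAt (param κ Q) (paramDeriv κ Q (join x (φ x))) (join x (φ x)) :=
      hasFDerivAt_param (hWd (hDW x hx.1))
    exact (h2.comp x h1 :)
  have hdet : ∀ x ∈ D', (fderiv ℝ Γ x).toLinearMap.normDet =
      paramFactor Q (join x (φ x)) ^ m * ‖graphNormal φ x‖ := by
    intro x hx
    have hd := hWd (hDW x hx.1)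
    rw [(hder x hx).fderiv, normDet_conformal_comp (paramFactor_pos hd).le (norm_paramDeriv hd),
      normDet_graphDeriv, finrank_euclideanSpace_fin, graphNormal]
  have hinj : ∀ x ∈ D', Function.Injective (fderiv ℝ Γ x) := by
    intro x hx
    have hd := hWd (hDW x hx.1)
    rw [(hder x hx).fderiv]
    exact (injective_of_conformal (paramFactor_pos hd) (norm_paramDeriv hd)).comp
      (graphDeriv_injective _)
  have hΓi : InjOn Γ D' := by
    refine ((param_injective κ Q).comp fun x y hxy => ?_).injOn
    simpa using congrArg (projL m) hxy
  have hw : ∀ x ∈ D', HasFDerivWithinAt Γ (fderiv ℝ Γ x) D' x := fun x hx =>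
    (hder x hx).differentiableAt.hasFDerivAt.hasFDerivWithinAt
  have h1 := integrableOn_image_iff_normDet_smul hD' (measurable_fderiv ℝ Γ) hw hinj hΓi f
  have h2 := integral_image_eq_normDet_smul hD' (measurable_fderiv ℝ Γ) hw hinj hΓi f
  rw [finrank_euclideanSpace_fin] at h1 h2
  have hcongr : EqOn (fun x => (fderiv ℝ Γ x).toLinearMap.normDet • f (Γ x))
      (fun x => (paramFactor Q (join x (φ x)) ^ m * ‖graphNormal φ x‖) • f (Γ x)) D' :=
    fun x hx => by simp only [hdet x hx]
  constructor
  · rw [← integrableOn_congr_set_ae hae', ← integrableOn_congr_set_ae hae, h1]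
    exact integrableOn_congr_fun hcongr hD'
  · rw [← setIntegral_congr_set hae', ← setIntegral_congr_set hae, h2]
    exact setIntegral_congr_fun hD' hcongr

end Param

/-! ### Outward normals -/

section Normal

open Filter

variable {n : ℕ}

/-- A curve on the sphere through `x` with velocity `τ`. -/
def sphereCurve (x τ : Euc (n + 1)) (s : ℝ) : Euc (n + 1) := ‖x + s • τ‖⁻¹ • (x + s • τ)

variable {x τ ν : Euc (n + 1)}

theorem sphereCurve_zero (hx : ‖x‖ = 1) : sphereCurve x τ 0 = x := by
  rw [sphereCurve, zero_smul, add_zero, hx, inv_one, one_smul]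

theorem norm_add_smul_sq (hx : ‖x‖ = 1) (hτ : inner ℝ x τ = 0) (s : ℝ) :
    ‖x + s • τ‖ ^ 2 = 1 + s ^ 2 * ‖τ‖ ^ 2 := by
  rw [norm_add_sq_real, hx, inner_smul_right, hτ, norm_smul, mul_pow, Real.norm_eq_abs, sq_abs]
  ring

theorem norm_add_smul_pos (hx : ‖x‖ = 1) (hτ : inner ℝ x τ = 0) (s : ℝ) : 0 < ‖x + s • τ‖ := by
  have h := norm_add_smul_sq hx hτ s
  refine (norm_nonneg _).lt_of_ne fun h0 => ?_
  rw [← h0] at h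
  nlinarith [mul_nonneg (sq_nonneg s) (sq_nonneg ‖τ‖)]

theorem norm_sphereCurve (hx : ‖x‖ = 1) (hτ : inner ℝ x τ = 0) (s : ℝ) :
    ‖sphereCurve x τ s‖ = 1 := by
  rw [sphereCurve, norm_smul, norm_inv, norm_norm,
    inv_mul_cancel₀ (norm_add_smul_pos hx hτ s).ne']

theorem hasDerivAt_sphereCurve (hx : ‖x‖ = 1) (hτ : inner ℝ x τ = 0) :
    HasDerivAt (sphereCurve x τ) τ 0 := by
  have h1 : HasDerivAt (fun s : ℝ => x + s • τ) τ 0 := by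
    simpa using ((hasDerivAt_id (0 : ℝ)).smul_const τ).const_add x
  have h2 : HasDerivAt (fun s : ℝ => ‖x + s • τ‖⁻¹) 0 0 := by
    have h3 : (fun s : ℝ => ‖x + s • τ‖⁻¹) = fun s : ℝ => (√(1 + s ^ 2 * ‖τ‖ ^ 2))⁻¹ := by
      funext s
      rw [← norm_add_smul_sq hx hτ, Real.sqrt_sq (norm_nonneg _)]
    rw [h3]
    have h4 : HasDerivAt (fun s : ℝ => 1 + s ^ 2 * ‖τ‖ ^ 2) 0 0 := by
      simpa using (((hasDerivAt_id (0 : ℝ)).pow 2).mul_const (‖τ‖ ^ 2)).const_add 1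
    have h5 := (h4.sqrt (by norm_num)).fun_inv (by norm_num)
    simpa using h5
  have h6 := h2.smul h1
  simp only [zero_smul, add_zero, hx, inv_one, one_smul] at h6
  exact h6

theorem tendsto_sphereCurve (hx : ‖x‖ = 1) (hτ : inner ℝ x τ = 0) :
    Tendsto (sphereCurve x τ) (𝓝[>] 0) (𝓝[sphere 0 1] x) := by
  refine tendsto_nhdsWithin_iff.2 ⟨?_, Eventually.of_forall fun s => ?_⟩
  · have := (hasDerivAt_sphereCurve hx hτ).continuousAt.tendsto
    rw [sphereCurve_zero hx] at this
    exact this.mono_left nhdsWithin_le_nhds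
  · rw [mem_sphere_zero_iff_norm, norm_sphereCurve hx hτ]

/-- The difference quotients of the curve converge to `τ`, and `τ` lies strictly inside some cone
around `ν`. This tests the normal condition, which speaks of cones, along curves. -/
theorem exists_sphereCurve_mem_cone (hx : ‖x‖ = 1) (hτ : inner ℝ x τ = 0) (h : 0 < inner ℝ τ ν) :
    ∃ ε > (0 : ℝ), ∀ᶠ s in 𝓝[>] 0,
      ε * ‖sphereCurve x τ s - x‖ < inner ℝ (sphereCurve x τ s - x) ν := by
  obtain ⟨ε, hε, hε'⟩ : ∃ ε > (0 : ℝ), ε * ‖τ‖ < inner ℝ τ ν := by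
    refine ⟨inner ℝ τ ν / (‖τ‖ + 1), by positivity, ?_⟩
    rw [div_mul_eq_mul_div, div_lt_iff₀ (by positivity)]
    exact mul_lt_mul_of_pos_left (lt_add_one _) h
  refine ⟨ε, hε, ?_⟩
  have h1 := (hasDerivAt_sphereCurve hx hτ).tendsto_slope_zero_right
  simp only [zero_add, sphereCurve_zero hx] at h1
  have h2 : Tendsto (fun d : Euc (n + 1) => inner ℝ d ν - ε * ‖d‖) (𝓝 τ)
      (𝓝 (inner ℝ τ ν - ε * ‖τ‖)) :=
    ((continuous_id.inner continuous_const).sub (continuous_const.mul continuous_norm)).tendsto τ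
  filter_upwards [(h2.comp h1).eventually_const_lt (sub_pos.2 hε'), self_mem_nhdsWithin] with s hs hs0
  have hs0' : (0 : ℝ) < s := hs0
  simp only [Function.comp_apply, inner_smul_left, norm_smul, norm_inv, Real.norm_eq_abs,
    abs_of_pos hs0', RCLike.conj_to_real] at hs
  have h3 : s⁻¹ * (inner ℝ (sphereCurve x τ s - x) ν - ε * ‖sphereCurve x τ s - x‖) > 0 := by
    linarith
  have h4 := (pos_iff_pos_of_mul_pos h3).1 (inv_pos.2 hs0')
  linarith

namespace IsOutwardNormal

variable {V V' : Set (Euc (n + 1))}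

theorem eventually_notMem (hν : IsOutwardNormal V x ν) (hx : ‖x‖ = 1) (hτ : inner ℝ x τ = 0)
    (h : 0 < inner ℝ τ ν) : ∀ᶠ s in 𝓝[>] 0, sphereCurve x τ s ∉ V := by
  obtain ⟨ε, hε, h1⟩ := exists_sphereCurve_mem_cone hx hτ h
  filter_upwards [h1, (tendsto_sphereCurve hx hτ).eventually (hν.2.2 ε hε)] with s h2 h3
  exact h3.1 h2

theorem eventually_mem (hν : IsOutwardNormal V x ν) (hx : ‖x‖ = 1) (hτ : inner ℝ x τ = 0)
    (h : inner ℝ τ ν < 0) : ∀ᶠ s in 𝓝[>] 0, sphereCurve x τ s ∈ V := by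
  obtain ⟨ε, hε, h1⟩ := exists_sphereCurve_mem_cone (ν := -ν) hx hτ
    (by rw [inner_neg_right]; linarith)
  filter_upwards [h1, (tendsto_sphereCurve hx hτ).eventually (hν.2.2 ε hε)] with s h2 h3
  rw [inner_neg_right] at h2
  exact h3.2 (by linarith)

/-- The direction `ν - ν'` points out of `V` according to `ν` and into `V` according to `ν'`, so the
curve in that direction would be eventually both outside and inside. -/
theorem unique {ν' : Euc (n + 1)} (hx : ‖x‖ = 1) (hν : IsOutwardNormal V x ν)
    (hν' : IsOutwardNormal V x ν') : ν = ν' := by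
  by_contra hne
  have h1 := (inner_lt_one_iff_real_of_norm_eq_one hν.1 hν'.1).2 hne
  have hτ : inner ℝ x (ν - ν') = 0 := by rw [inner_sub_right, hν.2.1, hν'.2.1, sub_zero]
  have h2 := hν.eventually_notMem hx hτ (by
    rw [inner_sub_left, real_inner_self_eq_norm_sq, hν.1, real_inner_comm]; linarith)
  have h3 := hν'.eventually_mem hx hτ (by
    rw [inner_sub_left, real_inner_self_eq_norm_sq, hν'.1]; linarith)
  obtain ⟨s, h4, h5⟩ := (h2.and h3).exists
  exact h4 h5

theorem congr (hν : IsOutwardNormal V x ν) (h : ∀ᶠ p in 𝓝[sphere 0 1] x, p ∈ V ↔ p ∈ V') :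
    IsOutwardNormal V' x ν := by
  refine ⟨hν.1, hν.2.1, fun ε hε => ?_⟩
  filter_upwards [hν.2.2 ε hε, h] with p h1 h2
  rwa [← h2]

theorem outwardNormal_eq (hx : ‖x‖ = 1) (hν : IsOutwardNormal V x ν) : outwardNormal V x = ν := by
  have h : ∃ ν, IsOutwardNormal V x ν := ⟨ν, hν⟩
  rw [outwardNormal, dif_pos h]
  exact unique hx h.choose_spec hν

end IsOutwardNormal

theorem outwardNormal_congr {V V' : Set (Euc (n + 1))}
    (h : ∀ᶠ p in 𝓝[sphere 0 1] x, p ∈ V ↔ p ∈ V') : outwardNormal V x = outwardNormal V' x := by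
  have : IsOutwardNormal V x = IsOutwardNormal V' x := by
    funext ν
    exact propext ⟨fun hν => hν.congr h, fun hν => hν.congr (h.mono fun p hp => hp.symm)⟩
  unfold outwardNormal
  rw [this]

theorem outwardNormal_eq_zero {V : Set (Euc (n + 1))} (h : ∀ ν, ¬ IsOutwardNormal V x ν) :
    outwardNormal V x = 0 := by
  rw [outwardNormal, dif_neg (not_exists.2 h)]

/-- The normal is positively homogeneous for the sign that tells which side lies in `V`. -/
theorem outwardNormal_of_sides {V A B : Set (Euc (n + 1))} {a b : Prop} [Decidable a] [Decidable b]
    (hx : ‖x‖ = 1) (hB : IsOutwardNormal B x ν) (hA : IsOutwardNormal A x (-ν))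
    (ha : ∀ p ∈ B, (p ∈ V ↔ a)) (hb : ∀ p ∈ A, (p ∈ V ↔ b))
    (hV : ∀ᶠ p in 𝓝[sphere 0 1] x, p ∈ V → p ∈ A ∨ p ∈ B) :
    outwardNormal V x = ((if a then 1 else 0) - (if b then 1 else 0) : ℝ) • ν := by
  by_cases ha' : a <;> by_cases hb' : b
  · simp only [ha', hb', if_true, sub_self, zero_smul]
    refine outwardNormal_eq_zero fun ν' hν' => ?_
    -- Both sides belong to `V`. A tangent direction that points outward for a supposed normal `ν'`
    -- but is transversal to the boundary stays in one of the two sides, hence in `V`: a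
    -- contradiction.
    obtain ⟨τ, hτ, h1, h2⟩ : ∃ τ, inner ℝ x τ = 0 ∧ 0 < inner ℝ τ ν' ∧ inner ℝ τ ν ≠ 0 := by
      have h3 : inner ℝ ν' ν' = 1 := by rw [real_inner_self_eq_norm_sq, hν'.1, one_pow]
      have h4 : inner ℝ ν ν = 1 := by rw [real_inner_self_eq_norm_sq, hB.1, one_pow]
      by_cases h : inner ℝ ν' ν = 0
      · refine ⟨ν' + ν, ?_, ?_, ?_⟩
        · rw [inner_add_right, hν'.2.1, hB.2.1, add_zero]
        · rw [inner_add_left, h3, real_inner_comm, h]; norm_num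
        · rw [inner_add_left, h4, h]; norm_num
      · exact ⟨ν', hν'.2.1, by rw [h3]; exact one_pos, h⟩
    have h5 := hν'.eventually_notMem hx hτ h1
    have h6 : ∀ᶠ s in 𝓝[>] 0, sphereCurve x τ s ∈ V := by
      rcases lt_or_gt_of_ne h2 with h | h
      · exact (hB.eventually_mem hx hτ h).mono fun s hs => (ha _ hs).2 ha'
      · refine (hA.eventually_mem hx hτ ?_).mono fun s hs => (hb _ hs).2 hb'
        rw [inner_neg_right]; linarith
    obtain ⟨s, h7, h8⟩ := (h5.and h6).exists
    exact h7 h8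
  · simp only [ha', hb', if_true, if_false, sub_zero, one_smul]
    refine (hB.congr ?_).outwardNormal_eq hx
    filter_upwards [hV] with p hp
    refine ⟨fun h => (ha p h).2 ha', fun h => (hp h).resolve_left fun hpA => ?_⟩
    exact hb' ((hb p hpA).1 h)
  · simp only [ha', hb', if_true, if_false, zero_sub, neg_smul, one_smul]
    refine (hA.congr ?_).outwardNormal_eq hx
    filter_upwards [hV] with p hp
    refine ⟨fun h => (hb p h).2 hb', fun h => (hp h).resolve_right fun hpB => ?_⟩
    exact ha' ((ha p hpB).1 h)
  · simp only [ha', hb', if_false, sub_self, zero_smul]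
    refine outwardNormal_eq_zero fun ν' hν' => ?_
    -- Neither side belongs to `V`, but a supposed normal would force the curve in the direction
    -- `-ν'` into `V`.
    have h1 : inner ℝ x (-ν') = 0 := by rw [inner_neg_right, hν'.2.1, neg_zero]
    have h2 := hν'.eventually_mem hx h1 (by
      rw [inner_neg_left, real_inner_self_eq_norm_sq, hν'.1]; norm_num)
    obtain ⟨s, h3, h4⟩ := (h2.and ((tendsto_sphereCurve hx h1).eventually hV)).exists
    rcases h4 h3 with h | h
    · exact hb' ((hb _ h).1 h3)
    · exact ha' ((ha _ h).1 h3)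

variable {m : ℕ} {κ : Bool} {Q : Mobius (m + 1)} {z : Euc (m + 1)}

theorem eventually_param_paramInv (z : Euc (m + 1)) :
    ∀ᶠ p in 𝓝[sphere 0 1] (param κ Q z), param κ Q (paramInv κ Q p) = p := by
  have h1 : ∀ᶠ p in 𝓝 (param κ Q z), flip (m + 1) κ p ≠ pole (m + 1) :=
    (flip (m + 1) κ).continuous.continuousAt.eventually_ne (flip_chart_ne_pole κ _)
  filter_upwards [nhdsWithin_le_nhds h1, self_mem_nhdsWithin] with p hp hp'
  exact param_paramInv (mem_sphere_zero_iff_norm.1 hp') hp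

theorem tendsto_paramInv (hz : z ∈ Q.dom) :
    Tendsto (paramInv κ Q) (𝓝[sphere 0 1] (param κ Q z)) (𝓝 z) := by
  have := (continuousAt_paramInv (κ := κ) hz).tendsto
  rw [paramInv_param] at this
  exact this.mono_left nhdsWithin_le_nhds

/-- A conformal derivative carries cones to cones; half of the aperture is given up to absorb the
error of linearization. -/
theorem eventually_cone_param (hz : z ∈ Q.dom) {N : Euc (m + 1)} (hN : N ≠ 0) {ε : ℝ} (hε : 0 < ε) :
    ∀ᶠ p in 𝓝[sphere 0 1] (param κ Q z), ε * ‖p - param κ Q z‖ <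
        inner ℝ (p - param κ Q z) ((paramFactor Q z * ‖N‖)⁻¹ • paramDeriv κ Q z N) →
      (ε * ‖N‖ / 2) * ‖paramInv κ Q p - z‖ < inner ℝ (paramInv κ Q p - z) N := by
  have hc := paramFactor_pos hz
  have hN' := norm_pos_iff.2 hN
  set c := paramFactor Q z
  set ν := (c * ‖N‖)⁻¹ • paramDeriv κ Q z N with hν
  have hν1 : ‖ν‖ = 1 := by
    rw [hν, norm_smul, norm_paramDeriv hz, norm_inv, Real.norm_eq_abs, abs_of_pos (by positivity)]
    exact inv_mul_cancel₀ (by positivity)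
  -- The linearization error enters once through `ε * ‖d‖` and once through the inner product, so `δ
  -- (1 + ε)` has to be half of `ε c`.
  set δ := ε * c / (2 * (1 + ε)) with hδ
  have hδ0 : 0 < δ := by positivity
  have h1 := (hasFDerivAt_param (κ := κ) hz).isLittleO.def hδ0
  filter_upwards [(tendsto_paramInv (κ := κ) hz).eventually h1, eventually_param_paramInv z]
    with p h2 h3 h4
  rw [h3] at h2
  set w := paramInv κ Q p - z with hw
  set d := p - param κ Q z with hd
  have h5 : ‖paramDeriv κ Q z w‖ = c * ‖w‖ := norm_paramDeriv hz w
  have h6 : inner ℝ (paramDeriv κ Q z w) ν = c / ‖N‖ * inner ℝ w N := by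
    rw [hν, inner_smul_right, inner_map_map_of_conformal (norm_paramDeriv hz)]
    change (c * ‖N‖)⁻¹ * (c ^ 2 * _) = _
    field_simp
  have h7 : ‖d‖ ≥ c * ‖w‖ - δ * ‖w‖ := by
    have h8 := norm_sub_norm_le (paramDeriv κ Q z w) (paramDeriv κ Q z w - d)
    rw [sub_sub_cancel, h5, norm_sub_rev (paramDeriv κ Q z w) d] at h8
    linarith
  have h8 : inner ℝ d ν ≤ c / ‖N‖ * inner ℝ w N + δ * ‖w‖ := by
    have h9 : inner ℝ d ν = inner ℝ (paramDeriv κ Q z w) ν +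
        inner ℝ (d - paramDeriv κ Q z w) ν := by
      rw [← inner_add_left, add_sub_cancel]
    have h10 := (real_inner_le_norm (d - paramDeriv κ Q z w) ν).trans
      (mul_le_mul_of_nonneg_right h2 (norm_nonneg ν))
    rw [hν1, mul_one] at h10
    rw [h9, h6]
    linarith
  have h11 : δ * (2 * (1 + ε)) = ε * c := by
    rw [hδ]; field_simp
  have h12 : ε * (c * ‖w‖ - δ * ‖w‖) < c / ‖N‖ * inner ℝ w N + δ * ‖w‖ :=
    lt_of_le_of_lt (mul_le_mul_of_nonneg_left h7 hε.le) (h4.trans_le h8)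
  have h13 : ε * c / 2 * ‖w‖ < c / ‖N‖ * inner ℝ w N := by
    have : ε * c / 2 = ε * c - δ * (1 + ε) := by linarith
    rw [this]
    linarith
  have h14 : c / ‖N‖ * (ε * ‖N‖ / 2 * ‖w‖) < c / ‖N‖ * inner ℝ w N := by
    refine lt_of_eq_of_lt ?_ h13
    field_simp
  exact lt_of_mul_lt_mul_left h14 (by positivity)

theorem inner_sub_graphNormal (φ : Euc m → ℝ) (x : Euc m) (w : Euc (m + 1)) :
    inner ℝ (w - join x (φ x)) (graphNormal φ x) =
      (w (Fin.last m) - φ x) - inner ℝ (projL m w - x) (gradient φ x) := by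
  have h1 : w - join x (φ x) = emb (projL m w - x) + (w (Fin.last m) - φ x) • pole m := by
    conv_lhs => rw [← join_projL w]
    simp only [join, map_sub]
    module
  rw [h1, graphNormal, inner_add_left, inner_sub_right, inner_sub_right, inner_smul_left,
    inner_smul_left, inner_emb_pole, inner_emb, inner_pole_pole, inner_pole_emb]
  simp
  ring

theorem norm_projL_sub_le (x : Euc m) (t : ℝ) (w : Euc (m + 1)) :
    ‖projL m w - x‖ ≤ ‖w - join x t‖ := by
  rw [← sq_le_sq₀ (norm_nonneg _) (norm_nonneg _)]
  have h1 : w - join x t = join (projL m w - x) (w (Fin.last m) - t) := by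
    conv_lhs => rw [← join_projL w]
    simp only [join, map_sub]
    module
  rw [h1, norm_join_sq]
  nlinarith [sq_nonneg (w (Fin.last m) - t)]

/-- The inner product with the graph normal is the height above the tangent plane, and the graph
deviates from that plane by a small multiple of the distance. -/
theorem eventually_side_graph {φ : Euc m → ℝ} {x : Euc m} (hφ : DifferentiableAt ℝ φ x) {c : ℝ}
    (hc : 0 < c) : ∀ᶠ w in 𝓝 (join x (φ x)),
      (c * ‖w - join x (φ x)‖ < inner ℝ (w - join x (φ x)) (graphNormal φ x) →
        φ (projL m w) < w (Fin.last m)) ∧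
      (c * ‖w - join x (φ x)‖ < inner ℝ (w - join x (φ x)) (-graphNormal φ x) →
        w (Fin.last m) < φ (projL m w)) := by
  have h1 := hφ.hasFDerivAt.isLittleO.def hc
  have h2 : Tendsto (projL m) (𝓝 (join x (φ x))) (𝓝 x) := by
    have := (projL m).continuous.tendsto (join x (φ x))
    rwa [projL_join] at this
  filter_upwards [h2.eventually h1] with w hw
  rw [← inner_gradient_left, Real.norm_eq_abs, real_inner_comm] at hw
  have h3 := hw.trans (mul_le_mul_of_nonneg_left (norm_projL_sub_le x (φ x) w) hc.le)
  rw [inner_neg_right, inner_sub_graphNormal]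
  have h4 := abs_le.1 h3
  exact ⟨fun h => by linarith, fun h => by linarith⟩

theorem graphNormal_ne_zero (φ : Euc m → ℝ) (x : Euc m) : graphNormal φ x ≠ 0 := by
  intro h
  have h1 := congrArg (fun v => v (Fin.last m)) h
  simp [graphNormal, emb_last, pole_last] at h1

/-- The unit normal of the Möbius image of a graph, pointing upwards. -/
def unitNormal (κ : Bool) (Q : Mobius (m + 1)) (φ : Euc m → ℝ) (x : Euc m) : Euc (m + 2) :=
  (paramFactor Q (join x (φ x)) * ‖graphNormal φ x‖)⁻¹ •
    paramDeriv κ Q (join x (φ x)) (graphNormal φ x)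

theorem norm_unitNormal {φ : Euc m → ℝ} {x : Euc m} (hz : join x (φ x) ∈ Q.dom) :
    ‖unitNormal κ Q φ x‖ = 1 := by
  have h1 := paramFactor_pos hz
  have h2 := norm_pos_iff.2 (graphNormal_ne_zero φ x)
  rw [unitNormal, norm_smul, norm_paramDeriv hz, norm_inv, Real.norm_eq_abs,
    abs_of_pos (by positivity)]
  exact inv_mul_cancel₀ (by positivity)

/-- A cone around the normal on the sphere pulls back into a cone around the graph normal, which
lies on one side of the graph near the point. -/
theorem isOutwardNormal_graph {φ : Euc m → ℝ} {x : Euc m} {W : Set (Euc (m + 1))} (hW : IsOpen W)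
    (hWd : W ⊆ Q.dom) (hxW : join x (φ x) ∈ W) (hφ : DifferentiableAt ℝ φ x) :
    IsOutwardNormal (param κ Q '' (W ∩ {w | w (Fin.last m) < φ (projL m w)}))
      (param κ Q (join x (φ x))) (unitNormal κ Q φ x) ∧
    IsOutwardNormal (param κ Q '' (W ∩ {w | φ (projL m w) < w (Fin.last m)}))
      (param κ Q (join x (φ x))) (-unitNormal κ Q φ x) := by
  have hz := hWd hxW
  have hN := graphNormal_ne_zero φ x
  have hperp : inner ℝ (param κ Q (join x (φ x))) (unitNormal κ Q φ x) = 0 := by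
    rw [unitNormal, inner_smul_right, inner_param_paramDeriv, mul_zero]
  have key : ∀ ε > 0, ∀ᶠ p in 𝓝[sphere 0 1] (param κ Q (join x (φ x))),
      (param κ Q (paramInv κ Q p) = p ∧ paramInv κ Q p ∈ W) ∧
      (ε * ‖p - param κ Q (join x (φ x))‖ <
        inner ℝ (p - param κ Q (join x (φ x))) (unitNormal κ Q φ x) →
          φ (projL m (paramInv κ Q p)) < paramInv κ Q p (Fin.last m)) ∧
      (inner ℝ (p - param κ Q (join x (φ x))) (unitNormal κ Q φ x) <
        -(ε * ‖p - param κ Q (join x (φ x))‖) →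
          paramInv κ Q p (Fin.last m) < φ (projL m (paramInv κ Q p))) := by
    intro ε hε
    have h1 := eventually_cone_param (κ := κ) hz hN hε
    have h2 := eventually_cone_param (κ := κ) hz (neg_ne_zero.2 hN) hε
    rw [norm_neg] at h2
    have hc : 0 < ε * ‖graphNormal φ x‖ / 2 := by
      have := norm_pos_iff.2 hN
      positivity
    filter_upwards [h1, h2, (tendsto_paramInv (κ := κ) hz).eventually (eventually_side_graph hφ hc),
      eventually_param_paramInv (join x (φ x)),
      (tendsto_paramInv (κ := κ) hz).eventually (hW.mem_nhds hxW)] with p h3 h4 h5 h6 h7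
    refine ⟨⟨h6, h7⟩, fun h => h5.1 (h3 h), fun h => h5.2 (h4 ?_)⟩
    rw [map_neg, smul_neg, inner_neg_right]
    change _ < -inner ℝ _ (unitNormal κ Q φ x)
    linarith
  refine ⟨⟨norm_unitNormal hz, hperp, fun ε hε => ?_⟩,
    ⟨by rw [norm_neg, norm_unitNormal hz], by rw [inner_neg_right, hperp, neg_zero],
      fun ε hε => ?_⟩⟩
  · filter_upwards [key ε hε] with p hp
    refine ⟨fun h => ?_, fun h => ⟨_, ⟨hp.1.2, hp.2.2 h⟩, hp.1.1⟩⟩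
    rintro ⟨w, ⟨-, hw⟩, rfl⟩
    have := hp.2.1 h
    rw [paramInv_param] at this
    exact lt_asymm this hw
  · filter_upwards [key ε hε] with p hp
    rw [inner_neg_right]
    refine ⟨fun h => ?_, fun h => ⟨_, ⟨hp.1.2, hp.2.1 (by linarith)⟩, hp.1.1⟩⟩
    rintro ⟨w, ⟨-, hw⟩, rfl⟩
    have := hp.2.2 (by linarith)
    rw [paramInv_param] at this
    exact lt_asymm this hw

end Normal

/-! ### The divergence theorem near a boundary point -/

section Patch

open Filter

variable {m : ℕ}

/-- `W` is a neighbourhood in a Möbius parametrization of the sphere, in which `∂V` is the graph of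
`φ`, and the two sides of the graph lie in `V` or not according to `a` and `b`. -/
structure IsGraphPatch (V : Set (Euc (m + 2))) (κ : Bool) (Q : Mobius (m + 1)) (φ : Euc m → ℝ)
    (W : Set (Euc (m + 1))) (a b : Prop) : Prop where
  isOpen : IsOpen W
  subset_dom : W ⊆ Q.dom
  lipschitz : ∃ K, LipschitzOnWith K (param κ Q) W
  below : ∀ z ∈ W, z (Fin.last m) < φ (projL m z) → (param κ Q z ∈ V ↔ a)
  above : ∀ z ∈ W, φ (projL m z) < z (Fin.last m) → (param κ Q z ∈ V ↔ b)
  graph : ∀ z ∈ W, param κ Q z ∈ closure V \ V ↔ z (Fin.last m) = φ (projL m z)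

/-- The integrand of the Cauchy formula on the sphere. -/
def boundaryForm (g : Euc (m + 2) → Cl (m + 2)) (y : Euc (m + 2)) (V : Set (Euc (m + 2)))
    (x : Euc (m + 2)) : Cl (m + 2) := cauchyG (m + 1) (x - y) * vec (outwardNormal V x) * g x

theorem sgrad_eq_zero {n : ℕ} {η : Euc (n + 1) → ℝ} {x : Euc (n + 1)} (hx : x ∉ tsupport η) :
    sgrad η x = 0 := by
  rw [sgrad, gradient_eq_zero_of_notMem_tsupport hx]
  simp

theorem sourceForm_eq_zero {n : ℕ} {g : Euc (n + 1) → Cl (n + 1)} {y : Euc (n + 1)}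
    {η : Euc (n + 1) → ℝ} {x : Euc (n + 1)} (hx : x ∉ tsupport η) : sourceForm g y η x = 0 := by
  rw [sourceForm, sgrad_eq_zero hx]
  simp

theorem tsupport_comp_chart_subset {κ : Bool} {Q : Mobius (m + 1)} {C : Set (Euc (m + 1))}
    {η : Euc (m + 2) → ℝ} (hηC : ∀ x ∈ tsupport η, ‖x‖ = 1 → x ∈ param κ Q '' C) :
    tsupport (fun u => η (chart κ u)) ⊆ Q.map '' C := by
  intro u hu
  have h1 : chart κ u ∈ tsupport η :=
    tsupport_comp_subset_preimage η (continuous_chart κ) hu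
  obtain ⟨z, hz, hzu⟩ := hηC _ h1 (norm_chart κ u)
  exact ⟨z, hz, chart_injective κ hzu⟩

theorem measurableSet_graph_side {φ : Euc m → ℝ} (hφ : Continuous φ) :
    MeasurableSet {z : Euc (m + 1) | z (Fin.last m) < φ (projL m z)} ∧
    MeasurableSet {z : Euc (m + 1) | φ (projL m z) < z (Fin.last m)} :=
  ⟨(isOpen_lt continuous_last (hφ.comp (projL m).continuous)).measurableSet,
    (isOpen_lt (hφ.comp (projL m).continuous) continuous_last).measurableSet⟩

open Classical in
/-- The integral over the sides that belong to `V`. -/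
theorem integral_sides {F : Type*} [NormedAddCommGroup F] [NormedSpace ℝ F] {φ : Euc m → ℝ}
    (hφ : Continuous φ) {W : Set (Euc (m + 1))} {P : Euc (m + 1) → Prop} {a b : Prop}
    (hm : MeasurableSet {z | z ∈ W ∧ P z})
    (ha : ∀ z ∈ W, z (Fin.last m) < φ (projL m z) → (P z ↔ a))
    (hb : ∀ z ∈ W, φ (projL m z) < z (Fin.last m) → (P z ↔ b))
    {q : Euc (m + 1) → F} (hq : Integrable q) (hqW : ∀ z, z ∉ W → q z = 0) (hq0 : ∫ z, q z = 0) :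
    ∫ z in {z | z ∈ W ∧ P z}, q z = ((if a then 1 else 0) - (if b then 1 else 0) : ℝ) •
      ∫ z in {z | z (Fin.last m) < φ (projL m z)}, q z := by
  set A := {z : Euc (m + 1) | z (Fin.last m) < φ (projL m z)} with hA
  set B := {z : Euc (m + 1) | φ (projL m z) < z (Fin.last m)} with hB
  have hAm : MeasurableSet A := (measurableSet_graph_side hφ).1
  have hBm : MeasurableSet B := (measurableSet_graph_side hφ).2
  have hae : ∀ᵐ z : Euc (m + 1), z (Fin.last m) ≠ φ (projL m z) :=
    measure_eq_zero_iff_ae_notMem.1 (volume_graph_eq_zero hφ)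
  have h1 : ∫ z in {z | z ∈ W ∧ P z}, q z =
      ∫ z, ((if a then 1 else 0 : ℝ) • A.indicator q z + (if b then 1 else 0 : ℝ) •
        B.indicator q z) := by
    rw [← integral_indicator hm]
    refine integral_congr_ae ?_
    filter_upwards [hae] with z hz
    by_cases hzW : z ∈ W
    · rcases lt_or_gt_of_ne hz with h | h
      · have hzA : z ∈ A := h
        have hzB : z ∉ B := fun h' => lt_asymm h h'
        rw [indicator_of_mem hzA, indicator_of_notMem hzB, smul_zero, add_zero]
        by_cases ha' : a
        · rw [indicator_of_mem (by exact ⟨hzW, (ha z hzW h).2 ha'⟩), if_pos ha', one_smul]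
        · rw [indicator_of_notMem (fun h' => ha' ((ha z hzW h).1 h'.2)), if_neg ha', zero_smul]
      · have hzB : z ∈ B := h
        have hzA : z ∉ A := fun h' => lt_asymm h h'
        rw [indicator_of_mem hzB, indicator_of_notMem hzA, smul_zero, zero_add]
        by_cases hb' : b
        · rw [indicator_of_mem (by exact ⟨hzW, (hb z hzW h).2 hb'⟩), if_pos hb', one_smul]
        · rw [indicator_of_notMem (fun h' => hb' ((hb z hzW h).1 h'.2)), if_neg hb', zero_smul]
    · have h0 := hqW z hzW
      simp [indicator_apply, h0]
  -- The total integral is 0 and the graph is a null set, so the integrals over the two sides are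
  -- opposite. This lets one flux through the graph, with the sign `[a] - [b]`, account for all
  -- cases.
  have h2 : (∫ z in A, q z) + ∫ z in B, q z = 0 := by
    have hd : Disjoint A B :=
      disjoint_left.2 fun z hzA hzB => lt_asymm (mem_ofPred_eq ▸ hzA) hzB
    have h3 := setIntegral_union (f := q) (μ := volume) hd hBm hq.integrableOn hq.integrableOn
    rw [← hq0, ← h3]
    refine setIntegral_eq_integral_of_ae_compl_eq_zero ?_
    filter_upwards [hae] with z hz h
    exact absurd (lt_or_gt_of_ne hz) h
  have h4 : ∫ z in B, q z = -∫ z in A, q z := eq_neg_of_add_eq_zero_right h2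
  rw [h1, integral_add (f := fun z => (if a then 1 else 0 : ℝ) • A.indicator q z)
    (g := fun z => (if b then 1 else 0 : ℝ) • B.indicator q z)
    ((hq.indicator hAm).smul _) ((hq.indicator hBm).smul _), integral_smul,
    integral_smul, integral_indicator hAm, integral_indicator hBm, h4,
    smul_neg, sub_smul, sub_eq_add_neg]

variable {V : Set (Euc (m + 2))} {κ : Bool} {Q : Mobius (m + 1)} {φ : Euc m → ℝ}
  {W C : Set (Euc (m + 1))} {a b : Prop} {g : Euc (m + 2) → Cl (m + 2)} {y : Euc (m + 2)}
  {η : Euc (m + 2) → ℝ}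

namespace IsGraphPatch

open Classical in
theorem outwardNormal_eq (hP : IsGraphPatch V κ Q φ W a b) {x : Euc m}
    (hx : join x (φ x) ∈ W) (hφ : DifferentiableAt ℝ φ x) :
    outwardNormal V (param κ Q (join x (φ x))) =
      ((if a then 1 else 0) - (if b then 1 else 0) : ℝ) • unitNormal κ Q φ x := by
  obtain ⟨hB, hA⟩ := isOutwardNormal_graph (κ := κ) hP.isOpen hP.subset_dom hx hφ
  refine outwardNormal_of_sides (norm_param κ Q _) hB hA ?_ ?_ ?_
  · rintro _ ⟨w, ⟨hw, hw'⟩, rfl⟩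
    exact hP.below w hw hw'
  · rintro _ ⟨w, ⟨hw, hw'⟩, rfl⟩
    exact hP.above w hw hw'
  · filter_upwards [eventually_param_paramInv (join x (φ x)),
      (tendsto_paramInv (κ := κ) (hP.subset_dom hx)).eventually (hP.isOpen.mem_nhds hx)]
      with p hp hpW hpV
    rcases lt_trichotomy (paramInv κ Q p (Fin.last m)) (φ (projL m (paramInv κ Q p))) with h | h | h
    · exact Or.inr ⟨_, ⟨hpW, h⟩, hp⟩
    -- Points of the graph are boundary points and so do not belong to the open set `V`.
    · rw [← hP.graph _ hpW, hp] at h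
      exact absurd hpV h.2
    · exact Or.inl ⟨_, ⟨hpW, h⟩, hp⟩

theorem setIntegral_source (hP : IsGraphPatch V κ Q φ W a b) (hVs : V ⊆ sphere 0 1)
    (hVm : MeasurableSet V) (hWV : MeasurableSet {z | z ∈ W ∧ param κ Q z ∈ V})
    (hη : ContDiff ℝ 1 η) (hCW : C ⊆ W)
    (hηC : ∀ x ∈ tsupport η, ‖x‖ = 1 → x ∈ param κ Q '' C) :
    ∫ x in V, sourceForm g y η x ∂(Measure.euclideanHausdorffMeasure (m + 1)) =
      ∫ z in {z | z ∈ W ∧ param κ Q z ∈ V},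
        mobiusSource Q (kern κ y) (localRep g κ) (fun u => η (chart κ u)) z := by
  have h1 : param κ Q '' {z | z ∈ W ∧ param κ Q z ∈ V} ⊆ V := by
    rintro _ ⟨z, ⟨-, hz⟩, rfl⟩
    exact hz
  rw [setIntegral_eq_of_subset_of_forall_sdiff_eq_zero hVm h1,
    integral_param_image hWV fun z hz => hP.subset_dom hz.1]
  · exact setIntegral_congr_fun hWV fun z _ =>
      (mobiusSource_eq g y (hη.differentiable one_ne_zero _)).symm
  · intro x hx
    refine sourceForm_eq_zero fun h => hx.2 ?_
    obtain ⟨z, hz, rfl⟩ := hηC x h (mem_sphere_zero_iff_norm.1 (hVs hx.1))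
    exact ⟨z, ⟨hCW hz, hx.1⟩, rfl⟩

theorem image_graph (hP : IsGraphPatch V κ Q φ W a b) :
    (closure V \ V) ∩ param κ Q '' W =
      (fun x => param κ Q (join x (φ x))) '' {x | join x (φ x) ∈ W} := by
  ext p
  constructor
  · rintro ⟨hp, z, hz, rfl⟩
    have h1 := (hP.graph z hz).1 hp
    have h2 : join (projL m z) (φ (projL m z)) = z := by rw [← h1, join_projL]
    exact ⟨projL m z, by rwa [mem_ofPred_eq, h2], by simp only [h2]⟩
  · rintro ⟨x, hx, rfl⟩
    exact ⟨(hP.graph _ hx).2 (by rw [join_last, projL_join]), _, hx, rfl⟩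

open Classical in
/-- The divergence theorem for a field supported near a boundary point. -/
theorem setIntegral_boundary (hP : IsGraphPatch V κ Q φ W a b) {L : ℝ≥0} (hφ : LipschitzWith L φ)
    (hVs : V ⊆ sphere 0 1) (hVm : MeasurableSet V)
    (hWV : MeasurableSet {z | z ∈ W ∧ param κ Q z ∈ V}) (hy : ‖y‖ = 1)
    (hWy : ∀ z ∈ W, param κ Q z ≠ y)
    (hg : ∀ z ∈ W, IsLeftMonogenicAt (localRep g κ) (Q.map z))
    (hη : ContDiff ℝ 1 η) (hC : IsCompact C) (hCW : C ⊆ W)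
    (hηC : ∀ x ∈ tsupport η, ‖x‖ = 1 → x ∈ param κ Q '' C) :
    IntegrableOn (fun x => η x • boundaryForm g y V x) (closure V \ V)
      (Measure.euclideanHausdorffMeasure m) ∧
    ∫ x in closure V \ V, η x • boundaryForm g y V x ∂(Measure.euclideanHausdorffMeasure m) =
      ∫ x in V, sourceForm g y η x ∂(Measure.euclideanHausdorffMeasure (m + 1)) := by
  have hζ : ContDiff ℝ 1 fun u : Euc (m + 1) => η (chart κ u) := hη.comp (contDiff_chart κ)
  have hζC := tsupport_comp_chart_subset hηC
  have hK : ∀ z ∈ W, IsRightMonogenicAt (kern κ y) (Q.map z) := fun z hz =>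
    kern_monogenic hy (hWy z hz)
  have hKc : ∀ z ∈ W, ContinuousAt (kern κ y) (Q.map z) := fun z hz => by
    obtain ⟨_, h1, _⟩ := hK z hz
    exact h1.continuousAt
  have hgc : ∀ z ∈ W, ContinuousAt (localRep g κ) (Q.map z) := fun z hz =>
    (hg z hz).1.continuousAt
  set q := mobiusSource Q (kern κ y) (localRep g κ) (fun u => η (chart κ u)) with hq
  set Z := mobiusFlux Q (kern κ y) (localRep g κ) (fun u => η (chart κ u)) with hZdef
  have hqi : Integrable q :=
    integrable_mobiusSource hP.isOpen hP.subset_dom hKc hgc hζ hC hCW hζC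
  have hZ : Continuous Z :=
    continuous_mobiusFlux hP.isOpen hP.subset_dom hKc hgc hζ.continuous hC hCW hζC
  have hZc : HasCompactSupport Z := hasCompactSupport_mobiusFlux hC hζC
  have hX : ∀ X : Euc (m + 1) → ℝ, ContDiff ℝ 1 X →
      (∫ z, X z • q z) + ∫ z, Z z (gradient X z) = 0 := fun X hX =>
    integral_mobiusSource_add_flux hP.isOpen hP.subset_dom hK hg hζ hC hCW hζC hX
  -- The test function 1.
  have hq0 : ∫ z, q z = 0 := by
    have h1 := hX (fun _ => 1) contDiff_const
    have h2 : ∀ z : Euc (m + 1), gradient (fun _ : Euc (m + 1) => (1 : ℝ)) z = 0 := fun z => by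
      simp [gradient]
    simpa [h2] using h1
  have hbelow := integral_below_graph hφ hZ hZc hqi hX
  have hvol := hP.setIntegral_source (g := g) (y := y) hVs hVm hWV hη hCW hηC
  rw [integral_sides hφ.continuous hWV hP.below hP.above hqi
    (fun z hz => mobiusSource_eq_zero hζC fun h => hz (hCW h)) hq0, hbelow] at hvol
  set σ : ℝ := (if a then 1 else 0) - (if b then 1 else 0) with hσ
  set D : Set (Euc m) := {x | join x (φ x) ∈ W} with hD
  have hγ : Continuous fun x => join x (φ x) :=
    continuous_join.comp (continuous_id.prodMk hφ.continuous)
  have hDm : MeasurableSet D := (hP.isOpen.preimage hγ).measurableSet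
  obtain ⟨K, hlip⟩ := hP.lipschitz
  obtain ⟨harea1, harea2⟩ := param_graph_area (κ := κ) hφ hDm hP.subset_dom (fun x hx => hx) hlip
    fun x => η x • boundaryForm g y V x
  rw [← hP.image_graph] at harea1 harea2
  -- The cancellation of all conformal factors: with `c = paramFactor` and `N` the graph normal, the
  -- area element `c ^ m ‖N‖` and the normalization `(c ‖N‖)⁻¹` of the unit normal leave `c ^ (m -
  -- 1)`, and the flux form carries `c ^ (m + 1) c⁻²`.
  have hpt : ∀ᵐ x, x ∈ D → (paramFactor Q (join x (φ x)) ^ m * ‖graphNormal φ x‖) •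
      (η (param κ Q (join x (φ x))) • boundaryForm g y V (param κ Q (join x (φ x)))) =
      σ • Z (join x (φ x)) (graphNormal φ x) := by
    filter_upwards [hφ.ae_differentiableAt] with x hx hxD
    have hc := (paramFactor_pos (hP.subset_dom hxD)).ne'
    have hN := norm_ne_zero_iff.2 (graphNormal_ne_zero φ x)
    rw [boundaryForm, hP.outwardNormal_eq hxD hx, hZdef, mobiusFlux_eq, ← hσ, unitNormal]
    simp only [map_smul, mul_smul_comm, smul_mul_assoc, smul_smul]
    congr 1
    rw [pow_succ]
    field_simp
  have hZi : Integrable fun x => σ • Z (join x (φ x)) (graphNormal φ x) :=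
    (integrable_apply_graphNormal hφ hZ hZc).smul σ
  have hZ0 : ∀ x, x ∉ D → σ • Z (join x (φ x)) (graphNormal φ x) = 0 := by
    intro x hx
    have h1 : Z (join x (φ x)) = 0 := by
      refine image_eq_zero_of_notMem_tsupport fun h => hx (hCW ?_)
      have h2 : tsupport Z ⊆ C := by
        refine closure_minimal (fun z hz => ?_) hC.isClosed
        by_contra hzC
        refine hz ?_
        have h3 : η (chart κ (Q.map z)) = 0 := by
          refine image_eq_zero_of_notMem_tsupport (f := fun u => η (chart κ u)) fun h => hzC ?_
          obtain ⟨w, hw, hwz⟩ := hζC h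
          rwa [← Function.LeftInverse.injective Q.inv_map hwz]
        rw [hZdef, mobiusFlux, h3, mul_zero, zero_mul, zero_smul]
      exact h2 h
    rw [h1, zero_apply, smul_zero]
  have hSW : MeasurableSet ((closure V \ V) ∩ param κ Q '' W) := by
    have h1 := (measurableEmbedding_domRestrict hP.isOpen.measurableSet
      (fun z hz => (contDiffAt_param (hP.subset_dom hz)).continuousAt.continuousWithinAt)
      (param_injective κ Q).injOn).measurableSet_range
    rw [Set.range_domRestrict] at h1
    exact (isClosed_closure.measurableSet.diff hVm).inter h1
  have hS0 : ∀ x ∈ (closure V \ V) \ ((closure V \ V) ∩ param κ Q '' W),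
      η x • boundaryForm g y V x = 0 := by
    intro x hx
    have h1 : ‖x‖ = 1 := mem_sphere_zero_iff_norm.1
      (closure_minimal hVs isClosed_sphere hx.1.1)
    have h2 : η x = 0 := by
      refine image_eq_zero_of_notMem_tsupport fun h => hx.2 ⟨hx.1, ?_⟩
      exact image_mono hCW (hηC x h h1)
    rw [h2, zero_smul]
  constructor
  · refine IntegrableOn.of_forall_sdiff_eq_zero (harea1.2 ?_)
      (isClosed_closure.measurableSet.diff hVm) hS0
    refine (integrableOn_congr_fun_ae ?_).2 hZi.integrableOn
    exact (ae_restrict_iff' hDm).2 hpt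
  · rw [hvol, ← integral_smul, setIntegral_eq_of_subset_of_forall_sdiff_eq_zero
      (isClosed_closure.measurableSet.diff hVm) inter_subset_left hS0, harea2,
      ← setIntegral_eq_integral_of_forall_compl_eq_zero hZ0]
    exact setIntegral_congr_ae hDm hpt

end IsGraphPatch

end Patch

/-! ### Existence of graph patches, and the local divergence theorem -/

section Local

open Filter

variable {m : ℕ}

/-- The reflection in the hyperplane that bisects two unit vectors exchanges them. It brings a graph
in an arbitrary direction into the standard position. -/
theorem exists_rotation_pole {w : Euc (m + 1)} (hw : ‖w‖ = 1) :
    ∃ B : Euc (m + 1) ≃ₗᵢ[ℝ] Euc (m + 1), B (pole m) = w :=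
  ⟨(ℝ ∙ (pole m - w))ᗮ.reflection, Submodule.reflection_sub (by rw [norm_pole, hw])⟩

theorem kelvin_map {d : ℕ} (B : Euc d ≃ₗᵢ[ℝ] Euc d) (v : Euc d) : kelvin (B v) = B (kelvin v) := by
  rw [kelvin, kelvin, B.norm_map, map_smul]

/-- A Möbius transformation composed with a rotation, in explicit form. -/
theorem exists_mobius_comp_rotation {d : ℕ} {T : Euc d → Euc d} {W : Set (Euc d)}
    (hT : IsMobiusOn T W) (B : Euc d ≃ₗᵢ[ℝ] Euc d) :
    ∃ Q : Mobius d, ∀ z, B z ∈ W → z ∈ Q.dom ∧ Q.map z = T (B z) := by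
  obtain ⟨A, a, b, s, hs, h | ⟨ha, h⟩⟩ := hT
  · refine ⟨⟨B.trans A, B.symm a, b, s, hs, false⟩, fun z hz => ⟨fun h => by simp at h, ?_⟩⟩
    rw [h _ hz]
    simp [Mobius.map, core]
  · refine ⟨⟨B.trans A, B.symm a, b, s, hs, true⟩, fun z hz => ⟨fun _ h' => ha ?_, ?_⟩⟩
    · rw [h', LinearIsometryEquiv.apply_symm_apply] at hz
      exact hz
    · rw [h _ hz]
      simp [Mobius.map, core, ← kelvin_map]

theorem mem_lipGraph_rotation {w : Euc (m + 1)} {φ : Euc (m + 1) → ℝ}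
    {B : Euc (m + 1) ≃ₗᵢ[ℝ] Euc (m + 1)} (hB : B (pole m) = w) (z : Euc (m + 1)) :
    B z ∈ lipGraph w φ ↔ z (Fin.last m) = φ (B (emb (projL m z))) := by
  have h1 : inner ℝ (B z) w = z (Fin.last m) := by
    rw [← hB, B.inner_map_map, inner_pole_right]
  have h2 : B z - z (Fin.last m) • w = B (emb (projL m z)) := by
    rw [← hB, ← map_smul, ← map_sub]
    congr 1
    rw [sub_eq_iff_eq_add, emb_projL_add]
  rw [lipGraph, mem_ofPred_eq, h1, h2]

variable {V : Set (Euc (m + 2))} {κ : Bool} {Q : Mobius (m + 1)}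

/-- Off the boundary the sphere is the union of two disjoint relatively open sets, `V` and the
complement of its closure; a connected set lies in one of them. -/
theorem param_mem_iff_of_isPreconnected (hV : ∃ O, IsOpen O ∧ V = O ∩ sphere 0 1)
    {X : Set (Euc (m + 1))} (hX : IsPreconnected X) (hXd : X ⊆ Q.dom)
    (hXS : ∀ z ∈ X, param κ Q z ∉ closure V \ V) : ∃ a : Prop, ∀ z ∈ X, (param κ Q z ∈ V ↔ a) := by
  obtain ⟨O, hO, hVO⟩ := hV
  have h1 : IsPreconnected (param κ Q '' X) := hX.image _ fun z hz =>
    (contDiffAt_param (hXd hz)).continuousAt.continuousWithinAt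
  by_cases h : ∃ z ∈ X, param κ Q z ∈ V
  · refine ⟨True, fun z hz => iff_true_intro ?_⟩
    by_contra hzV
    obtain ⟨z', hz', hzV'⟩ := h
    obtain ⟨_, ⟨w, hw, rfl⟩, h2, h3⟩ := h1 O (closure V)ᶜ hO isClosed_closure.isOpen_compl
      (by
        rintro _ ⟨w, hw, rfl⟩
        by_cases hwV : param κ Q w ∈ V
        · rw [hVO] at hwV; exact Or.inl hwV.1
        · exact Or.inr fun h4 => hXS w hw ⟨h4, hwV⟩)
      ⟨_, ⟨z', hz', rfl⟩, by rw [hVO] at hzV'; exact hzV'.1⟩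
      ⟨_, ⟨z, hz, rfl⟩, fun h4 => hXS z hz ⟨h4, hzV⟩⟩
    refine h3 (subset_closure ?_)
    rw [hVO]
    exact ⟨h2, by rw [mem_sphere_zero_iff_norm, norm_param]⟩
  · push Not at h
    exact ⟨False, fun z hz => iff_false_intro (h z hz)⟩

/-- The part of `ℝᵐ⁺¹` over a ball with height over the graph of `φ` in an interval. -/
theorem image_join_add (φ : Euc m → ℝ) (D : Set (Euc m)) (I : Set ℝ) :
    (fun p : Euc m × ℝ => join p.1 (φ p.1 + p.2)) '' (D ×ˢ I) =
      {z | projL m z ∈ D ∧ z (Fin.last m) - φ (projL m z) ∈ I} := by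
  ext z
  constructor
  · rintro ⟨⟨x, t⟩, ⟨hx, ht⟩, rfl⟩
    refine ⟨?_, ?_⟩
    · simpa using hx
    · simpa using ht
  · rintro ⟨h1, h2⟩
    refine ⟨(projL m z, z (Fin.last m) - φ (projL m z)), ⟨h1, h2⟩, ?_⟩
    simp only
    rw [add_sub_cancel, join_projL]

/-- Near each of its points, a strongly Lipschitz boundary is a graph in a Möbius parametrization,
with connected sides. -/
theorem exists_isGraphPatch (hV : ∃ O, IsOpen O ∧ V = O ∩ sphere 0 1) {p : Euc (m + 2)}
    {W : Set (Euc (m + 1))} {T : Euc (m + 1) → Euc (m + 1)} {w : Euc (m + 1)}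
    {φ : Euc (m + 1) → ℝ} {L : ℝ≥0} (hW : IsOpen W) (hT : IsMobiusOn T W) (hw : ‖w‖ = 1)
    (hφ : LipschitzWith L φ) (hp : ∃ u ∈ W, chart κ (T u) = p) (hpS : p ∈ closure V \ V)
    (hS : ∀ u ∈ W, chart κ (T u) ∈ closure V \ V ↔ u ∈ lipGraph w φ)
    {P : Euc (m + 2) → Prop} (hP : ∀ᶠ x in 𝓝[sphere 0 1] p, P x) :
    ∃ (Q : Mobius (m + 1)) (ψ : Euc m → ℝ) (Y : Set (Euc (m + 1))) (a b : Prop),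
      LipschitzWith L ψ ∧ IsGraphPatch V κ Q ψ Y a b ∧ (∃ z ∈ Y, param κ Q z = p) ∧
      ∀ z ∈ Y, P (param κ Q z) := by
  obtain ⟨B, hB⟩ := exists_rotation_pole hw
  obtain ⟨Q, hQ⟩ := exists_mobius_comp_rotation hT B
  obtain ⟨u, hu, hup⟩ := hp
  set ψ : Euc m → ℝ := fun x => φ (B (emb x)) with hψ
  have hψL : LipschitzWith L ψ := by
    have h1 := hφ.comp (B.lipschitz.comp (embL m).lipschitz)
    rw [mul_one, mul_one] at h1
    exact h1
  have hgraph : ∀ z, B z ∈ W → (param κ Q z ∈ closure V \ V ↔ z (Fin.last m) = ψ (projL m z)) :=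
    fun z hz => by rw [param, (hQ z hz).2, hS _ hz, mem_lipGraph_rotation hB]
  set z₀ := B.symm u with hz₀
  have hBz₀ : B z₀ = u := B.apply_symm_apply u
  have hz₀W : B z₀ ∈ W := by rwa [hBz₀]
  have hz₀d : z₀ ∈ Q.dom := (hQ z₀ hz₀W).1
  have hz₀p : param κ Q z₀ = p := by rw [param, (hQ z₀ hz₀W).2, hBz₀, hup]
  obtain ⟨K, t, ht, hlip⟩ := (contDiffAt_param (κ := κ) hz₀d).exists_lipschitzOnWith
  have htend : Tendsto (param κ Q) (𝓝 z₀) (𝓝[sphere 0 1] p) := by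
    refine tendsto_nhdsWithin_iff.2 ⟨?_, Eventually.of_forall fun z => ?_⟩
    · rw [← hz₀p]
      exact (contDiffAt_param hz₀d).continuousAt
    · rw [mem_sphere_zero_iff_norm, norm_param]
  have hnear : ∀ᶠ z in 𝓝 z₀, B z ∈ W ∧ z ∈ t ∧ P (param κ Q z) :=
    (B.continuous.continuousAt.eventually (hW.mem_nhds hz₀W)).and
      ((eventually_mem_set.2 ht).and (htend.eventually hP))
  set x₀ := projL m z₀ with hx₀
  have hx₀φ : z₀ (Fin.last m) = ψ x₀ := (hgraph z₀ hz₀W).1 (by rwa [hz₀p])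
  have hJ : Continuous fun p : Euc m × ℝ => join p.1 (ψ p.1 + p.2) :=
    continuous_join.comp (continuous_fst.prodMk
      ((hψL.continuous.comp continuous_fst).add continuous_snd))
  have hJ0 : join x₀ (ψ x₀ + 0) = z₀ := by rw [add_zero, ← hx₀φ, join_projL]
  have hnear' : ∀ᶠ p : Euc m × ℝ in 𝓝 (x₀, 0), B (join p.1 (ψ p.1 + p.2)) ∈ W ∧
      join p.1 (ψ p.1 + p.2) ∈ t ∧ P (param κ Q (join p.1 (ψ p.1 + p.2))) := by
    have h1 := hJ.tendsto (x₀, (0 : ℝ))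
    simp only [hJ0] at h1
    exact h1.eventually hnear
  obtain ⟨δ, hδ, hball⟩ := Metric.eventually_nhds_iff_ball.1 hnear'
  -- A box in the coordinates sheared along the graph. Each side is then the image of a ball times
  -- an interval, hence connected, so it lies entirely in `V` or entirely outside.
  set Y : Set (Euc (m + 1)) :=
    {z | projL m z ∈ ball x₀ δ ∧ z (Fin.last m) - ψ (projL m z) ∈ ball (0 : ℝ) δ} with hY
  have hYall : ∀ z ∈ Y, B z ∈ W ∧ z ∈ t ∧ P (param κ Q z) := by
    intro z hz
    have h1 := hball (projL m z, z (Fin.last m) - ψ (projL m z)) (by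
      rw [← ball_prod_same]; exact ⟨hz.1, hz.2⟩)
    simpa only [add_sub_cancel, join_projL] using h1
  have hside : ∀ I : Set ℝ, IsPreconnected I → I ⊆ ball (0 : ℝ) δ → 0 ∉ I →
      ∃ a : Prop, ∀ z, projL m z ∈ ball x₀ δ → z (Fin.last m) - ψ (projL m z) ∈ I →
        (param κ Q z ∈ V ↔ a) := by
    intro I hI hIδ hI0
    have h1 : IsPreconnected {z | projL m z ∈ ball x₀ δ ∧ z (Fin.last m) - ψ (projL m z) ∈ I} := by
      rw [← image_join_add]
      exact ((convex_ball x₀ δ).isPreconnected.prod hI).image _ hJ.continuousOn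
    obtain ⟨a, ha⟩ := param_mem_iff_of_isPreconnected (κ := κ) hV h1
      (fun z hz => (hQ z (hYall z ⟨hz.1, hIδ hz.2⟩).1).1) fun z hz hzS => by
        rw [hgraph z (hYall z ⟨hz.1, hIδ hz.2⟩).1, ← sub_eq_zero] at hzS
        exact hI0 (hzS ▸ hz.2)
    exact ⟨a, fun z h2 h3 => ha z ⟨h2, h3⟩⟩
  obtain ⟨a, ha⟩ := hside (Ioo (-δ) 0) isPreconnected_Ioo
    (fun s hs => by rw [Real.ball_zero_eq_Ioo]; exact ⟨hs.1, hs.2.trans hδ⟩) (by simp)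
  obtain ⟨b, hb⟩ := hside (Ioo 0 δ) isPreconnected_Ioo
    (fun s hs => by rw [Real.ball_zero_eq_Ioo]; exact ⟨by linarith [hs.1], hs.2⟩) (by simp)
  have hYopen : IsOpen Y :=
    (isOpen_ball.preimage (projL m).continuous).inter
      (isOpen_ball.preimage (continuous_last.sub (hψL.continuous.comp (projL m).continuous)))
  refine ⟨Q, ψ, Y, a, b, hψL, ⟨hYopen, fun z hz => (hQ z (hYall z hz).1).1,
    ⟨K, hlip.mono fun z hz => (hYall z hz).2.1⟩, fun z hz h => ?_, fun z hz h => ?_,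
    fun z hz => hgraph z (hYall z hz).1⟩, ⟨z₀, ⟨?_, ?_⟩, hz₀p⟩, fun z hz => (hYall z hz).2.2⟩
  · have h1 := hz.2
    rw [Real.ball_zero_eq_Ioo] at h1
    exact ha z hz.1 ⟨h1.1, by linarith⟩
  · have h1 := hz.2
    rw [Real.ball_zero_eq_Ioo] at h1
    exact hb z hz.1 ⟨by linarith, h1.2⟩
  · exact mem_ball_self hδ
  · rw [hx₀φ, sub_self]
    exact mem_ball_self hδ

/-- A compact set of parameters covers a ball of the sphere. -/
theorem exists_compact_param {z : Euc (m + 1)} {W : Set (Euc (m + 1))} (hW : IsOpen W)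
    (hWd : W ⊆ Q.dom) (hz : z ∈ W) : ∃ C ⊆ W, IsCompact C ∧ ∃ ρ > 0,
      ∀ x ∈ ball (param κ Q z) ρ, ‖x‖ = 1 → x ∈ param κ Q '' C := by
  obtain ⟨r, hr, hrW⟩ := nhds_basis_closedBall.mem_iff.1 (hW.mem_nhds hz)
  refine ⟨closedBall z r, hrW, isCompact_closedBall z r, ?_⟩
  have h1 := ((tendsto_paramInv (κ := κ) (hWd hz)).eventually (closedBall_mem_nhds z hr)).and
    (eventually_param_paramInv z)
  obtain ⟨ρ, hρ, h2⟩ := Metric.mem_nhdsWithin_iff.1 h1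
  refine ⟨ρ, hρ, fun x hx hx1 => ?_⟩
  obtain ⟨h3, h4⟩ := h2 ⟨hx, mem_sphere_zero_iff_norm.2 hx1⟩
  exact ⟨_, h3, h4⟩

/-- The identity as a Möbius transformation. -/
def Mobius.refl (d : ℕ) : Mobius d := ⟨LinearIsometryEquiv.refl ℝ _, 0, 0, 1, one_pos, false⟩

theorem Mobius.refl_map {d : ℕ} (z : Euc d) : (Mobius.refl d).map z = z := by
  simp [Mobius.refl, Mobius.map, core]

theorem Mobius.refl_dom (d : ℕ) : (Mobius.refl d).dom = univ := by
  simp [Mobius.refl, Mobius.dom]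

theorem param_refl (z : Euc (m + 1)) : param κ (Mobius.refl (m + 1)) z = chart κ z := by
  rw [param, Mobius.refl_map]

/-- A compact set of chart coordinates covers a ball of the sphere. -/
theorem exists_compact_chart (κ : Bool) (v : Euc (m + 1)) : ∃ C, IsCompact C ∧ ∃ ρ > 0,
    ∀ x ∈ ball (chart κ v) ρ, ‖x‖ = 1 → x ∈ chart κ '' C := by
  obtain ⟨C, -, hC, ρ, hρ, h⟩ := exists_compact_param (κ := κ) (Q := Mobius.refl (m + 1)) isOpen_univ
    (by rw [Mobius.refl_dom]) (mem_univ v)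
  have h1 : param κ (Mobius.refl (m + 1)) = chart κ := funext param_refl
  rw [h1] at h
  exact ⟨C, hC, ρ, hρ, h⟩

variable {g : Euc (m + 2) → Cl (m + 2)} {y : Euc (m + 2)} {η : Euc (m + 2) → ℝ}

/-- The volume integral of a field supported inside `V` and in one chart. -/
theorem setIntegral_source_chart (hVm : MeasurableSet V) (hη : ContDiff ℝ 1 η)
    (hηV : ∀ x ∈ tsupport η, ‖x‖ = 1 → x ∈ V ∧ x ∈ range (chart κ)) (hVs : V ⊆ sphere 0 1) :
    ∫ x in V, sourceForm g y η x ∂(Measure.euclideanHausdorffMeasure (m + 1)) =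
      ∫ u, kern κ y u * vec (emb (gradient (fun u => η (chart κ u)) u)) * localRep g κ u := by
  have hA : MeasurableSet (chart κ ⁻¹' V) := (continuous_chart κ).measurable hVm
  have h0 : ∀ u, u ∉ chart κ ⁻¹' V →
      kern κ y u * vec (emb (gradient (fun u => η (chart κ u)) u)) * localRep g κ u = 0 := by
    intro u hu
    rw [gradient_eq_zero_of_notMem_tsupport]
    · simp
    · exact fun h => hu (hηV _ (tsupport_comp_subset_preimage η (continuous_chart κ) h)
        (norm_chart κ u)).1
  rw [← setIntegral_eq_integral_of_forall_compl_eq_zero h0,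
    setIntegral_eq_of_subset_of_forall_sdiff_eq_zero hVm (image_preimage_subset (chart κ) V),
    integral_chart_image κ hA]
  · exact setIntegral_congr_fun hA fun u _ =>
      conf_smul_sourceForm κ u g y (hη.differentiable one_ne_zero _)
  · intro x hx
    refine sourceForm_eq_zero fun h => hx.2 ?_
    obtain ⟨u, rfl⟩ := (hηV x h (mem_sphere_zero_iff_norm.1 (hVs hx.1))).2
    exact ⟨u, hx.1, rfl⟩

end Local

/-! ### The Cauchy formula on the sphere -/

section SphereFormula

open Filter

variable {m : ℕ}

/-- `V ⊆ U` are relatively open subsets of the sphere, `g` is Clifford holomorphic on `U`, and the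
boundary of `V` is a strongly Lipschitz hypersurface in `U`. -/
structure IsCauchyDomain (U V : Set (Euc (m + 2))) (g : Euc (m + 2) → Cl (m + 2)) : Prop where
  isOpen : ∃ O, IsOpen O ∧ V = O ∩ sphere 0 1
  isOpen_outer : ∃ O, IsOpen O ∧ U = O ∩ sphere 0 1
  closure_subset : closure V ⊆ U
  monogenic : ∀ κ u, chart κ u ∈ U → IsLeftMonogenicAt (localRep g κ) u
  lipschitz : ∀ p ∈ closure V \ V, ∃ (κ : Bool) (W : Set (Euc (m + 1)))
    (T : Euc (m + 1) → Euc (m + 1)) (w : Euc (m + 1)) (φ : Euc (m + 1) → ℝ) (L : ℝ≥0),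
    IsOpen W ∧ IsMobiusOn T W ∧ ‖w‖ = 1 ∧ LipschitzWith L φ ∧ (∃ u ∈ W, chart κ (T u) = p) ∧
    ∀ u ∈ W, chart κ (T u) ∈ closure V \ V ↔ u ∈ lipGraph w φ

/-- The sphere is covered by two Lipschitz images of the unit ball. -/
theorem euclideanHausdorffMeasure_sphere_lt_top :
    Measure.euclideanHausdorffMeasure (m + 1) (sphere (0 : Euc (m + 2)) 1) < ⊤ := by
  have h1 : sphere (0 : Euc (m + 2)) 1 ⊆ ⋃ κ : Bool, chart κ '' closedBall (0 : Euc (m + 1)) 1 := by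
    intro x hx
    obtain ⟨κ, u, hu, rfl⟩ := exists_chart_eq (mem_sphere_zero_iff_norm.1 hx)
    exact mem_iUnion.2 ⟨κ, u, by rwa [mem_closedBall_zero_iff], rfl⟩
  refine (measure_mono h1).trans_lt ((measure_iUnion_le _).trans_lt ?_)
  rw [tsum_fintype]
  refine ENNReal.sum_lt_top.2 fun κ _ => ?_
  have h2 : LipschitzWith 2 (chart κ : Euc (m + 1) → Euc (m + 2)) := by
    refine lipschitzWith_of_nnnorm_fderiv_le (𝕜 := ℝ)
      (fun u => (hasFDerivAt_chart κ u).differentiableAt) fun u => ?_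
    rw [(hasFDerivAt_chart κ u).fderiv, ← NNReal.coe_le_coe]
    refine ContinuousLinearMap.opNorm_le_bound _ (by norm_num) fun v => ?_
    rw [norm_chartDeriv]
    refine mul_le_mul_of_nonneg_right ?_ (norm_nonneg v)
    rw [confFactor, norm_den_sq, NNReal.coe_ofNat]
    exact div_le_self (by norm_num) (by nlinarith [sq_nonneg ‖u‖])
  have h3 := euclideanHausdorffMeasure_image_le_of_lipschitz (f := chart κ)
    (g := fun u : Euc (m + 1) => u) (s := closedBall 0 1) (K := 2) (m + 1)
    fun x _ y _ => h2.dist_le_mul x y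
  refine h3.trans_lt (ENNReal.mul_lt_top (by finiteness) ?_)
  have h4 := InnerProductSpace.euclideanHausdorffMeasure_eq_volume (V := Euc (m + 1))
  rw [finrank_euclideanSpace_fin] at h4
  rw [image_id', h4]
  exact measure_closedBall_lt_top

variable {U V : Set (Euc (m + 2))} {g : Euc (m + 2) → Cl (m + 2)} {y : Euc (m + 2)}
  {η : Euc (m + 2) → ℝ}

namespace IsCauchyDomain

theorem subset_sphere (h : IsCauchyDomain U V g) : V ⊆ sphere 0 1 := by
  obtain ⟨O, -, rfl⟩ := h.isOpen
  exact inter_subset_right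

theorem closure_subset_sphere (h : IsCauchyDomain U V g) : closure V ⊆ sphere 0 1 :=
  closure_minimal h.subset_sphere isClosed_sphere

theorem isCompact_closure (h : IsCauchyDomain U V g) : IsCompact (closure V) :=
  (isCompact_sphere _ _).of_isClosed_subset isClosed_closure h.closure_subset_sphere

theorem measurableSet (h : IsCauchyDomain U V g) : MeasurableSet V := by
  obtain ⟨O, hO, rfl⟩ := h.isOpen
  exact hO.measurableSet.inter isClosed_sphere.measurableSet

theorem isCompact_boundary (h : IsCauchyDomain U V g) : IsCompact (closure V \ V) := by
  obtain ⟨O, hO, hV⟩ := h.isOpen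
  have h1 : closure V \ V = closure V ∩ Oᶜ := by
    ext x
    constructor
    · rintro ⟨hx, hxV⟩
      exact ⟨hx, fun hxO => hxV (by rw [hV]; exact ⟨hxO, h.closure_subset_sphere hx⟩)⟩
    · rintro ⟨hx, hxO⟩
      exact ⟨hx, fun hxV => hxO (by rw [hV] at hxV; exact hxV.1)⟩
  rw [h1]
  exact h.isCompact_closure.inter_right hO.isClosed_compl

theorem exists_ball_subset (h : IsCauchyDomain U V g) {p : Euc (m + 2)} (hp : p ∈ V) :
    ∃ ρ > 0, ∀ x ∈ ball p ρ, ‖x‖ = 1 → x ∈ V := by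
  obtain ⟨O, hO, hV⟩ := h.isOpen
  rw [hV] at hp
  obtain ⟨ρ, hρ, h1⟩ := Metric.isOpen_iff.1 hO p hp.1
  refine ⟨ρ, hρ, fun x hx hx1 => ?_⟩
  rw [hV]
  exact ⟨h1 hx, mem_sphere_zero_iff_norm.2 hx1⟩

theorem eventually_mem (h : IsCauchyDomain U V g) {p : Euc (m + 2)} (hp : p ∈ U) :
    ∀ᶠ x in 𝓝[sphere 0 1] p, x ∈ U := by
  obtain ⟨O, hO, hU⟩ := h.isOpen_outer
  rw [hU] at hp ⊢
  filter_upwards [mem_nhdsWithin_of_mem_nhds (hO.mem_nhds hp.1), self_mem_nhdsWithin] with x h1 h2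
  exact ⟨h1, h2⟩

theorem norm_eq_one (h : IsCauchyDomain U V g) (hy : y ∈ V) : ‖y‖ = 1 :=
  mem_sphere_zero_iff_norm.1 (h.subset_sphere hy)

/-- The local divergence theorem at a boundary point. -/
theorem exists_ball_boundary (h : IsCauchyDomain U V g) (hy : y ∈ V) {p : Euc (m + 2)}
    (hp : p ∈ closure V \ V) : ∃ ρ > 0, ∀ η : Euc (m + 2) → ℝ, ContDiff ℝ 1 η →
      tsupport η ⊆ ball p ρ →
      IntegrableOn (fun x => η x • boundaryForm g y V x) (closure V \ V)
        (Measure.euclideanHausdorffMeasure m) ∧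
      ∫ x in closure V \ V, η x • boundaryForm g y V x ∂(Measure.euclideanHausdorffMeasure m) =
        ∫ x in V, sourceForm g y η x ∂(Measure.euclideanHausdorffMeasure (m + 1)) := by
  obtain ⟨κ, W, T, w, φ, L, hW, hT, hw, hφ, hpW, hS⟩ := h.lipschitz p hp
  have hne : p ≠ y := fun h' => hp.2 (h' ▸ hy)
  have hP : ∀ᶠ x in 𝓝[sphere 0 1] p, x ∈ U ∧ x ≠ y :=
    (h.eventually_mem (h.closure_subset hp.1)).and (nhdsWithin_le_nhds (isOpen_ne.mem_nhds hne))
  obtain ⟨Q, ψ, Y, a, b, hψ, hpatch, ⟨z, hz, rfl⟩, hYP⟩ :=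
    exists_isGraphPatch h.isOpen hW hT hw hφ hpW hp hS hP
  obtain ⟨C, hCY, hC, ρ, hρ, hball⟩ :=
    exists_compact_param (κ := κ) hpatch.isOpen hpatch.subset_dom hz
  refine ⟨ρ, hρ, fun η hη hηs => ?_⟩
  refine hpatch.setIntegral_boundary hψ h.subset_sphere h.measurableSet ?_ (h.norm_eq_one hy)
    (fun z hz => (hYP z hz).2) (fun z hz => h.monogenic κ _ (hYP z hz).1) hη hC hCY
    fun x hx hx1 => hball x (hηs hx) hx1
  obtain ⟨O, hO, hV⟩ := h.isOpen
  have h1 : {z | z ∈ Y ∧ param κ Q z ∈ V} = Y ∩ param κ Q ⁻¹' O := by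
    ext z
    refine and_congr_right fun _ => ?_
    rw [hV]
    exact ⟨fun h => h.1, fun h => ⟨h, by rw [mem_sphere_zero_iff_norm, norm_param]⟩⟩
  rw [h1]
  exact (ContinuousOn.isOpen_inter_preimage (fun z hz =>
    (contDiffAt_param (hpatch.subset_dom hz)).continuousAt.continuousWithinAt)
    hpatch.isOpen hO).measurableSet

/-- A field supported near a point of `V`, away from the pole. -/
theorem exists_ball_interior (h : IsCauchyDomain U V g) (hy : y ∈ V) {p : Euc (m + 2)}
    (hp : p ∈ V) : ∃ ρ > 0, ∀ η : Euc (m + 2) → ℝ, ContDiff ℝ 1 η →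
      tsupport η ⊆ ball p ρ → y ∉ tsupport η → (∀ x ∈ closure V \ V, η x = 0) ∧
        ∫ x in V, sourceForm g y η x ∂(Measure.euclideanHausdorffMeasure (m + 1)) = 0 := by
  obtain ⟨ρ₁, hρ₁, h1⟩ := h.exists_ball_subset hp
  obtain ⟨κ, v, -, rfl⟩ := exists_chart_eq (h.norm_eq_one hp)
  obtain ⟨C, hC, ρ₂, hρ₂, h2⟩ := exists_compact_chart κ v
  refine ⟨min ρ₁ ρ₂, lt_min hρ₁ hρ₂, fun η hη hηs hyη => ⟨fun x hx => ?_, ?_⟩⟩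
  · refine image_eq_zero_of_notMem_tsupport fun hxη => hx.2 (h1 x ?_ ?_)
    · exact ball_subset_ball (min_le_left _ _) (hηs hxη)
    · exact mem_sphere_zero_iff_norm.1 (h.closure_subset_sphere hx.1)
  · have hmem : ∀ x ∈ tsupport η, ‖x‖ = 1 → x ∈ V ∧ x ∈ chart κ '' C := fun x hx hx1 =>
      ⟨h1 x (ball_subset_ball (min_le_left _ _) (hηs hx)) hx1,
        h2 x (ball_subset_ball (min_le_right _ _) (hηs hx)) hx1⟩
    have hsup : ∀ u ∈ tsupport (fun u => η (chart κ u)), chart κ u ∈ tsupport η := fun u hu =>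
      tsupport_comp_subset_preimage η (continuous_chart κ) hu
    rw [setIntegral_source_chart h.measurableSet hη
      (fun x hx hx1 => ⟨(hmem x hx hx1).1, image_subset_range _ _ (hmem x hx hx1).2⟩)
      h.subset_sphere]
    refine integral_kernel_gradient_eq_zero (hη.comp (contDiff_chart κ))
      (hC.of_isClosed_subset (isClosed_tsupport _) fun u hu => ?_) (fun u hu => ?_) fun u hu => ?_
    · obtain ⟨c, hc, hcu⟩ := (hmem _ (hsup u hu) (norm_chart κ u)).2
      rwa [← chart_injective κ hcu]
    · exact kern_monogenic (h.norm_eq_one hy) fun hu' => hyη (hu' ▸ hsup u hu)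
    · exact h.monogenic κ u (h.closure_subset
        (subset_closure (hmem _ (hsup u hu) (norm_chart κ u)).1))

/-- A cutoff function near the pole, and the residue. -/
theorem exists_pole_cutoff (h : IsCauchyDomain U V g) (hy : y ∈ V) :
    ∃ b : Euc (m + 2) → ℝ, ContDiff ℝ 1 b ∧ (∀ᶠ x in 𝓝 y, b x = 1) ∧
      (∀ x ∈ closure V \ V, b x = 0) ∧
      ∫ x in V, sourceForm g y b x ∂(Measure.euclideanHausdorffMeasure (m + 1)) =
        sphereArea (m + 1) • g y := by
  obtain ⟨ρ₁, hρ₁, h1⟩ := h.exists_ball_subset hy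
  obtain ⟨κ, v, -, rfl⟩ := exists_chart_eq (h.norm_eq_one hy)
  obtain ⟨C, hC, ρ₂, hρ₂, h2⟩ := exists_compact_chart κ v
  set ρ := min ρ₁ ρ₂ / 2 with hρ
  have hmin : 0 < min ρ₁ ρ₂ := lt_min hρ₁ hρ₂
  have hρ0 : 0 < ρ := half_pos hmin
  set b := ballCutoff (chart κ v) ρ with hb
  have hbs : tsupport b ⊆ ball (chart κ v) (min ρ₁ ρ₂) :=
    (tsupport_ballCutoff hρ0).trans (closedBall_subset_ball (half_lt_self hmin))
  have hb1 : ∀ᶠ x in 𝓝 (chart κ v), b x = 1 := by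
    filter_upwards [closedBall_mem_nhds (chart κ v) (half_pos hρ0)] with x hx
    exact ballCutoff_of_le hρ0 (by rwa [← dist_eq_norm])
  have hmem : ∀ x ∈ tsupport b, ‖x‖ = 1 → x ∈ V ∧ x ∈ chart κ '' C := fun x hx hx1 =>
    ⟨h1 x (ball_subset_ball (min_le_left _ _) (hbs hx)) hx1,
      h2 x (ball_subset_ball (min_le_right _ _) (hbs hx)) hx1⟩
  have hsup : ∀ u ∈ tsupport (fun u => b (chart κ u)), chart κ u ∈ tsupport b := fun u hu =>
    tsupport_comp_subset_preimage b (continuous_chart κ) hu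
  refine ⟨b, contDiff_ballCutoff _ _, hb1, fun x hx => ?_, ?_⟩
  · refine image_eq_zero_of_notMem_tsupport fun hxη => hx.2 (h1 x ?_ ?_)
    · exact ball_subset_ball (min_le_left _ _) (hbs hxη)
    · exact mem_sphere_zero_iff_norm.1 (h.closure_subset_sphere hx.1)
  · rw [setIntegral_source_chart h.measurableSet (contDiff_ballCutoff _ _)
      (fun x hx hx1 => ⟨(hmem x hx hx1).1, image_subset_range _ _ (hmem x hx hx1).2⟩)
      h.subset_sphere, integral_kern_pole κ v
      (ζ := fun u => ballCutoff (chart κ v) ρ (chart κ u))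
      ((contDiff_ballCutoff _ _).comp (contDiff_chart κ))]
    · rw [localRep, unweight_mul_weight]
    · refine hC.of_isClosed_subset (isClosed_tsupport _) fun u hu => ?_
      obtain ⟨c, hc, hcu⟩ := (hmem _ (hsup u hu) (norm_chart κ u)).2
      rwa [← chart_injective κ hcu]
    · exact (continuous_chart κ).continuousAt.eventually hb1
    · exact fun u hu => h.monogenic κ u (h.closure_subset
        (subset_closure (hmem _ (hsup u hu) (norm_chart κ u)).1))

/-- The boundary is compact, and near each of its points the form coincides with a cut-off one, for
which the local divergence theorem already includes integrability. -/
theorem integrableOn_boundaryForm (h : IsCauchyDomain U V g) (hy : y ∈ V) :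
    IntegrableOn (boundaryForm g y V) (closure V \ V) (Measure.euclideanHausdorffMeasure m) := by
  refine LocallyIntegrableOn.integrableOn_isCompact (fun p hp => ?_) h.isCompact_boundary
  obtain ⟨ρ, hρ, h1⟩ := h.exists_ball_boundary hy hp
  obtain ⟨h2, -⟩ := h1 (ballCutoff p (ρ / 2)) (contDiff_ballCutoff _ _)
    ((tsupport_ballCutoff (half_pos hρ)).trans (closedBall_subset_ball (half_lt_self hρ)))
  have hρ4 : 0 < ρ / 2 / 2 := half_pos (half_pos hρ)
  refine ⟨(closure V \ V) ∩ closedBall p (ρ / 2 / 2),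
    inter_mem_nhdsWithin _ (closedBall_mem_nhds p hρ4), ?_⟩
  refine (h2.mono_set inter_subset_left).congr_fun (fun x hx => ?_)
    (h.isCompact_boundary.isClosed.measurableSet.inter isClosed_closedBall.measurableSet)
  simp only
  rw [ballCutoff_of_le (half_pos hρ) (by rw [← dist_eq_norm]; exact hx.2), one_smul]

/-- The section is recovered from its differentiable chart representative by removing the spinor
weight. -/
theorem continuousWithinAt_section (h : IsCauchyDomain U V g) {x : Euc (m + 2)} (hx : x ∈ U) :
    ContinuousWithinAt g (sphere 0 1) x := by
  have hx1 : ‖x‖ = 1 := by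
    obtain ⟨O, -, hU⟩ := h.isOpen_outer
    rw [hU] at hx
    exact mem_sphere_zero_iff_norm.1 hx.2
  obtain ⟨κ, u, -, rfl⟩ := exists_chart_eq hx1
  have hinv := continuousAt_chartInv hx1 (flip_chart_ne_pole κ u)
  have h1 : ContinuousAt (fun u => unweight κ u * localRep g κ u) u := by
    refine ContinuousAt.mul ?_ (h.monogenic κ u hx).1.continuousAt
    have hden : Continuous fun u : Euc (m + 1) => den u := continuous_emb.add continuous_const
    have h2 : Continuous fun u : Euc (m + 1) => ‖den u‖ ^ (m + 1) / ‖den u‖ ^ 2 :=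
      (hden.norm.pow _).div (hden.norm.pow 2) fun u => (pow_pos (norm_den_pos u) 2).ne'
    exact ((continuous_const.mul h2).neg.smul
      (continuous_const.mul (continuous_vec.comp hden))).continuousAt
  have h3 : ContinuousAt (fun x => unweight κ (chartInv κ x) * localRep g κ (chartInv κ x))
      (chart κ u) := ContinuousAt.comp (g := fun u => unweight κ u * localRep g κ u)
        (by rw [chartInv_chart]; exact h1) hinv
  refine h3.continuousWithinAt.congr_of_eventuallyEq_of_mem ?_ (mem_sphere_zero_iff_norm.2 hx1)
  have h4 : ∀ᶠ p in 𝓝 (chart κ u), flip (m + 1) κ p ≠ pole (m + 1) :=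
    (flip (m + 1) κ).continuous.continuousAt.eventually_ne (flip_chart_ne_pole κ u)
  filter_upwards [nhdsWithin_le_nhds h4, self_mem_nhdsWithin] with p hp hp1
  rw [localRep, unweight_mul_weight, chart_chartInv (mem_sphere_zero_iff_norm.1 hp1) hp]

/-- With the pole away from the support of the gradient, the form is continuous on the compact
closure of `V`, hence bounded, and the sphere has finite measure. -/
theorem integrableOn_sourceForm (h : IsCauchyDomain U V g) (hη : ContDiff ℝ 1 η)
    (hyη : y ∉ tsupport (sgrad η)) :
    IntegrableOn (sourceForm g y η) V (Measure.euclideanHausdorffMeasure (m + 1)) := by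
  have hgrad : Continuous (sgrad η) := by
    have h1 : Continuous fun x : Euc (m + 2) => (inner ℝ x (gradient η x) : ℝ) :=
      continuous_id.inner (continuous_gradient hη)
    have h2 : Continuous fun x : Euc (m + 2) => (inner ℝ x (gradient η x) : ℝ) • x :=
      h1.smul continuous_id
    exact (continuous_gradient hη).sub h2
  have h1 : Continuous fun x => cauchyG (m + 1) (x - y) * vec (sgrad η x) := by
    refine continuous_iff_continuousAt.2 fun x => ?_
    by_cases hx : x ∈ tsupport (sgrad η)
    · have hxy : x - y ≠ 0 := sub_ne_zero.2 fun h' => hyη (h' ▸ hx)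
      have h2 : ContinuousAt (fun x => cauchyG (m + 1) (x - y)) x := by
        have h3 : Continuous fun x : Euc (m + 2) => x - y := continuous_id.sub continuous_const
        exact ((h3.norm.pow _).continuousAt.inv₀ (pow_ne_zero _ (norm_ne_zero_iff.2 hxy))).smul
          (continuous_vec.comp h3).continuousAt
      exact h2.mul (continuous_vec.comp hgrad).continuousAt
    · refine continuousAt_const.congr (f := fun _ => (0 : Cl (m + 2))) ?_
      filter_upwards [(isClosed_tsupport _).isOpen_compl.mem_nhds hx] with w hw
      rw [image_eq_zero_of_notMem_tsupport hw, map_zero, mul_zero]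
  have h2 : ContinuousOn (sourceForm g y η) (closure V) := fun x hx =>
    h1.continuousWithinAt.mul
      ((h.continuousWithinAt_section (h.closure_subset hx)).mono h.closure_subset_sphere)
  obtain ⟨c, hc⟩ := h.isCompact_closure.exists_bound_of_continuousOn h2
  refine Integrable.mono' (g := fun _ => c) (integrableOn_const ?_)
    ((h2.mono subset_closure).aestronglyMeasurable h.measurableSet)
    ((ae_restrict_iff' h.measurableSet).2 (Eventually.of_forall fun x hx => hc x (subset_closure hx)))
  exact ((measure_mono h.subset_sphere).trans_lt euclideanHausdorffMeasure_sphere_lt_top).ne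

end IsCauchyDomain

theorem notMem_tsupport_sgrad {c : ℝ} (h : ∀ᶠ x in 𝓝 y, η x = c) : y ∉ tsupport (sgrad η) := by
  have h1 := notMem_tsupport_gradient h
  rw [notMem_tsupport_iff_eventuallyEq] at h1 ⊢
  filter_upwards [h1] with x hx
  rw [sgrad, hx]
  simp

theorem gradient_sub {n : ℕ} {f₁ f₂ : Euc n → ℝ} {x : Euc n} (h₁ : DifferentiableAt ℝ f₁ x)
    (h₂ : DifferentiableAt ℝ f₂ x) :
    gradient (fun x => f₁ x - f₂ x) x = gradient f₁ x - gradient f₂ x := by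
  simp only [gradient]
  rw [← map_sub]
  congr 1
  exact (h₁.hasFDerivAt.sub h₂.hasFDerivAt).fderiv

theorem sourceForm_sub {η₁ η₂ : Euc (m + 2) → ℝ} (h₁ : ContDiff ℝ 1 η₁) (h₂ : ContDiff ℝ 1 η₂)
    (x : Euc (m + 2)) : sourceForm g y (fun x => η₁ x - η₂ x) x =
      sourceForm g y η₁ x - sourceForm g y η₂ x := by
  have h3 : sgrad (fun x => η₁ x - η₂ x) x = sgrad η₁ x - sgrad η₂ x := by
    simp only [sgrad]
    rw [gradient_sub (h₁.differentiable one_ne_zero x) (h₂.differentiable one_ne_zero x),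
      inner_sub_right]
    module
  rw [sourceForm, h3, map_sub, mul_sub, sub_mul]
  rfl

theorem sourceForm_const (c : ℝ) (x : Euc (m + 2)) : sourceForm g y (fun _ => c) x = 0 := by
  have h : sgrad (fun _ : Euc (m + 2) => c) x = 0 := by simp [sgrad, gradient]
  rw [sourceForm, h]
  simp

/-- The Cauchy formula on the sphere. -/
theorem IsCauchyDomain.cauchy_formula (h : IsCauchyDomain U V g) (hy : y ∈ V) :
    ∫ x in closure V \ V, boundaryForm g y V x ∂(Measure.euclideanHausdorffMeasure m) =
      -(sphereArea (m + 1) • g y) := by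
  obtain ⟨b, hb, hb1, hbS, hbV⟩ := h.exists_pole_cutoff hy
  -- Test functions supported near any single point, and away from `y`, satisfy the identity of
  -- boundary and volume integrals.
  have hgood : ∀ p : Euc (m + 2), ∃ ρ > 0, p ∈ closure V → ∀ η : Euc (m + 2) → ℝ,
      ContDiff ℝ 1 η → tsupport η ⊆ ball p ρ → y ∉ tsupport η →
      ∫ x in closure V \ V, η x • boundaryForm g y V x ∂(Measure.euclideanHausdorffMeasure m) =
        ∫ x in V, sourceForm g y η x ∂(Measure.euclideanHausdorffMeasure (m + 1)) := by
    intro p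
    by_cases hp : p ∈ closure V
    · by_cases hpV : p ∈ V
      · obtain ⟨ρ, hρ, h1⟩ := h.exists_ball_interior hy hpV
        refine ⟨ρ, hρ, fun _ η hη hηs hyη => ?_⟩
        obtain ⟨h2, h3⟩ := h1 η hη hηs hyη
        rw [h3]
        exact setIntegral_eq_zero_of_forall_eq_zero fun x hx => by rw [h2 x hx, zero_smul]
      · obtain ⟨ρ, hρ, h1⟩ := h.exists_ball_boundary hy ⟨hp, hpV⟩
        exact ⟨ρ, hρ, fun _ η hη hηs _ => (h1 η hη hηs).2⟩
    · exact ⟨1, one_pos, fun hp' => absurd hp' hp⟩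
  choose ρ hρ hgood using hgood
  have hρ2 : ∀ p, 0 < ρ p / 2 := fun p => half_pos (hρ p)
  let B : Euc (m + 2) → Euc (m + 2) → ℝ := fun p => ballCutoff p (ρ p / 2)
  have hB : ∀ p, ContDiff ℝ 1 (B p) := fun p => contDiff_ballCutoff _ _
  have hBs : ∀ p, tsupport (B p) ⊆ ball p (ρ p) := fun p =>
    (tsupport_ballCutoff (hρ2 p)).trans (closedBall_subset_ball (half_lt_self (hρ p)))
  -- A partition of unity in product form: inserting a point `p` subtracts `P t * B p`, which is
  -- supported near `p`. The factor `1 - b` makes every such term vanish near `y`.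
  let P : Finset (Euc (m + 2)) → Euc (m + 2) → ℝ := fun t x => (1 - b x) * ∏ p ∈ t, (1 - B p x)
  have hPc : ∀ t, ContDiff ℝ 1 (P t) := fun t =>
    (contDiff_const.sub hb).mul (contDiff_prod fun p _ => contDiff_const.sub (hB p))
  have hPy : ∀ t, ∀ᶠ x in 𝓝 y, P t x = 0 := fun t => by
    filter_upwards [hb1] with x hx
    simp only [P, hx, sub_self, zero_mul]
  have hint := h.integrableOn_boundaryForm hy
  have hintS : ∀ η : Euc (m + 2) → ℝ, ContDiff ℝ 1 η →
      IntegrableOn (fun x => η x • boundaryForm g y V x) (closure V \ V)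
        (Measure.euclideanHausdorffMeasure m) := fun η hη =>
    hint.continuousOn_smul hη.continuous.continuousOn h.isCompact_boundary
  -- The defect in the divergence theorem. It is not changed by inserting a point of the closure,
  -- and it is 0 once the cutoffs cover the closure.
  let Λ : (Euc (m + 2) → ℝ) → Cl (m + 2) := fun η =>
    (∫ x in closure V \ V, η x • boundaryForm g y V x ∂(Measure.euclideanHausdorffMeasure m)) -
      ∫ x in V, sourceForm g y η x ∂(Measure.euclideanHausdorffMeasure (m + 1))
  have hΛ : ∀ t : Finset (Euc (m + 2)), (∀ p ∈ t, p ∈ closure V) → Λ (P t) = Λ (P ∅) := by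
    intro t
    induction t using Finset.induction_on with
    | empty => exact fun _ => rfl
    | insert p t hpt ih =>
      intro ht
      rw [← ih fun q hq => ht q (Finset.mem_insert_of_mem hq)]
      let R : Euc (m + 2) → ℝ := fun x => P t x * B p x
      have hR : ContDiff ℝ 1 R := (hPc t).mul (hB p)
      have hRy : ∀ᶠ x in 𝓝 y, R x = 0 := by
        filter_upwards [hPy t] with x hx
        simp only [R, hx, zero_mul]
      have h1 : P (insert p t) = fun x => P t x - R x := by
        funext x
        simp only [P, R, Finset.prod_insert hpt]
        ring
      have h2 := hgood p (ht p (Finset.mem_insert_self p t)) R hR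
        (tsupport_mul_subset_right.trans (hBs p)) (notMem_tsupport_iff_eventuallyEq.2 hRy)
      simp only [Λ]
      rw [h1]
      simp only [sub_smul, sourceForm_sub (hPc t) hR]
      rw [integral_sub (hintS _ (hPc t)) (hintS _ hR), integral_sub
        (h.integrableOn_sourceForm (hPc t) (notMem_tsupport_sgrad (hPy t)))
        (h.integrableOn_sourceForm hR (notMem_tsupport_sgrad hRy)), h2]
      abel
  obtain ⟨t, ht, hcover⟩ := h.isCompact_closure.elim_nhds_subcover
    (fun p => ball p (ρ p / 2 / 2)) fun p _ => ball_mem_nhds p (half_pos (hρ2 p))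
  have hPt : ∀ x ∈ closure V, ∀ᶠ w in 𝓝 x, P t w = 0 := by
    intro x hx
    obtain ⟨p, hp, hxp⟩ := mem_iUnion₂.1 (hcover hx)
    filter_upwards [isOpen_ball.mem_nhds hxp] with w hw
    have h1 : B p w = 1 := ballCutoff_of_le (hρ2 p) (by
      rw [← dist_eq_norm]; exact (mem_ball.1 hw).le)
    simp only [P]
    rw [Finset.prod_eq_zero hp (by rw [h1, sub_self]), mul_zero]
  have h0 : Λ (P t) = 0 := by
    simp only [Λ]
    rw [setIntegral_eq_zero_of_forall_eq_zero fun x hx => by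
        rw [(hPt x hx.1).self_of_nhds, zero_smul],
      setIntegral_eq_zero_of_forall_eq_zero fun x hx => sourceForm_eq_zero
        (notMem_tsupport_iff_eventuallyEq.2 (hPt x (subset_closure hx))), sub_zero]
  rw [hΛ t ht] at h0
  have hP0 : P ∅ = fun x => 1 - b x := by
    funext x
    simp only [P, Finset.prod_empty, mul_one]
  have h1 : ∀ x, sourceForm g y (fun x => 1 - b x) x = -sourceForm g y b x := by
    intro x
    rw [sourceForm_sub contDiff_const hb, sourceForm_const, zero_sub]
  have h2 : ∫ x in closure V \ V, P ∅ x • boundaryForm g y V x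
        ∂(Measure.euclideanHausdorffMeasure m) =
      ∫ x in closure V \ V, boundaryForm g y V x ∂(Measure.euclideanHausdorffMeasure m) := by
    refine setIntegral_congr_fun h.isCompact_boundary.isClosed.measurableSet fun x hx => ?_
    simp only [hP0, hbS x hx, sub_zero, one_smul]
  simp only [Λ] at h0
  rw [h2, hP0] at h0
  simp only [h1, integral_neg] at h0
  rw [hbV] at h0
  rw [sub_neg_eq_add] at h0
  exact eq_neg_of_add_eq_zero_left h0

end SphereFormula

/-! ### The glued manifold as a round sphere -/

section WedgeSphere

variable {n : ℕ} {r : ℝ}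

/-- The height of the upper boundary circle of the annulus. -/
def rimHeight (r : ℝ) : ℝ := 1 - 2 / (r ^ 2 + 1)


theorem reflect_last (x : Euc (n + 1)) : (reflect x) (Fin.last n) = -x (Fin.last n) := by
  simp only [reflect, PiLp.sub_apply, PiLp.smul_apply, pole_last, smul_eq_mul]
  ring

theorem cayley_last (u : Euc n) : (cayley u) (Fin.last n) = 1 - 2 / (‖u‖ ^ 2 + 1) := by
  have h := one_sub_cayley_last u
  rw [confFactor, norm_den_sq] at h
  linarith

theorem exists_cayley_eq {x : Euc (n + 1)} (hx : ‖x‖ = 1) (h : x (Fin.last n) < 1) :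
    ∃ u, cayley u = x := by
  have hne : flip n false x ≠ pole n := by
    intro h0
    have h1 : x = pole n := h0
    rw [h1, pole_last] at h
    exact lt_irrefl _ h
  exact ⟨_, chart_chartInv hx hne⟩

theorem one_sub_two_div_lt_iff {a b : ℝ} (ha : 0 ≤ a) (hb : 0 ≤ b) :
    1 - 2 / (a ^ 2 + 1) < 1 - 2 / (b ^ 2 + 1) ↔ a < b := by
  rw [sub_lt_sub_iff_left, div_lt_div_iff_of_pos_left two_pos (by positivity) (by positivity),
    add_lt_add_iff_right, sq_lt_sq₀ ha hb]

theorem neg_rimHeight (hr : 0 < r) : -rimHeight r = 1 - 2 / ((1 / r) ^ 2 + 1) := by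
  rw [rimHeight]
  field_simp
  ring

theorem rimHeight_pos (hr : 1 < r) : 0 < rimHeight r := by
  have := (one_sub_two_div_lt_iff (a := 1) (b := r) zero_le_one (by linarith)).2 hr
  rw [rimHeight]
  norm_num at this ⊢
  linarith

theorem rimHeight_lt_one (r : ℝ) : rimHeight r < 1 := by
  have : 0 < 2 / (r ^ 2 + 1) := by positivity
  rw [rimHeight]
  linarith

/-- The height of `cayley u` increases with `‖u‖`, and the radii `r` and `1 / r` correspond to
opposite heights; so caps and annulus are described by the last coordinate. -/
theorem mem_cap_iff (hr : 1 < r) {x : Euc (n + 1)} :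
    x ∈ cap n r ↔ ‖x‖ = 1 ∧ -rimHeight r < x (Fin.last n) := by
  have hr0 : 0 < r := by linarith
  rw [cap, mem_sdiff, mem_sphere_zero_iff_norm]
  refine and_congr_right fun hx => ?_
  constructor
  · intro h
    by_contra hle
    have hlt : x (Fin.last n) < 1 := by linarith [rimHeight_pos hr]
    obtain ⟨u, rfl⟩ := exists_cayley_eq hx hlt
    refine h ⟨u, ?_, rfl⟩
    rw [cayley_last, neg_rimHeight hr0, one_sub_two_div_lt_iff (by positivity) (norm_nonneg _),
      not_lt] at hle
    simpa using hle
  · rintro h ⟨u, hu, rfl⟩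
    rw [cayley_last, neg_rimHeight hr0, one_sub_two_div_lt_iff (by positivity) (norm_nonneg _)] at h
    rw [mem_closedBall_zero_iff] at hu
    linarith

/-- The annulus lies between two opposite heights, so it is the overlap of the cap with its
reflection. -/
theorem mem_annulus_iff (hr : 1 < r) {x : Euc (n + 1)} :
    x ∈ annulus n r ↔ x ∈ cap n r ∧ reflect x ∈ cap n r := by
  have hr0 : 0 < r := by linarith
  rw [mem_cap_iff hr, mem_cap_iff hr, norm_reflect, reflect_last, neg_lt_neg_iff]
  constructor
  · rintro ⟨u, ⟨h1, h2⟩, rfl⟩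
    have h0 : ‖cayley u‖ = 1 := norm_chart false u
    refine ⟨⟨h0, ?_⟩, h0, ?_⟩
    · rw [cayley_last, neg_rimHeight hr0]
      exact (one_sub_two_div_lt_iff (by positivity) (norm_nonneg _)).2 h1
    · rw [cayley_last, rimHeight]
      exact (one_sub_two_div_lt_iff (norm_nonneg _) hr0.le).2 h2
  · rintro ⟨⟨hx, h1⟩, -, h2⟩
    obtain ⟨u, rfl⟩ := exists_cayley_eq hx (h2.trans (rimHeight_lt_one r))
    rw [cayley_last, neg_rimHeight hr0,
      one_sub_two_div_lt_iff (by positivity) (norm_nonneg _)] at h1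
    rw [cayley_last, rimHeight, one_sub_two_div_lt_iff (norm_nonneg _) hr0.le] at h2
    exact ⟨u, ⟨h1, h2⟩, rfl⟩

/-- What a cap omits has height at most `-rimHeight r`, which is negative for `r > 1`; its
reflection is thus high enough. Hence the two caps cover the sphere. -/
theorem reflect_mem_cap (hr : 1 < r) {x : Euc (n + 1)} (hx : ‖x‖ = 1) (h : x ∉ cap n r) :
    reflect x ∈ cap n r := by
  rw [mem_cap_iff hr, norm_reflect, reflect_last, neg_lt_neg_iff]
  rw [mem_cap_iff hr, not_and, not_lt] at h
  exact ⟨hx, by linarith [h hx, rimHeight_pos hr]⟩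

theorem norm_eq_one_of_mem_cap {x : Euc (n + 1)} (h : x ∈ cap n r) : ‖x‖ = 1 :=
  mem_sphere_zero_iff_norm.1 h.1

theorem cap_isOpen_inter (n : ℕ) (r : ℝ) :
    ∃ O : Set (Euc (n + 1)), IsOpen O ∧ cap n r = O ∩ sphere 0 1 := by
  refine ⟨(cayley '' closedBall (0 : Euc n) (1 / r))ᶜ, ?_, ?_⟩
  · exact ((isCompact_closedBall _ _).image (continuous_chart false)).isClosed.isOpen_compl
  · rw [cap, sdiff_eq, inter_comm]

theorem measurableSet_cap (n : ℕ) (r : ℝ) : MeasurableSet (cap n r) := by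
  obtain ⟨O, hO, h⟩ := cap_isOpen_inter n r
  rw [h]
  exact hO.measurableSet.inter isClosed_sphere.measurableSet

theorem eventually_mem_cap {x : Euc (n + 1)} (hx : x ∈ cap n r) :
    ∀ᶠ p in 𝓝[sphere 0 1] x, p ∈ cap n r := by
  obtain ⟨O, hO, h⟩ := cap_isOpen_inter n r
  rw [h] at hx ⊢
  filter_upwards [self_mem_nhdsWithin, mem_nhdsWithin_of_mem_nhds (hO.mem_nhds hx.1)] with p h1 h2
  exact ⟨h2, h1⟩

/-- The bounds on `‖u‖` hold automatically when a point and its reflection both lie in the cap. -/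
theorem glue_iff (hr : 1 < r) {p q : Caps n r} :
    Glue n r p q ↔ p.1 = 0 ∧ q.1 = 1 ∧ (q.2 : Euc (n + 1)) = reflect p.2 := by
  have hr0 : 0 < r := by linarith
  have hu0 : ∀ u : Euc n, 1 / r < ‖u‖ → u ≠ 0 := fun u hu =>
    norm_pos_iff.1 ((by positivity : 0 < 1 / r).trans hu)
  constructor
  · rintro ⟨u, h1, h2, hp, hq, hp2, hq2⟩
    exact ⟨hp, hq, by rw [hq2, hp2, reflect_cayley (hu0 u h1)]⟩
  · rintro ⟨hp, hq, h⟩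
    have : (p.2 : Euc (n + 1)) ∈ annulus n r :=
      (mem_annulus_iff hr).2 ⟨p.2.2, h ▸ q.2.2⟩
    obtain ⟨u, ⟨h1, h2⟩, h3⟩ := this
    exact ⟨u, h1, h2, hp, hq, h3.symm, by rw [h, ← h3, reflect_cayley (hu0 u h1)]⟩

/-- The chart index that corresponds to the sphere `S_j`. -/
def side (j : Fin 2) : Bool := decide (j = 1)

@[simp] theorem side_zero : side 0 = false := rfl

@[simp] theorem side_one : side 1 = true := rfl

theorem glue_imp (hr : 1 < r) (p q : Caps n r) (h : Glue n r p q) :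
    flip n (side p.1) p.2 = flip n (side q.1) q.2 := by
  obtain ⟨h1, h2, h3⟩ := (glue_iff hr).1 h
  rw [h1, h2, h3]
  simp [flip]

/-- The identification of the glued manifold with the first sphere. -/
def toSphere (hr : 1 < r) : Wedge n r → Euc (n + 1) :=
  Quot.lift (fun p : Caps n r => flip n (side p.1) p.2) (glue_imp hr)

variable (hr : 1 < r)

theorem toSphere_pt (j : Fin 2) {x : Euc (n + 1)} (h : x ∈ cap n r) :
    toSphere hr (pt j x h) = flip n (side j) x := rfl

theorem exists_pt_eq (p : Wedge n r) : ∃ j x, ∃ h : x ∈ cap n r, pt j x h = p := by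
  obtain ⟨⟨j, x, h⟩, rfl⟩ := Quot.exists_rep p
  exact ⟨j, x, h, rfl⟩

theorem norm_toSphere (p : Wedge n r) : ‖toSphere hr p‖ = 1 := by
  obtain ⟨j, x, h, rfl⟩ := exists_pt_eq p
  rw [toSphere_pt, norm_flip, norm_eq_one_of_mem_cap h]

theorem continuous_toSphere : Continuous (toSphere hr : Wedge n r → Euc (n + 1)) := by
  refine continuous_quot_lift _ (continuous_prod_of_discrete_left.2 fun j => ?_)
  exact (flip n (side j)).continuous.comp continuous_subtype_val

theorem toSphere_injective : Function.Injective (toSphere hr : Wedge n r → Euc (n + 1)) := by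
  intro p q h
  obtain ⟨i, x, hx, rfl⟩ := exists_pt_eq p
  obtain ⟨j, y, hy, rfl⟩ := exists_pt_eq q
  rw [toSphere_pt, toSphere_pt] at h
  fin_cases i <;> fin_cases j
  · have h' : x = y := (flip n (side 0)).injective h
    subst h'
    rfl
  · exact Quot.sound ((glue_iff hr).2 ⟨rfl, rfl, by
      have h' : x = reflect y := h
      simp [h']⟩)
  · exact (Quot.sound ((glue_iff hr).2 ⟨rfl, rfl, by
      have h' : reflect x = y := h
      simp [← h']⟩)).symm
  · have h' : x = y := (flip n (side 1)).injective h
    subst h'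
    rfl

theorem mem_part_iff {A : Set (Wedge n r)} {j : Fin 2} {x : Euc (n + 1)} :
    x ∈ part A j ↔ x ∈ cap n r ∧ flip n (side j) x ∈ toSphere hr '' A := by
  constructor
  · rintro ⟨h, hA⟩
    exact ⟨h, _, hA, rfl⟩
  · rintro ⟨h, p, hp, hpx⟩
    rw [← toSphere_pt hr j h] at hpx
    exact ⟨h, toSphere_injective hr hpx ▸ hp⟩

theorem exists_flip_mem_cap (hr : 1 < r) {x : Euc (n + 1)} (hx : ‖x‖ = 1) :
    ∃ j : Fin 2, flip n (side j) x ∈ cap n r := by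
  by_cases h : x ∈ cap n r
  · exact ⟨0, h⟩
  · exact ⟨1, reflect_mem_cap hr hx h⟩

theorem range_toSphere : range (toSphere hr : Wedge n r → Euc (n + 1)) = sphere 0 1 := by
  refine Subset.antisymm (range_subset_iff.2 fun p => ?_) fun x hx => ?_
  · rw [mem_sphere_zero_iff_norm, norm_toSphere]
  · obtain ⟨j, hj⟩ := exists_flip_mem_cap hr (mem_sphere_zero_iff_norm.1 hx)
    exact ⟨pt j _ hj, by rw [toSphere_pt, flip_flip]⟩

theorem part_isOpen_inter {A : Set (Wedge n r)} (hA : IsOpen A) (j : Fin 2) :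
    ∃ O : Set (Euc (n + 1)), IsOpen O ∧ part A j = O ∩ sphere 0 1 := by
  have h1 : Continuous fun x : cap n r => pt j (x : Euc (n + 1)) x.2 :=
    continuous_quot_mk.comp (continuous_const.prodMk continuous_id)
  obtain ⟨O, hO, h2⟩ := isOpen_induced_iff.1 (hA.preimage h1)
  obtain ⟨O', hO', h3⟩ := cap_isOpen_inter n r
  refine ⟨O ∩ O', hO.inter hO', ?_⟩
  rw [inter_assoc, ← h3]
  ext x
  constructor
  · rintro ⟨h, hx⟩
    exact ⟨(Set.ext_iff.1 h2 ⟨x, h⟩).2 hx, h⟩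
  · rintro ⟨hx, h⟩
    exact ⟨h, (Set.ext_iff.1 h2 ⟨x, h⟩).1 hx⟩

theorem image_toSphere_isOpen_inter {A : Set (Wedge n r)} (hA : IsOpen A) :
    ∃ O : Set (Euc (n + 1)), IsOpen O ∧ toSphere hr '' A = O ∩ sphere 0 1 := by
  choose O hO hO' using part_isOpen_inter hA
  refine ⟨⋃ j, flip n (side j) ⁻¹' O j,
    isOpen_iUnion fun j => (hO j).preimage (flip n (side j)).continuous, ?_⟩
  ext x
  constructor
  · rintro ⟨p, hp, rfl⟩
    refine ⟨?_, by rw [mem_sphere_zero_iff_norm, norm_toSphere]⟩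
    obtain ⟨j, x, h, rfl⟩ := exists_pt_eq p
    refine mem_iUnion.2 ⟨j, ?_⟩
    have : x ∈ part A j := ⟨h, hp⟩
    rw [hO'] at this
    simpa [toSphere_pt] using this.1
  · rintro ⟨hx, hx1⟩
    obtain ⟨j, hj⟩ := mem_iUnion.1 hx
    have : flip n (side j) x ∈ part A j := by
      rw [hO' j]
      exact ⟨hj, by rw [mem_sphere_zero_iff_norm, norm_flip]; simpa using hx1⟩
    simpa using ((mem_part_iff hr).1 this).2

/-- The map is a homeomorphism onto the sphere: images of open sets are relatively open because each
`S'_j` is open in its sphere. -/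
theorem isClosedEmbedding_toSphere : IsClosedEmbedding (toSphere hr : Wedge n r → Euc (n + 1)) := by
  refine ⟨⟨⟨?_⟩, toSphere_injective hr⟩, by rw [range_toSphere]; exact isClosed_sphere⟩
  refine le_antisymm (continuous_iff_le_induced.1 (continuous_toSphere hr)) fun A hA => ?_
  obtain ⟨O, hO, h⟩ := image_toSphere_isOpen_inter hr hA
  refine isOpen_induced_iff.2 ⟨O, hO, ?_⟩
  rw [← (toSphere_injective hr).preimage_image A, h, ← range_toSphere hr,
    preimage_inter_range]

theorem image_frontier {V : Set (Wedge n r)} (hV : IsOpen V) :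
    toSphere hr '' frontier V = closure (toSphere hr '' V) \ toSphere hr '' V := by
  rw [hV.frontier_eq, image_sdiff (toSphere_injective hr),
    (isClosedEmbedding_toSphere hr).closure_image_eq]

end WedgeSphere

/-! ### Transport of normals by the reflection -/

section Transport

variable {n : ℕ} {r : ℝ}

theorem tendsto_flip (κ : Bool) (x : Euc (n + 1)) :
    Filter.Tendsto (flip n κ) (𝓝[sphere 0 1] x) (𝓝[sphere 0 1] (flip n κ x)) := by
  refine tendsto_nhdsWithin_iff.2
    ⟨((flip n κ).continuous.tendsto x).mono_left nhdsWithin_le_nhds, ?_⟩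
  filter_upwards [self_mem_nhdsWithin] with p hp
  rw [mem_sphere_zero_iff_norm, norm_flip]
  simpa using hp

theorem IsOutwardNormal.flip {V : Set (Euc (n + 1))} {x ν : Euc (n + 1)} (κ : Bool)
    (h : IsOutwardNormal V (flip n κ x) ν) :
    IsOutwardNormal (GluedSpheres.flip n κ ⁻¹' V) x (GluedSpheres.flip n κ ν) := by
  have key : ∀ a : Euc (n + 1), inner ℝ a (GluedSpheres.flip n κ ν) =
      inner ℝ (GluedSpheres.flip n κ a) ν := fun a => by
    conv_lhs => rw [← flip_flip κ a]
    exact (GluedSpheres.flip n κ).inner_map_map _ _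
  refine ⟨by rw [norm_flip, h.1], by rw [key, h.2.1], fun ε hε => ?_⟩
  filter_upwards [(tendsto_flip κ x).eventually (h.2.2 ε hε)] with p hp
  rwa [key, map_sub, ← norm_flip κ (p - x), map_sub]

theorem outwardNormal_preimage_flip {V : Set (Euc (n + 1))} {x : Euc (n + 1)} (κ : Bool)
    (hx : ‖x‖ = 1) :
    outwardNormal (flip n κ ⁻¹' V) x = flip n κ (outwardNormal V (flip n κ x)) := by
  by_cases h : ∃ ν, IsOutwardNormal V (flip n κ x) ν
  · obtain ⟨ν, hν⟩ := h
    rw [hν.outwardNormal_eq (by rw [norm_flip, hx]), (hν.flip κ).outwardNormal_eq hx]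
  · rw [outwardNormal_eq_zero (not_exists.1 h), map_zero]
    refine outwardNormal_eq_zero fun ν hν => h ⟨flip n κ ν, ?_⟩
    have h1 := IsOutwardNormal.flip (V := flip n κ ⁻¹' V) (x := flip n κ x) (ν := ν) κ
      (by rwa [flip_flip])
    rwa [← preimage_comp, show flip n κ ∘ flip n κ = id from funext (flip_flip κ),
      preimage_id] at h1

/-- The normal depends only on the germ of the set, and near a point of the cap the part of `V` is
the reflected image of `V`. -/
theorem outwardNormal_part (hr : 1 < r) {V : Set (Wedge n r)} {j : Fin 2} {x : Euc (n + 1)}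
    (hx : x ∈ cap n r) :
    outwardNormal (part V j) x =
      flip n (side j) (outwardNormal (toSphere hr '' V) (flip n (side j) x)) := by
  rw [← outwardNormal_preimage_flip _ (norm_eq_one_of_mem_cap hx)]
  refine outwardNormal_congr ?_
  filter_upwards [eventually_mem_cap hx] with p hp
  rw [mem_part_iff hr, and_iff_right hp, mem_preimage]

/-- The reflection of a chart as a measure preserving map. -/
theorem measurePreserving_flip (κ : Bool) (d : ℕ) :
    MeasurePreserving (flip n κ) (Measure.euclideanHausdorffMeasure d)
      (Measure.euclideanHausdorffMeasure d) :=
  (IsometryEquiv.mk' (flip n κ) (flip n κ) (flip_flip κ)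
    (flip n κ).isometry).measurePreserving_euclideanHausdorffMeasure d

theorem measurableEmbedding_flip (κ : Bool) : MeasurableEmbedding (flip n κ) :=
  (flip n κ).isometry.isClosedEmbedding.measurableEmbedding

end Transport

/-! ### Sections of the spinor bundle as functions on the sphere -/

section Sections

variable {n : ℕ} {r : ℝ}

open Classical in
/-- A section over the glued manifold as a function on the first sphere. -/
def sphereSection (r : ℝ) (F : Fin 2 → Euc (n + 1) → Cl (n + 1)) (x : Euc (n + 1)) : Cl (n + 1) :=
  if x ∈ cap n r then F 0 x else vec (pole n) * F 1 (reflect x)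

variable {U V S : Set (Wedge n r)} {F : Fin 2 → Euc (n + 1) → Cl (n + 1)}

/-- For the second sphere this is the definition off the overlap and the transition rule, whose
weight is `e`, on the overlap. -/
theorem sphereSection_flip (hr : 1 < r) (hF : IsHolomorphicSection U F) {j : Fin 2}
    {x : Euc (n + 1)} (hx : x ∈ part U j) :
    sphereSection r F (flip n (side j) x) = twist n (side j) * F j x := by
  have hc : x ∈ cap n r := hx.1
  fin_cases j
  · change sphereSection r F x = 1 * F 0 x
    rw [sphereSection, if_pos hc, one_mul]
  · change sphereSection r F (reflect x) = vec (pole n) * F 1 x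
    by_cases h : reflect x ∈ cap n r
    · have h0 : reflect x ∈ part U 0 := by
        rw [mem_part_iff hr]
        exact ⟨h, ((mem_part_iff hr).1 hx).2⟩
      rw [sphereSection, if_pos h,
        hF.glue _ ⟨h0, (mem_annulus_iff hr).2 ⟨h, by rwa [reflect_reflect]⟩⟩, weight_pole_zero,
        reflect_reflect]
    · rw [sphereSection, if_neg h, reflect_reflect]

theorem flip_chart_eq (κ κ' : Bool) (u : Euc n) : flip n κ' (chart κ u) = chart (xor κ κ') u := by
  cases κ <;> cases κ' <;> simp [flip, chart]

/-- The twist exchanges the weights of the two charts up to a constant sign, which is `-1` only when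
`e` is met twice. -/
theorem weight_mul_twist (n : ℕ) (κ κ' : Bool) :
    ∃ s : ℝ, ∀ u : Euc n, weight n (chartDen κ u) * twist n κ' =
      s • weight n (chartDen (xor κ κ') u) := by
  simp only [weight_chartDen]
  cases κ <;> cases κ'
  · exact ⟨1, fun u => by simp [twist]⟩
  · exact ⟨1, fun u => by simp [twist]⟩
  · exact ⟨1, fun u => by simp [twist]⟩
  · exact ⟨-1, fun u => by
      simp only [twist, if_true, Bool.bne_true, Bool.not_true, Bool.false_eq_true, if_false,
        smul_mul_assoc, mul_assoc, vec_pole_mul_self, mul_neg, mul_one, smul_neg, neg_smul,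
        one_smul]⟩

theorem dirac_const_smul {h : Euc n → Cl (n + 1)} {u : Euc n} (hd : DifferentiableAt ℝ h u)
    (s : ℝ) : dirac (fun v => s • h v) u = s • dirac h u := by
  rw [dirac, dirac, Finset.smul_sum]
  refine Finset.sum_congr rfl fun i _ => ?_
  rw [fderiv_fun_const_smul hd, smul_apply, mul_smul_comm]

/-- Every chart of the sphere is, after the reflection of one copy, a chart of that copy; the
representatives differ by a constant sign, to which the Dirac equation is insensitive. -/
theorem isLeftMonogenicAt_sphereSection (hr : 1 < r) (hU : IsOpen U)
    (hF : IsHolomorphicSection U F) {κ : Bool} {u : Euc n}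
    (hu : chart κ u ∈ toSphere hr '' U) :
    IsLeftMonogenicAt (localRep (sphereSection r F) κ) u := by
  obtain ⟨j, hj⟩ := exists_flip_mem_cap hr (norm_chart κ u)
  have hj' : flip n (side j) (chart κ u) ∈ part U j :=
    (mem_part_iff hr).2 ⟨hj, by rwa [flip_flip]⟩
  rw [flip_chart_eq] at hj'
  obtain ⟨-, hd, h0⟩ := hF.holomorphic j (xor κ (side j)) u hj'
  obtain ⟨s, hs⟩ := weight_mul_twist n κ (side j)
  have hev : localRep (sphereSection r F) κ =ᶠ[𝓝 u] fun v =>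
      s • (weight n (chartDen (xor κ (side j)) v) * F j (chart (xor κ (side j)) v)) := by
    obtain ⟨O, hO, hOU⟩ := part_isOpen_inter hU j
    have : ∀ᶠ v in 𝓝 u, chart (xor κ (side j)) v ∈ O :=
      (continuous_chart _).continuousAt.eventually_mem (hO.mem_nhds (hOU ▸ hj').1)
    filter_upwards [this] with v hv
    have hv' : chart (xor κ (side j)) v ∈ part U j := by
      rw [hOU]
      exact ⟨hv, by rw [mem_sphere_zero_iff_norm, norm_chart]⟩
    have h1 := sphereSection_flip hr hF hv'
    rw [← flip_chart_eq, flip_flip] at h1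
    rw [localRep, h1, ← mul_assoc, hs, smul_mul_assoc, flip_chart_eq]
  refine ⟨(hd.const_smul s).congr_of_eventuallyEq hev, ?_⟩
  rw [dirac, hev.fderiv_eq, ← dirac, dirac_const_smul hd, h0, smul_zero]

/-- Reflection acts on vectors by `x ↦ e x e`. In the product of kernel, normal and section the
inner factors `e` cancel in pairs, and the left-over constant, which depends only on the sheet of
`y`, is the inverse of the twist relating `F j` to the function on the sphere. -/
theorem cauchyIntegrand_eq (hr : 1 < r) (hF : IsHolomorphicSection U F) {i j : Fin 2}
    {x y : Euc (n + 1)} (hx : x ∈ part U i) :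
    cauchyIntegrand V F j y i x = (sgn (side j) • twist n (side j)) *
      (cauchyG n (flip n (side i) x - flip n (side j) y) *
        vec (outwardNormal (toSphere hr '' V) (flip n (side i) x)) *
          sphereSection r F (flip n (side i) x)) := by
  have hp : ∀ a : Cl (n + 1), vec (pole n) * (vec (pole n) * a) = -a := fun a => by
    rw [← mul_assoc, vec_pole_mul_self, neg_one_mul]
  rw [cauchyIntegrand, outwardNormal_part hr hx.1, sphereSection_flip hr hF hx, vec_flip]
  generalize outwardNormal (toSphere hr '' V) (flip n (side i) x) = ν
  fin_cases i <;> fin_cases j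
  · simp [cauchyKernel, twist, sgn, flip]
  · simp [cauchyKernel, twist, sgn, flip, weight_pole_one, mul_assoc]
  · have h : x - reflect (reflect y) = x - y := by rw [reflect_reflect]
    have h2 : x - reflect y = reflect (reflect x - y) := by rw [reflect_sub, reflect_reflect]
    simp [cauchyKernel, twist, sgn, flip, weight_pole_zero, h2, cauchyG_reflect, mul_assoc, hp]
  · have h2 : reflect x - reflect y = reflect (x - y) := by rw [reflect_sub]
    simp [cauchyKernel, twist, sgn, flip, h2, cauchyG_reflect, mul_assoc, hp]

/-- The piece of the sphere that is covered by the sheet `i`. -/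
def sheetImage (n : ℕ) (r : ℝ) (i : Fin 2) : Set (Euc (n + 1)) :=
  if i = 0 then cap n r else (cap n r)ᶜ

theorem measurableSet_sheetImage (n : ℕ) (r : ℝ) (i : Fin 2) :
    MeasurableSet (sheetImage n r i) := by
  unfold sheetImage
  split_ifs
  · exact measurableSet_cap n r
  · exact (measurableSet_cap n r).compl

/-- A point that is not in the first cap is represented only in the second one. So the two sheets
correspond to a cap and its complement, and no boundary point is counted twice. -/
theorem sheet_eq (hr : 1 < r) (i : Fin 2) :
    sheet S i = flip n (side i) ⁻¹' (toSphere hr '' S ∩ sheetImage n r i) := by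
  ext x
  fin_cases i
  · change x ∈ part S 0 ↔ x ∈ toSphere hr '' S ∧ x ∈ cap n r
    rw [mem_part_iff hr, and_comm]
    rfl
  · change x ∈ part S 1 ∧ x ∉ annulus n r ↔ reflect x ∈ toSphere hr '' S ∧ reflect x ∉ cap n r
    rw [mem_part_iff hr, mem_annulus_iff hr]
    change (x ∈ cap n r ∧ reflect x ∈ toSphere hr '' S) ∧ _ ↔ _
    constructor
    · rintro ⟨⟨h1, h2⟩, h3⟩
      exact ⟨h2, fun h4 => h3 ⟨h1, h4⟩⟩
    · rintro ⟨⟨p, hp, hpx⟩, h2⟩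
      refine ⟨⟨?_, p, hp, hpx⟩, fun h3 => h2 h3.2⟩
      have hx : ‖reflect x‖ = 1 := by rw [← hpx, norm_toSphere]
      simpa using reflect_mem_cap hr hx h2

theorem sheet_subset_part (S : Set (Wedge n r)) (i : Fin 2) : sheet S i ⊆ part S i := by
  unfold sheet
  split_ifs with h
  · rw [h]
  · rw [show i = 1 by omega]
    exact sdiff_subset

theorem part_mono {A B : Set (Wedge n r)} (h : A ⊆ B) (i : Fin 2) : part A i ⊆ part B i :=
  fun _ hx => ⟨hx.1, h hx.2⟩

end Sections

/-! ### The Cauchy formula on the glued manifold, from the one on the sphere. -/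

section Formula

variable {m : ℕ} {r : ℝ} {U V S : Set (Wedge (m + 1) r)}
  {F : Fin 2 → Euc (m + 2) → Cl (m + 2)}

/-- The reflection of the second copy only exchanges the two charts, so the Möbius patches of `S`
serve unchanged on the sphere. -/
theorem isCauchyDomain_toSphere (hr : 1 < r) (hU : IsOpen U) (hF : IsHolomorphicSection U F)
    (hS : IsStronglyLipschitz S) (hSU : S ⊆ U) (hV : IsOpen V) (hVU : V ⊆ U)
    (hVS : frontier V = S) :
    IsCauchyDomain (toSphere hr '' U) (toSphere hr '' V) (sphereSection r F) where
  isOpen := image_toSphere_isOpen_inter hr hV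
  isOpen_outer := image_toSphere_isOpen_inter hr hU
  closure_subset := by
    rw [(isClosedEmbedding_toSphere hr).closure_image_eq, closure_eq_self_union_frontier, hVS]
    exact image_mono (union_subset hVU hSU)
  monogenic κ u hu := isLeftMonogenicAt_sphereSection hr hU hF hu
  lipschitz p hp := by
    rw [← image_frontier hr hV, hVS] at hp ⊢
    obtain ⟨q, hq, rfl⟩ := hp
    obtain ⟨L, hL⟩ := hS
    obtain ⟨j, κ, W, T, w, φ, hW, hT, hw, hφ, hcap, ⟨u, hu, h, rfl⟩, hgraph⟩ := hL q hq
    refine ⟨xor κ (side j), W, T, w, φ, L, hW, hT, hw, hφ, ⟨u, hu, ?_⟩, fun v hv => ?_⟩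
    · rw [toSphere_pt, flip_chart_eq]
    · rw [← hgraph v hv, mem_part_iff hr, and_iff_right (hcap v hv), flip_chart_eq]

/-- The boundary integral on the sphere is split along the cap and carried to the two sheets by
isometries. The constant left factor of the integrand then removes the twist from the value of the
spherical section at `y`. -/
theorem cauchy_formula_wedge (hr : 1 < r) (hU : IsOpen U) (hF : IsHolomorphicSection U F)
    (hS : IsStronglyLipschitz S) (hSU : S ⊆ U) (hV : IsOpen V) (hVU : V ⊆ U)
    (hVS : frontier V = S) {j : Fin 2} {y : Euc (m + 2)} (hy : y ∈ part V j) :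
    (∀ i : Fin 2, IntegrableOn (cauchyIntegrand V F j y i) (sheet S i)
      (Measure.euclideanHausdorffMeasure m)) ∧
    F j y = -(sphereArea (m + 1))⁻¹ • ∑ i : Fin 2, ∫ x in sheet S i, cauchyIntegrand V F j y i x
      ∂(Measure.euclideanHausdorffMeasure m) := by
  have hD := isCauchyDomain_toSphere hr hU hF hS hSU hV hVU hVS
  have hy' := ((mem_part_iff hr).1 hy).2
  have hint := hD.integrableOn_boundaryForm hy'
  have hform := hD.cauchy_formula hy'
  set B := boundaryForm (sphereSection r F) (flip (m + 1) (side j) y) (toSphere hr '' V) with hB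
  rw [← image_frontier hr hV, hVS] at hint hform
  set c : Cl (m + 2) := sgn (side j) • twist (m + 1) (side j) with hc
  have hmeas : ∀ i, MeasurableSet (sheet S i) := fun i => by
    have h1 : MeasurableSet (toSphere hr '' S) := by
      rw [← hVS]
      exact ((isClosedEmbedding_toSphere hr).isClosedMap _ isClosed_frontier).measurableSet
    rw [sheet_eq hr]
    exact (measurableEmbedding_flip _).measurable (h1.inter (measurableSet_sheetImage _ r i))
  have hcongr : ∀ i, EqOn (cauchyIntegrand V F j y i)
      (fun x => mulL _ c (B (flip (m + 1) (side i) x))) (sheet S i) := fun i x hx =>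
    cauchyIntegrand_eq hr hF (part_mono hSU i (sheet_subset_part S i hx))
  have hintB : ∀ i, IntegrableOn (fun x => B (flip (m + 1) (side i) x)) (sheet S i)
      (Measure.euclideanHausdorffMeasure m) := fun i => by
    rw [sheet_eq hr]
    exact ((measurePreserving_flip (side i) m).integrableOn_comp_preimage
      (measurableEmbedding_flip _)).2 (hint.mono_set inter_subset_left)
  refine ⟨fun i => ?_, ?_⟩
  · exact ((mulL _ c).integrable_comp (hintB i)).congr
      ((ae_restrict_iff' (hmeas i)).2 (Filter.Eventually.of_forall fun x hx => (hcongr i hx).symm))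
  have hI : ∀ i, ∫ x in sheet S i, cauchyIntegrand V F j y i x
      ∂(Measure.euclideanHausdorffMeasure m) =
      mulL _ c (∫ x in toSphere hr '' S ∩ sheetImage (m + 1) r i, B x
        ∂(Measure.euclideanHausdorffMeasure m)) := fun i => by
    rw [setIntegral_congr_fun (hmeas i) (hcongr i),
      (mulL _ c).integral_comp_comm (hintB i)]
    congr 1
    rw [sheet_eq hr]
    exact (measurePreserving_flip (side i) m).setIntegral_preimage_emb
      (measurableEmbedding_flip _) B _
  have hsum : (∫ x in toSphere hr '' S ∩ sheetImage (m + 1) r 0, B x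
        ∂(Measure.euclideanHausdorffMeasure m)) +
      (∫ x in toSphere hr '' S ∩ sheetImage (m + 1) r 1, B x
        ∂(Measure.euclideanHausdorffMeasure m)) =
      -(sphereArea (m + 1) • sphereSection r F (flip (m + 1) (side j) y)) := by
    rw [← hform]
    exact integral_inter_add_sdiff (measurableSet_cap (m + 1) r) hint
  have h0 := (sphereArea_pos m).ne'
  rw [Fin.sum_univ_two, hI, hI, ← map_add, hsum,
    sphereSection_flip hr hF (part_mono hVU j hy), mulL_apply, mul_neg, mul_smul_comm, smul_neg,
    smul_smul, neg_mul, inv_mul_cancel₀ h0, neg_smul, one_smul, neg_neg, ← mul_assoc, hc,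
    smul_mul_assoc, twist_mul_self, smul_smul, sgn_mul_self, one_smul, one_mul]

end Formula

end GluedSpheres

end

theorem theorem1 (n : ℕ) (hn : 2 ≤ n) (r : ℝ) (hr : 1 < r)
    (U : Set (GluedSpheres.Wedge n r)) (hU : IsOpen U) (hUc : IsConnected U)
    (F : Fin 2 → GluedSpheres.Euc (n + 1) → GluedSpheres.Cl (n + 1))
    (hF : GluedSpheres.IsHolomorphicSection U F)
    (S : Set (GluedSpheres.Wedge n r)) (hS : GluedSpheres.IsStronglyLipschitz S) (hSU : S ⊆ U)
    (V : Set (GluedSpheres.Wedge n r)) (hV : IsOpen V) (hVc : IsConnected V) (hVU : V ⊆ U)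
    (hVS : frontier V = S)
    (j : Fin 2) (y : GluedSpheres.Euc (n + 1)) (hy : y ∈ GluedSpheres.part V j) :
    (∀ i : Fin 2, MeasureTheory.IntegrableOn (GluedSpheres.cauchyIntegrand V F j y i)
      (GluedSpheres.sheet S i) (MeasureTheory.Measure.euclideanHausdorffMeasure (n - 1))) ∧
    F j y = -(GluedSpheres.sphereArea n)⁻¹ •
      ∑ i : Fin 2, ∫ x in GluedSpheres.sheet S i,
        GluedSpheres.cauchyIntegrand V F j y i x
          ∂(MeasureTheory.Measure.euclideanHausdorffMeasure (n - 1)) := by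
  obtain ⟨m, rfl⟩ := Nat.exists_eq_add_of_le' (one_le_two.trans hn)
  exact GluedSpheres.cauchy_formula_wedge hr hU hF hS hSU hV hVU hVS hy
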